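/- **Setting.** Let $T>0$, let $(V,\mathcal V,\pi)$ be a $\sigma$-finite measure space, $U=[0,T]\times V$, $d\mu=dt\,d\pi$, and $\mathbf H=L^2(U,\mu)$, with a countable complete orthonormal system $(m_k)$. Let $\mathfrak N$ be a driving cylindrical random field, i.e. an isometric linear map $\mathbf H\to L^2(\Omega,\mathbf P)$ with $\mathbf E\,\mathfrak N(g)=0$, and put $\xi_k=\mathfrak N(m_k)$. Let $J$ be the set of multiindices $\alpha=(\alpha_k)$, $\alpha_k\in\{0,1,2,\dots\}$, with $|\alpha|=\sum_k\alpha_k<\infty$; $\alpha!=\prod_k\alpha_k!$, $z^\alpha=\prod_k z_k^{\alpha_k}$, and $\varepsilon_k$ is the multiindex with the single nonzero entry $1$ at $k$. Assume: * (B1) for every $(\xi_{i_1},\dots,\xi_{i_n})$ the moment generating function $\mathbf E\exp\{\sum_j t_j\xi_{i_j}\}$ is finite for $t$ in a neighbourhood of $0$; * (B2) there is an orthogonal system $(\tilde K_\alpha)_{\alpha\in J}$ of nonzero elements of $L^2(\mathbf P)$ with $\tilde K_0=1$ such that, for each $n$, $\{\tilde K_p:|p|\le n\}$ and $\{\xi^p:|p|\le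 n\}$ span the same closed subspace $H_n$, and $\tilde K_\alpha=\xi^\alpha-\mathrm{proj}_{H_n}\xi^\alpha$ for $|\alpha|=n+1$. Put $\mathfrak N_\alpha=c_\alpha\tilde K_\alpha$ with $c_\alpha>0$ such that $\mathbf E\,\mathfrak N_\alpha^2=\alpha!$. $\mathcal D'$ is the space of formal series $u=\sum_\alpha u_\alpha\mathfrak N_\alpha$, $u_\alpha\in\mathbf R$. An $X\in L^2(\mathbf P)$ is identified with $\sum_\alpha\frac{\mathbf E[X\mathfrak N_\alpha]}{\alpha!}\mathfrak N_\alpha$ where it enters Wick products, and $\mathbf E[u^2]$ denotes $\mathbf E[X^2]$ if $\sum_\alpha u_\alpha\mathfrak N_\alpha$ converges to $X$ in $L^2(\mathbf P)$, and $+\infty$ if the series does not converge. $C\mathcal D'$ is the class of $u(t)=\sum_\alpha u_\alpha(t)\mathfrak N_\alpha$ with all $u_\alpha$ continuous on $[0,T]$. The Wick product is $(u\diamond v)_\alpha=\sum_{\beta\le\alpha}u_\beta v_{\alpha-\beta}$, $\exp^\diamond u=\sum_{k\ge0}u^{\diamond k}/k!$, and for a field $g(s,\upsilon)=\sum_\alpha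 g_\alpha(s,\upsilon)\mathfrak N_\alpha$ with all $g_\alpha\in L^2(\mu)$, $$\int_0^t\!\!\int g\diamond\mathfrak N(ds,d\upsilon)=\sum_\alpha\ \sum_{k:\,\alpha_k\ge1}\int_{[0,t]\times V}g_{\alpha-\varepsilon_k}\,m_k\,d\mu\ \mathfrak N_\alpha .$$ $\mathcal S'$ is the class of $w\in\mathcal D'$ with $\sum_{|\alpha|=n}\alpha!\,w_\alpha^2<\infty$ for all $n$; $\mathcal S'(\mathbf H)$ is the class of fields $f$ with $\sum_{|\alpha|=n}\alpha!\int f_\alpha^2d\mu<\infty$ for all $n$; $C\mathcal S'$ is the class of processes $u$ with $u(t)\in\mathcal S'$ for all $t\in[0,T]$ that are continuous on $[0,T]$ in each of the seminorms $(\sum_{|\alpha|=n}\alpha!\,u_\alpha^2)^{1/2}$. For $|\alpha|=n$ let $E_\alpha=\sum_{\sigma}m_{k_{\sigma(1)}}\otimes\dots\otimes m_{k_{\sigma(n)}}$, the sum being over all permutations $\sigma$ of $\{1,\dots,n\}$ and $k_1,\dots,k_n$ listing each $k$ with multiplicity $\alpha_k$. Then $u\in\mathcal S'$ is called $\mathcal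 F_t$-measurable if for each $n$ its kernel $\sum_{|\alpha|=n}u_\alpha E_\alpha\in L^2(U^n)$ vanishes a.e. outside $([0,t]\times V)^n$. A process $u(t)$ is adapted if $u(t)$ is $\mathcal F_t$-measurable for every $t\in[0,T]$, and a field $f(t,\upsilon)$ is adapted if $f(t,\upsilon)$ is $\mathcal F_t$-measurable for $\mu$-a.e. $(t,\upsilon)$. For $G\in L^2(\mu)$ put $H_k(s,t)=\int_{[s,t]\times V}Gm_k\,d\mu$, $$\|w\|^2=\sum_\alpha\alpha!\,w_\alpha^2+\sup_{t\in[0,T]}\sum_\alpha\alpha!\Big(\sum_{\beta\le\alpha}w_{\alpha-\beta}\tfrac{H(0,t)^\beta}{\beta!}\Big)^2,\qquad \|f\|_T^2=\sup_{t\in[0,T]}\sum_\alpha\alpha!\,F_\alpha(t)^2+\sum_\alpha\alpha!\int f_\alpha^2\,d\mu,$$ $$F_\alpha(t)=\sum_{k:\,\alpha_k\ge1}\int_{[0,t]\times V}\ \sum_{\beta\le\alpha-\varepsilon_k}f_{\alpha-\varepsilon_k-\beta}(s,\upsilon)\,m_k(s,\upsilon)\tfrac{H(s,t)^\beta}{\beta!}\,d\mu(s,\upsilon).$$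 **Proposition.** Let $G\in L^2(\mu)$. There is a constant $C$ depending only on $T,\pi,G$ such that for all $\mathfrak N$, $(m_k)$, $(\tilde K_\alpha)$ as above, every $w\in\mathcal D'$ and every field $f=\sum_\alpha f_\alpha(t,\upsilon)\mathfrak N_\alpha$ with all $f_\alpha\in L^2(\mu)$: (i) The equation $u(t)=w+\int_0^t\!\int[u(s)G(s,\upsilon)+f(s,\upsilon)]\diamond\mathfrak N(ds,d\upsilon)$, $0\le t\le T$, has exactly one solution $u$ in $C\mathcal D'$, and for $0\le t\le T$ $$u(t)=w\diamond\exp^\diamond\{\mathfrak N(\chi_{[0,t]}G)\}+\int_0^t\!\!\int\exp^\diamond\{\mathfrak N(\chi_{[s,t]}G)\}\diamond f(s,\upsilon)\diamond\mathfrak N(ds,d\upsilon)=\sum_\alpha\Big(F_\alpha(t)+\sum_{\beta\le\alpha}w_{\alpha-\beta}\tfrac{H(0,t)^\beta}{\beta!}\Big)\mathfrak N_\alpha.$$ (ii) The Picard iterations $u^0(t)=w+\int_0^t\!\int f\diamond\mathfrak N(ds,d\upsilon)$, $u^{n+1}(t)=w+\int_0^t\!\int[u^nG+f]\diamond\mathfrak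 N(ds,d\upsilon)$ lie in $C\mathcal D'$ and converge to $u$ in $\mathcal D'$ (coefficientwise), uniformly in $t\in[0,T]$, and $$u^n(t)=w\diamond\sum_{k=0}^n\frac{\mathfrak N(\chi_{[0,t]}G)^{\diamond k}}{k!}+\int_0^t\!\!\int\sum_{k=0}^n\frac{\mathfrak N(\chi_{[s,t]}G)^{\diamond k}}{k!}\diamond f(s,\upsilon)\diamond\mathfrak N(ds,d\upsilon).$$ If $f\in\mathcal S'(\mathbf H)$ and $w\in\mathcal S'$, then $u^n,u\in C\mathcal S'$. (iii) $\sup_{t\in[0,T]}\mathbf E[u(t)^2]\le2(\|w\|^2+\|f\|_T^2)$ (both sides in $[0,\infty]$). (iv) If $w=w_0$ is deterministic and $f$ is adapted with $\mathbf E\int_U|f|^2d\mu<\infty$, then $u$ is adapted and square integrable, and $\sup_{t\in[0,T]}\mathbf E[u(t)^2]\le C\big(w_0^2+\mathbf E\int_U|f|^2d\mu\big)$. -/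

import Mathlib

open MeasureTheory Set Filter Topology
open scoped ENNReal NNReal Nat

namespace WickSDE

noncomputable section

/-! ### The driving field and its chaos basis -/

/-- The measure `dt dπ` of `U = [0,T] × V`, carried by `ℝ × V`. -/
abbrev timeMeasure {V : Type*} [MeasurableSpace V] (T : ℝ) (π : Measure V) : Measure (ℝ × V) :=
  ((volume : Measure ℝ).restrict (Icc 0 T)).prod π

/-- A driving cylindrical random field on `(U, μ)`: an isometric linear map from `L²(μ)` to
`L²(P)` with centred values. -/
structure DrivingField {U Ω : Type*} [MeasurableSpace U] [MeasurableSpace Ω]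
    (μ : Measure U) (P : Measure Ω) where
  toIsometry : Lp ℝ 2 μ →ₗᵢ[ℝ] Lp ℝ 2 P
  mean_zero : ∀ f : Lp ℝ 2 μ, ∫ ω, toIsometry f ω ∂P = 0

/-- Multiindices `α = (α_k)` with finitely many nonzero entries. The length `|α|` is
`Finsupp.degree α`, and `ε_k` is `Finsupp.single k 1`. -/
abbrev MultiIndex (ι : Type*) := ι →₀ ℕ

/-- `α! = ∏ₖ α_k!`. -/
def mfactorial {ι : Type*} (α : MultiIndex ι) : ℕ := α.prod fun _ n => n !

/-- `z^α = ∏ₖ z_k ^ α_k`. -/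
def mpow {ι : Type*} (z : ι → ℝ) (α : MultiIndex ι) : ℝ := α.prod fun k n => z k ^ n

section Chaos

variable {U Ω ι : Type*} [MeasurableSpace U] [MeasurableSpace Ω] {μ : Measure U} {P : Measure Ω}

/-- `ξ_k = N(m_k)`. -/
def xi (N : DrivingField μ P) (m : HilbertBasis ι ℝ (Lp ℝ 2 μ)) (k : ι) : Lp ℝ 2 P :=
  N.toIsometry (m k)

/-- Assumption B1: the moment generating function of each vector `(ξ_{i_1}, …, ξ_{i_n})` exists in
a neighbourhood of `0`. -/
def AssumptionB1 (N : DrivingField μ P) (m : HilbertBasis ι ℝ (Lp ℝ 2 μ)) : Prop :=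
  ∀ (n : ℕ) (i : Fin n → ι), ∀ᶠ t in 𝓝 (0 : Fin n → ℝ),
    Integrable (fun ω => Real.exp (∑ j, t j * xi N m (i j) ω)) P

/-- The random variable `ξ^α`. -/
def xiMonomial (N : DrivingField μ P) (m : HilbertBasis ι ℝ (Lp ℝ 2 μ)) (α : MultiIndex ι) :
    Ω → ℝ :=
  fun ω => mpow (fun k => xi N m k ω) α

theorem memLp_xi {N : DrivingField μ P} {m : HilbertBasis ι ℝ (Lp ℝ 2 μ)}
    (h : AssumptionB1 N m) (k : ι) (p : ℝ≥0) : MemLp (fun ω => xi N m k ω) p P := by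
  apply ProbabilityTheory.memLp_of_mem_interior_integrableExpSet
  rw [mem_interior_iff_mem_nhds]
  have h1 := h 1 (fun _ => k)
  have h2 : Tendsto (fun s : ℝ => (fun _ : Fin 1 => s)) (𝓝 0) (𝓝 (0 : Fin 1 → ℝ)) := by
    have : Continuous (fun s : ℝ => (fun _ : Fin 1 => s)) := by fun_prop
    exact this.tendsto 0
  have h3 := h2.eventually h1
  filter_upwards [h3] with s hs
  simpa [ProbabilityTheory.integrableExpSet] using hs

theorem memLp_xiMonomial [IsProbabilityMeasure P] {N : DrivingField μ P}
    {m : HilbertBasis ι ℝ (Lp ℝ 2 μ)} (h : AssumptionB1 N m) (α : MultiIndex ι) :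
    MemLp (xiMonomial N m α) 2 P := by
  classical
  have hpow : ∀ k (p : ℝ≥0), MemLp (fun ω => xi N m k ω ^ α k) p P := by
    intro k p
    have h1 := MemLp.prod' (s := Finset.range (α k)) (f := fun _ ω => xi N m k ω)
      (p := fun _ => ((p * (α k : ℝ≥0) : ℝ≥0) : ℝ≥0∞)) (μ := P) (fun i _ => memLp_xi h k _)
    simp only [Finset.prod_const, Finset.card_range, Finset.sum_const, nsmul_eq_mul] at h1
    refine h1.mono_exponent ?_
    rw [ENNReal.le_inv_iff_mul_le]
    rcases eq_or_ne (α k) 0 with h0 | h0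
    · simp [h0]
    rcases eq_or_ne p 0 with hp | hp
    · simp [hp]
    have : (p : ℝ≥0∞) * ((α k : ℝ≥0∞) * ((p * (α k : ℝ≥0) : ℝ≥0) : ℝ≥0∞)⁻¹)
        = ((p * (α k : ℝ≥0) : ℝ≥0) : ℝ≥0∞) * ((p * (α k : ℝ≥0) : ℝ≥0) : ℝ≥0∞)⁻¹ := by
      rw [← mul_assoc]; push_cast; rfl
    rw [this]
    exact ENNReal.mul_inv_le_one _
  have h1 := MemLp.prod' (s := α.support) (f := fun k ω => xi N m k ω ^ α k)
      (p := fun _ => (((2 : ℝ≥0) * (α.support.card : ℝ≥0) : ℝ≥0) : ℝ≥0∞)) (μ := P)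
      (fun i _ => hpow i _)
  refine MemLp.mono_exponent h1 ?_
  simp only [Finset.sum_const, nsmul_eq_mul]
  rw [ENNReal.le_inv_iff_mul_le]
  have : (2 : ℝ≥0∞) * ((α.support.card : ℝ≥0∞) *
        ((2 * (α.support.card : ℝ≥0) : ℝ≥0) : ℝ≥0∞)⁻¹)
      = ((2 * (α.support.card : ℝ≥0) : ℝ≥0) : ℝ≥0∞) *
        ((2 * (α.support.card : ℝ≥0) : ℝ≥0) : ℝ≥0∞)⁻¹ := by
    rw [← mul_assoc]; push_cast; rfl
  rw [this]
  exact ENNReal.mul_inv_le_one _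

/-- `ξ^α` as an element of `L²(P)`. -/
def xiMonomialLp [IsProbabilityMeasure P] {N : DrivingField μ P}
    {m : HilbertBasis ι ℝ (Lp ℝ 2 μ)} (h : AssumptionB1 N m) (α : MultiIndex ι) : Lp ℝ 2 P :=
  (memLp_xiMonomial h α).toLp _

/-- The closed subspace `H_n` of `L²(P)` generated by `ξ^p`, `|p| ≤ n`. -/
def chaosUpTo [IsProbabilityMeasure P] {N : DrivingField μ P}
    {m : HilbertBasis ι ℝ (Lp ℝ 2 μ)} (h : AssumptionB1 N m) (n : ℕ) :
    Submodule ℝ (Lp ℝ 2 P) :=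
  (Submodule.span ℝ (xiMonomialLp h '' {p | p.degree ≤ n})).topologicalClosure

instance [IsProbabilityMeasure P] {N : DrivingField μ P}
    {m : HilbertBasis ι ℝ (Lp ℝ 2 μ)} (h : AssumptionB1 N m) (n : ℕ) :
    CompleteSpace (chaosUpTo h n) :=
  (Submodule.isClosed_topologicalClosure _).completeSpace_coe

/-- Assumption B2: `K` is an orthogonalization of the system `ξ^α` in which `K_α`, `|α| = n + 1`,
is obtained from `ξ^α` by subtracting its projection on `H_n`. -/
structure AssumptionB2 [IsProbabilityMeasure P] {N : DrivingField μ P}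
    {m : HilbertBasis ι ℝ (Lp ℝ 2 μ)} (h : AssumptionB1 N m)
    (K : MultiIndex ι → Lp ℝ 2 P) : Prop where
  orthogonal : ∀ α β, α ≠ β → ∫ ω, K α ω * K β ω ∂P = 0
  span_eq : ∀ n, (Submodule.span ℝ (K '' {p | p.degree ≤ n})).topologicalClosure = chaosUpTo h n
  zero : K 0 = xiMonomialLp h 0
  succ : ∀ n α, α.degree = n + 1 →
    K α = xiMonomialLp h α - (chaosUpTo h n).starProjection (xiMonomialLp h α)

/-- `𝔑_α = c_α K_α`, where `c_α > 0` is such that `E 𝔑_α² = α!`. -/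
def chaosBasis (K : MultiIndex ι → Lp ℝ 2 P) (α : MultiIndex ι) : Lp ℝ 2 P :=
  (√(mfactorial α : ℝ) / ‖K α‖) • K α

end Chaos

/-! ### Generalized random variables -/

/-- Real generalized random variables: the formal series `u = ∑_α u_α 𝔑_α`, given by their
coefficients. -/
abbrev GenRV (ι : Type*) := MultiIndex ι → ℝ

section GenRV

variable {U Ω ι V : Type*} [MeasurableSpace U] [MeasurableSpace Ω] [MeasurableSpace V]
  {μ : Measure U} {P : Measure Ω}

/-- The action `⟨u, v⟩ = ∑_α v_α u_α` on a test random variable `v` (a finite series). -/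
def pairing (u : GenRV ι) (v : MultiIndex ι →₀ ℝ) : ℝ := v.sum fun α c => c * u α

/-- The second moment `E[u²]` of a generalized random variable `u`: if `∑_α u_α 𝔑_α` converges in
`L²(P)` to a random variable `X`, this is `E[X²]`; otherwise it is `∞`. -/
def secondMoment (K : MultiIndex ι → Lp ℝ 2 P) (u : GenRV ι) : ℝ≥0∞ :=
  ⨅ (X : Lp ℝ 2 P) (_ : HasSum (fun α => u α • chaosBasis K α) X), ∫⁻ ω, ‖X ω‖ₑ ^ 2 ∂P

/-- The formal series `∑_α (E[X 𝔑_α] / α!) 𝔑_α` of a square integrable random variable `X`. -/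
def chaosExpansion (K : MultiIndex ι → Lp ℝ 2 P) (X : Lp ℝ 2 P) : GenRV ι :=
  fun α => (∫ ω, X ω * chaosBasis K α ω ∂P) / mfactorial α

open Classical in
/-- The Wick product: `(u ⋄ v)_α = ∑_{β ≤ α} u_β v_{α-β}`. -/
def wick (u v : GenRV ι) : GenRV ι :=
  fun α => ∑ q ∈ Finset.HasAntidiagonal.antidiagonal α, u q.1 * v q.2

open Classical in
/-- The constant `1 = 𝔑_0`. -/
def wickOne : GenRV ι := fun α => if α = 0 then 1 else 0

/-- Wick powers `u^{⋄n}`. -/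
def wickPow (u : GenRV ι) : ℕ → GenRV ι
  | 0 => wickOne
  | n + 1 => wick (wickPow u n) u

/-- The partial sums `∑_{k ≤ n} u^{⋄k} / k!`. -/
def wickExpTrunc (n : ℕ) (u : GenRV ι) : GenRV ι :=
  fun α => ∑ k ∈ Finset.range (n + 1), wickPow u k α / (k ! : ℝ)

/-- The Wick exponential `exp^⋄ u = ∑_k u^{⋄k} / k!`. -/
def wickExp (u : GenRV ι) : GenRV ι :=
  fun α => ∑' k : ℕ, wickPow u k α / (k ! : ℝ)

/-- The Skorokhod integral `δ(u) = ∫_U u(x) ⋄ N(dx)`: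
`δ(u)_α = ∑_{|p| = 1, p ≤ α} ∫ u_{α-p}(x) E_p(x) dμ`, where `E_p = m_k` for `p = ε_k`. -/
def skorokhod (m : HilbertBasis ι ℝ (Lp ℝ 2 μ)) (u : U → GenRV ι) : GenRV ι :=
  fun α => ∑ k ∈ α.support, ∫ x, u x (α - Finsupp.single k 1) * m k x ∂μ

/-- Measurable fields `f = ∑_α f_α(x) 𝔑_α` with `∫ |f_α|² dμ < ∞` for every `α`. -/
def MemL2D (μ : Measure U) (f : U → GenRV ι) : Prop :=
  ∀ α, MemLp (fun x => f x α) 2 μ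

/-- For `u = ∑_α u_α 𝔑_α`, the squared norm `∑_{|α| = n} n! α! |u_α|²` of the kernel
`∑_{|α| = n} u_α E_α` of order `n`. -/
def kernelNormSq (n : ℕ) (u : GenRV ι) : ℝ≥0∞ :=
  ∑' α : {α : MultiIndex ι // α.degree = n},
    ((n ! * mfactorial α.1 : ℕ) : ℝ≥0∞) * ‖u α.1‖ₑ ^ 2

/-- The class `𝒮'(ℝ)`: all the kernels are square integrable. -/
def MemS (u : GenRV ι) : Prop := ∀ n, kernelNormSq n u < ∞

/-- The class `𝒮'(𝐇, ℝ)`, `𝐇 = L²(μ)`: all the `𝐇`-valued kernels are square integrable. -/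
def MemSH (μ : Measure U) (f : U → GenRV ι) : Prop :=
  ∀ n : ℕ, ∑' α : {α : MultiIndex ι // α.degree = n},
    ((n ! * mfactorial α.1 : ℕ) : ℝ≥0∞) * ∫⁻ x, ‖f x α.1‖ₑ ^ 2 ∂μ < ∞

/-- The class `C𝒟'([0,T]; ℝ)`: all the coefficients are continuous on `[0,T]`. -/
def MemCD (T : ℝ) (u : ℝ → GenRV ι) : Prop := ∀ α, ContinuousOn (fun t => u t α) (Icc 0 T)

/-- The class `C𝒮'([0,T]; ℝ)`: all the kernels are continuous on `[0,T]` in the norm of the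
square integrable symmetric functions. -/
def MemCS (T : ℝ) (u : ℝ → GenRV ι) : Prop :=
  (∀ t ∈ Icc 0 T, MemS (u t)) ∧
    ∀ n, ∀ t₀ ∈ Icc 0 T,
      Tendsto (fun t => kernelNormSq n (u t - u t₀)) (𝓝[Icc 0 T] t₀) (𝓝 0)

/-! ### Adaptedness -/

/-- The symmetric function `∑_σ m_{k_σ(1)} ⊗ … ⊗ m_{k_σ(n)}` on `U^n`. -/
def symTensor (m : HilbertBasis ι ℝ (Lp ℝ 2 μ)) {n : ℕ} (k : Fin n → ι) (x : Fin n → U) : ℝ :=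
  ∑ σ : Equiv.Perm (Fin n), ∏ i, m (k (σ i)) (x i)

open Classical in
/-- For `|α| = n`, the function `E_α = ∑_σ m_{k_σ(1)} ⊗ … ⊗ m_{k_σ(n)}`, where `(k_1, …, k_n)` is
any listing of indices in which each `k` occurs `α_k` times. -/
def symBasis (m : HilbertBasis ι ℝ (Lp ℝ 2 μ)) (n : ℕ) (α : MultiIndex ι) (x : Fin n → U) : ℝ :=
  if h : ∃ k : Fin n → ι, ∑ i, Finsupp.single (k i) 1 = α then symTensor m h.choose x else 0

open Classical in
/-- `F` is the kernel of order `n` of `u`: `F = ∑_{|α| = n} u_α E_α` in `L²(U^n)`. -/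
def IsKernel (m : HilbertBasis ι ℝ (Lp ℝ 2 μ)) (n : ℕ) (u : GenRV ι) (F : (Fin n → U) → ℝ) :
    Prop :=
  MemLp F 2 (Measure.pi fun _ : Fin n => μ) ∧
    Tendsto (fun s : Finset (MultiIndex ι) =>
        eLpNorm (fun x => F x - ∑ α ∈ s with α.degree = n, u α * symBasis m n α x) 2
          (Measure.pi fun _ : Fin n => μ))
      atTop (𝓝 0)

/-- `u` is `ℱ_t`-measurable: it has a square integrable kernel of each order `n`, supported
in `([0,t] × V)^n`. -/
def IsMeasurableAt {μ : Measure (ℝ × V)} (m : HilbertBasis ι ℝ (Lp ℝ 2 μ)) (t : ℝ) (u : GenRV ι) :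
    Prop :=
  ∀ n : ℕ, ∃ F : (Fin n → ℝ × V) → ℝ, IsKernel m n u F ∧
    ∀ᵐ x ∂(Measure.pi fun _ : Fin n => μ), (∃ i, t < (x i).1) → F x = 0

/-- Adapted fields on `U = [0,T] × V`. -/
def AdaptedField {μ : Measure (ℝ × V)} (m : HilbertBasis ι ℝ (Lp ℝ 2 μ))
    (f : ℝ × V → GenRV ι) : Prop :=
  ∀ᵐ x ∂μ, IsMeasurableAt m x.1 (f x)

/-- Adapted processes on `[0,T]`. -/
def AdaptedProcess {μ : Measure (ℝ × V)} (m : HilbertBasis ι ℝ (Lp ℝ 2 μ)) (T : ℝ)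
    (u : ℝ → GenRV ι) : Prop :=
  ∀ t ∈ Icc 0 T, IsMeasurableAt m t (u t)

end GenRV

/-! ### The linear equation -/

section SDE

variable {V Ω ι : Type*} [MeasurableSpace V] [MeasurableSpace Ω]
  {μ : Measure (ℝ × V)} {P : Measure Ω}

/-- The subset `[s,t] × V` of `ℝ × V`. -/
def slab (V : Type*) (s t : ℝ) : Set (ℝ × V) := Icc s t ×ˢ univ

theorem measurableSet_slab (s t : ℝ) : MeasurableSet (slab V s t) :=
  measurableSet_Icc.prod MeasurableSet.univ

/-- `χ_{[s,t]} G` as an element of `L²(μ)`. -/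
def sliceLp (G : Lp ℝ 2 μ) (s t : ℝ) : Lp ℝ 2 μ :=
  ((Lp.memLp G).indicator (measurableSet_slab s t)).toLp ((slab V s t).indicator G)

/-- The generalized random variable `N(χ_{[s,t]} G)`. -/
def sliceNoise (N : DrivingField μ P) (K : MultiIndex ι → Lp ℝ 2 P) (G : Lp ℝ 2 μ) (s t : ℝ) :
    GenRV ι :=
  chaosExpansion K (N.toIsometry (sliceLp G s t))

/-- `∫_0^t ∫ u(s,υ) ⋄ N(ds,dυ) = δ(χ_{[0,t]} u)`. -/
def skorokhodTo (m : HilbertBasis ι ℝ (Lp ℝ 2 μ)) (t : ℝ) (u : ℝ × V → GenRV ι) : GenRV ι :=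
  skorokhod m ((slab V 0 t).indicator u)

/-- The right-hand side `w + ∫_0^t ∫ [u(s) G(s,υ) + f(s,υ)] ⋄ N(ds,dυ)` of the equation. -/
def sdeMap (m : HilbertBasis ι ℝ (Lp ℝ 2 μ)) (G : Lp ℝ 2 μ) (w : GenRV ι)
    (f : ℝ × V → GenRV ι) (u : ℝ → GenRV ι) (t : ℝ) : GenRV ι :=
  w + skorokhodTo m t (fun x => G x • u x.1 + f x)

/-- Solutions of the equation in `C𝒟'([0,T]; ℝ)`. -/
def IsSolution (m : HilbertBasis ι ℝ (Lp ℝ 2 μ)) (T : ℝ) (G : Lp ℝ 2 μ) (w : GenRV ι)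
    (f : ℝ × V → GenRV ι) (u : ℝ → GenRV ι) : Prop :=
  MemCD T u ∧ ∀ t ∈ Icc 0 T, u t = sdeMap m G w f u t

/-- The Picard iterations. -/
def picard (m : HilbertBasis ι ℝ (Lp ℝ 2 μ)) (G : Lp ℝ 2 μ) (w : GenRV ι)
    (f : ℝ × V → GenRV ι) : ℕ → ℝ → GenRV ι
  | 0 => fun t => w + skorokhodTo m t f
  | n + 1 => sdeMap m G w f (picard m G w f n)

/-- `H_k(s,t) = ∫ χ_{[s,t]} G m_k dμ`. -/
def slicedCoeff (m : HilbertBasis ι ℝ (Lp ℝ 2 μ)) (G : Lp ℝ 2 μ) (s t : ℝ) (k : ι) : ℝ :=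
  ∫ x, (slab V s t).indicator G x * m k x ∂μ

open Classical in
/-- The coefficient `∑_{β ≤ α} w_{α-β} H(0,t)^β / β!`. -/
def initialCoeff (m : HilbertBasis ι ℝ (Lp ℝ 2 μ)) (G : Lp ℝ 2 μ) (w : GenRV ι) (t : ℝ) :
    GenRV ι :=
  fun α => ∑ q ∈ Finset.HasAntidiagonal.antidiagonal α,
    w q.1 * (mpow (slicedCoeff m G 0 t) q.2 / mfactorial q.2)

open Classical in
/-- The coefficient
`∑_{|p| = 1} ∫_0^t ∫ ∑_{β + p ≤ α} f_{α-p-β}(s,υ) E_p(s,υ) H(s,t)^β / β! dμ`. -/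
def forcingCoeff (m : HilbertBasis ι ℝ (Lp ℝ 2 μ)) (G : Lp ℝ 2 μ) (f : ℝ × V → GenRV ι) (t : ℝ) :
    GenRV ι :=
  fun α => ∑ k ∈ α.support, ∫ x in slab V 0 t,
    ∑ q ∈ Finset.HasAntidiagonal.antidiagonal (α - Finsupp.single k 1),
      f x q.1 * m k x * (mpow (slicedCoeff m G x.1 t) q.2 / mfactorial q.2) ∂μ

/-- `‖w‖² = ∑_α α! |w_α|² + sup_t ∑_α α! (∑_{β ≤ α} w_{α-β} H(0,t)^β / β!)²`. -/
def initialNormSq (m : HilbertBasis ι ℝ (Lp ℝ 2 μ)) (T : ℝ) (G : Lp ℝ 2 μ) (w : GenRV ι) : ℝ≥0∞ :=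
  (∑' α, (mfactorial α : ℝ≥0∞) * ‖w α‖ₑ ^ 2) +
    ⨆ t ∈ Icc 0 T, ∑' α, (mfactorial α : ℝ≥0∞) * ‖initialCoeff m G w t α‖ₑ ^ 2

/-- `‖f‖_T² = sup_t ∑_α α! (∑_{|p| = 1} ∫_0^t ∫ ∑_{β + p ≤ α} f_{α-p-β} E_p H(s,t)^β / β! dμ)²
+ ∑_α α! ∫ |f_α|² dμ`. -/
def forcingNormSq (m : HilbertBasis ι ℝ (Lp ℝ 2 μ)) (T : ℝ) (G : Lp ℝ 2 μ)
    (f : ℝ × V → GenRV ι) : ℝ≥0∞ :=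
  (⨆ t ∈ Icc 0 T, ∑' α, (mfactorial α : ℝ≥0∞) * ‖forcingCoeff m G f t α‖ₑ ^ 2) +
    ∑' α, (mfactorial α : ℝ≥0∞) * ∫⁻ x, ‖f x α‖ₑ ^ 2 ∂μ

/-- `E ∫_U |f|² dμ`. -/
def meanSquare (K : MultiIndex ι → Lp ℝ 2 P) (μ : Measure (ℝ × V)) (f : ℝ × V → GenRV ι) : ℝ≥0∞ :=
  ∫⁻ x, secondMoment K (f x) ∂μ

end SDE

end

end WickSDE

open WickSDE

/-! Read coefficient by coefficient, the equation is a triangular system: the coefficient at `α` of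
a Skorokhod integral involves only coefficients of the integrand of degree `|α| - 1`
(`sdeMap_congr`). Hence uniqueness is an induction on `|α|`, and each coefficient of the Picard
iterates is eventually constant in `n`.

The solution comes from variation of constants. `N(g)` has only the first-order coefficients `⟨g,
m_k⟩`, so the Wick exponential of `N(χ_{[s,t]} G)` has coefficients `e_β(s,t) = H(s,t)^β / β!`. The
chain rule for absolutely continuous functions gives `e_β(s,t) = 1_{β=0} + ∑_k ∫_{[s,t]×V} G m_k
e_{β-ε_k}(s,·) dμ` (`slabExp_eq`). Substituting the Duhamel series into the equation and exchanging
the two time integrals then reproduces the series (`sdeMap_duhamel`). That lemma allows different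
kernels before and after the substitution: equal ones give the solution, truncations at consecutive
degrees give the Picard iterates.

Orthogonality turns the second moment into `∑ α! u_α²`, and (iii) is `(a+b)² ≤ 2(a²+b²)` in each
coefficient. For the continuity in `C𝒮'`, a weighted Cauchy-Schwarz inequality bounds level `n+1` of
a Skorokhod integral by `n+1` times level `n` of its integrand (`levelSq_skorokhod_le`).

Part (iv) must avoid that factor, since it has to sum over all levels. The kernel of order `n+1` of
the integral of `g` is the sum of `n+1` copies of `X(x,y) = ∑ g_β(x) E_β(y)`, the `p`-th variable
playing the role of `x` in copy `p`. For adapted `g`, copy `p` lives where the `p`-th time is the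
latest. The copies are thus disjointly supported up to ties, which form a null set, and the Itô
isometry follows (`levelSq_skorokhodTo_eq`); the same support property carries adaptedness from one
order to the next. The resulting inequality `level_{n+1}(u(t)) ≤ 2(∫ G² level_n(u) dμ + level_n(f))`
is iterated in a Gronwall fashion and sums to a constant involving `exp(2 ∫ G² dμ)`. -/

namespace WickSDE

/-! ### Multiindices and Wick powers -/

section Combinatorics

variable {ι : Type*}

theorem single_le_of_mem_support {α : MultiIndex ι} {k : ι} (h : k ∈ α.support) :
    Finsupp.single k 1 ≤ α := by
  classical
  rw [Finsupp.single_le_iff]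
  exact Nat.one_le_iff_ne_zero.2 (Finsupp.mem_support_iff.1 h)

theorem sub_single_add {α : MultiIndex ι} {k : ι} (h : k ∈ α.support) :
    α - Finsupp.single k 1 + Finsupp.single k 1 = α :=
  tsub_add_cancel_of_le (single_le_of_mem_support h)

theorem mem_support_add_single (β : MultiIndex ι) (k : ι) :
    k ∈ (β + Finsupp.single k 1).support := by
  simp

theorem degree_sub_single {α : MultiIndex ι} {k : ι} {n : ℕ} (h : k ∈ α.support)
    (hα : α.degree = n + 1) : (α - Finsupp.single k 1).degree = n := by
  have h1 := congrArg Finsupp.degree (sub_single_add h)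
  rw [map_add, Finsupp.degree_single] at h1
  omega

theorem degree_sub_single_lt {α : MultiIndex ι} {k : ι} (h : k ∈ α.support) :
    (α - Finsupp.single k 1).degree < α.degree := by
  have h1 := congrArg Finsupp.degree (sub_single_add h)
  rw [map_add, Finsupp.degree_single] at h1
  omega

theorem degree_eq_one_iff {α : MultiIndex ι} :
    α.degree = 1 ↔ ∃ k, α = Finsupp.single k 1 := by
  constructor
  · intro h
    have hne : α ≠ 0 := by rintro rfl; simp at h
    obtain ⟨k, hk⟩ := Finsupp.support_nonempty_iff.2 hne
    refine ⟨k, ?_⟩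
    have h1 := degree_sub_single hk h
    rw [Finsupp.degree_eq_zero_iff] at h1
    rw [← sub_single_add hk, h1, zero_add]
  · rintro ⟨k, rfl⟩
    simp

@[simp] theorem mfactorial_zero : mfactorial (0 : MultiIndex ι) = 1 := by
  simp [mfactorial]

@[simp] theorem mpow_zero (z : ι → ℝ) : mpow z 0 = 1 := by
  simp [mpow]

theorem mfactorial_pos (α : MultiIndex ι) : 0 < mfactorial α :=
  Finset.prod_pos fun _ _ => Nat.factorial_pos _

theorem mfactorial_cast_ne_zero (α : MultiIndex ι) : (mfactorial α : ℝ) ≠ 0 :=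
  Nat.cast_ne_zero.2 (mfactorial_pos α).ne'

theorem mpow_add (z : ι → ℝ) (α β : MultiIndex ι) : mpow z (α + β) = mpow z α * mpow z β := by
  classical
  exact Finsupp.prod_add_index' (fun _ => pow_zero _) (fun _ _ _ => pow_add _ _ _)

theorem mpow_single (z : ι → ℝ) (k : ι) (n : ℕ) : mpow z (Finsupp.single k n) = z k ^ n := by
  simp [mpow]

theorem mfactorial_add_single (β : MultiIndex ι) (k : ι) :
    mfactorial (β + Finsupp.single k 1) = (β k + 1) * mfactorial β := by
  classical
  unfold mfactorial
  have h1 : ∀ γ : MultiIndex ι, γ.support ⊆ insert k β.support →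
      (γ.prod fun _ n => n !) = ∏ i ∈ insert k β.support, (γ i)! := fun γ hγ =>
    Finsupp.prod_of_support_subset γ hγ (fun _ n => n !) (by simp)
  rw [h1, h1 β (Finset.subset_insert _ _)]
  · rw [← Finset.mul_prod_erase _ _ (Finset.mem_insert_self k _),
      ← Finset.mul_prod_erase (insert k β.support) (fun i => (β i)!) (Finset.mem_insert_self k _)]
    rw [← mul_assoc]
    congr 1
    · simp [Nat.factorial_succ]
    · refine Finset.prod_congr rfl fun i hi => ?_
      have : i ≠ k := Finset.ne_of_mem_erase hi
      simp [this.symm]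
  · intro i hi
    by_cases hk : i = k
    · simp [hk]
    · simp only [Finset.mem_insert, Finsupp.mem_support_iff]
      right
      simpa [Finsupp.single_apply, Ne.symm hk] using hi

theorem mfactorial_single_one (k : ι) : mfactorial (Finsupp.single k 1) = 1 := by
  simpa using mfactorial_add_single 0 k

theorem mfactorial_eq_mul {α : MultiIndex ι} {k : ι} (h : k ∈ α.support) :
    mfactorial α = α k * mfactorial (α - Finsupp.single k 1) := by
  conv_lhs => rw [← sub_single_add h]
  rw [mfactorial_add_single]
  have : α k ≠ 0 := Finsupp.mem_support_iff.1 h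
  simp [Nat.sub_add_cancel (Nat.one_le_iff_ne_zero.2 this)]

theorem sum_support_eq_degree (α : MultiIndex ι) : ∑ k ∈ α.support, α k = α.degree := rfl

open Classical in
-- Both sums run over the triples `(p, k, q)` with `p + ε_k + q = α`; on the right `ε_k` has been
-- merged into the second summand. This is the degree shift needed to recognise the recursion for
-- the kernels.
theorem sum_support_antidiagonal {M : Type*} [AddCommMonoid M] (α : MultiIndex ι)
    (X : MultiIndex ι → ι → MultiIndex ι → M) :
    ∑ k ∈ α.support, ∑ q ∈ Finset.HasAntidiagonal.antidiagonal (α - Finsupp.single k 1),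
        X q.1 k q.2 =
      ∑ q ∈ Finset.HasAntidiagonal.antidiagonal α,
        ∑ k ∈ q.2.support, X q.1 k (q.2 - Finsupp.single k 1) := by
  rw [Finset.sum_sigma', Finset.sum_sigma']
  refine Finset.sum_bij' (fun x _ => ⟨(x.2.1, x.2.2 + Finsupp.single x.1 1), x.1⟩)
    (fun y _ => ⟨y.2, (y.1.1, y.1.2 - Finsupp.single y.2 1)⟩) ?_ ?_ ?_ ?_ ?_
  · rintro ⟨k, q⟩ h
    simp only [Finset.mem_sigma, Finset.HasAntidiagonal.mem_antidiagonal] at h ⊢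
    refine ⟨?_, mem_support_add_single _ _⟩
    rw [← add_assoc, h.2, sub_single_add h.1]
  · rintro ⟨q, k⟩ h
    simp only [Finset.mem_sigma, Finset.HasAntidiagonal.mem_antidiagonal] at h ⊢
    have hk : k ∈ α.support := by
      rw [← h.1]
      have := Finsupp.mem_support_iff.1 h.2
      simp only [Finsupp.mem_support_iff, Finsupp.add_apply]
      omega
    refine ⟨hk, ?_⟩
    rw [← h.1, add_tsub_assoc_of_le (single_le_of_mem_support h.2)]
  · rintro ⟨k, q⟩ h
    simp
  · rintro ⟨q, k⟩ h
    simp only [Finset.mem_sigma] at h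
    simp [sub_single_add h.2]
  · rintro ⟨k, q⟩ h
    simp

open Classical in
theorem sum_antidiagonal_degree_one {M : Type*} [AddCommMonoid M] (α : MultiIndex ι)
    (X : MultiIndex ι → MultiIndex ι → M) (hX : ∀ p q, q.degree ≠ 1 → X p q = 0) :
    ∑ q ∈ Finset.HasAntidiagonal.antidiagonal α, X q.1 q.2 =
      ∑ k ∈ α.support, X (α - Finsupp.single k 1) (Finsupp.single k 1) := by
  symm
  refine Finset.sum_bij_ne_zero (fun k _ _ => (α - Finsupp.single k 1, Finsupp.single k 1))
    ?_ ?_ ?_ ?_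
  · intro k hk _
    simp [Finset.HasAntidiagonal.mem_antidiagonal, sub_single_add hk]
  · intro k _ _ l _ _ h
    have := (Prod.ext_iff.1 h).2
    exact (Finsupp.single_left_injective one_ne_zero) this
  · rintro ⟨p, q⟩ h hne
    have h1 : q.degree = 1 := by
      by_contra h2
      exact hne (hX p q h2)
    obtain ⟨k, rfl⟩ := degree_eq_one_iff.1 h1
    rw [Finset.HasAntidiagonal.mem_antidiagonal] at h
    dsimp only at h
    subst h
    exact ⟨k, mem_support_add_single _ _, by simpa using hne, by simp⟩
  · intros
    rfl

/-- The summation range is the condition `ε_k + ε_l ≤ α`, which is symmetric in `k` and `l`. -/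
theorem sum_support_comm {M : Type*} [AddCommMonoid M] (α : MultiIndex ι) (X : ι → ι → M) :
    ∑ k ∈ α.support, ∑ l ∈ (α - Finsupp.single k 1).support, X k l =
      ∑ l ∈ α.support, ∑ k ∈ (α - Finsupp.single l 1).support, X k l := by
  classical
  refine Finset.sum_comm' fun k l => ?_
  simp only [Finsupp.mem_support_iff, Finsupp.coe_tsub, Pi.sub_apply, Finsupp.single_apply]
  by_cases h : k = l
  · subst h; exact and_comm
  · simp only [h, Ne.symm h, if_false, Nat.sub_zero]

end Combinatorics

/-! ### Wick powers and exponentials of first-order series -/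

section WickPowers

variable {ι : Type*}

/-- The series `∑_k a_k 𝔑_{ε_k}`. -/
noncomputable def linearSeries (a : ι → ℝ) : GenRV ι :=
  fun α => if α.degree = 1 then mpow a α else 0

/-- The coefficients `a^α / α!`. -/
noncomputable def expCoeff (a : ι → ℝ) : GenRV ι := fun α => mpow a α / mfactorial α

/-- The coefficients `a^α / α!`, `|α| < n`. -/
noncomputable def expCoeffTrunc (n : ℕ) (a : ι → ℝ) : GenRV ι :=
  fun α => if α.degree < n then expCoeff a α else 0

/-- The multinomial theorem. In the induction, splitting `ε_k` off `α` contributes `α_k` times `n!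
a^α / α!`, and `∑ α_k = n + 1`. -/
theorem wickPow_linearSeries (a : ι → ℝ) (n : ℕ) (α : MultiIndex ι) :
    wickPow (linearSeries a) n α = if α.degree = n then (n ! : ℝ) * expCoeff a α else 0 := by
  classical
  induction n generalizing α with
  | zero =>
    by_cases h : α = 0
    · subst h; simp [wickPow, wickOne, expCoeff]
    · rw [if_neg (fun h2 => h (Finsupp.degree_eq_zero_iff _ |>.1 h2))]
      simp [wickPow, wickOne, h]
  | succ n ih =>
    rw [wickPow, wick, sum_antidiagonal_degree_one α
      (fun p q => wickPow (linearSeries a) n p * linearSeries a q)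
      (fun p q hq => by simp [linearSeries, hq])]
    by_cases h : α.degree = n + 1
    · rw [if_pos h]
      have h1 : ∀ k ∈ α.support, wickPow (linearSeries a) n (α - Finsupp.single k 1) *
          linearSeries a (Finsupp.single k 1) = n ! * expCoeff a α * α k := by
        intro k hk
        rw [ih, if_pos (degree_sub_single hk h)]
        simp only [linearSeries, Finsupp.degree_single, if_true, expCoeff]
        rw [mfactorial_eq_mul hk]
        nth_rewrite 3 [← sub_single_add hk]
        rw [mpow_add]
        have h2 : (α k : ℝ) ≠ 0 := Nat.cast_ne_zero.2 (Finsupp.mem_support_iff.1 hk)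
        have h3 := mfactorial_cast_ne_zero (α - Finsupp.single k 1)
        push_cast
        field_simp
      rw [Finset.sum_congr rfl h1, ← Finset.mul_sum, ← Nat.cast_sum, sum_support_eq_degree, h,
        Nat.factorial_succ]
      push_cast
      ring
    · rw [if_neg h]
      refine Finset.sum_eq_zero fun k hk => ?_
      rw [ih, if_neg, zero_mul]
      intro h2
      apply h
      have h1 := congrArg Finsupp.degree (sub_single_add hk)
      rw [map_add, Finsupp.degree_single] at h1
      omega

/-- Only the power `k = |α|` contributes at `α`, so the series defining the exponential has a single
nonzero term. -/
theorem wickExp_linearSeries (a : ι → ℝ) : wickExp (linearSeries a) = expCoeff a := by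
  ext α
  rw [wickExp, tsum_eq_single α.degree]
  · rw [wickPow_linearSeries, if_pos rfl]
    field_simp
  · intro n hn
    rw [wickPow_linearSeries, if_neg hn.symm, zero_div]

theorem wickExpTrunc_linearSeries (n : ℕ) (a : ι → ℝ) :
    wickExpTrunc n (linearSeries a) = expCoeffTrunc (n + 1) a := by
  ext α
  simp only [wickExpTrunc, wickPow_linearSeries, expCoeffTrunc]
  split_ifs with h
  · rw [Finset.sum_eq_single_of_mem α.degree (Finset.mem_range.2 h)]
    · rw [if_pos rfl]
      field_simp
    · intro k _ hk
      rw [if_neg hk.symm, zero_div]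
  · refine Finset.sum_eq_zero fun k hk => ?_
    rw [if_neg, zero_div]
    rintro rfl
    exact h (Finset.mem_range.1 hk)

open Classical in
theorem wick_comm (u v : GenRV ι) : wick u v = wick v u := by
  ext α
  exact Finset.sum_equiv (Equiv.prodComm _ _)
    (fun q => by simp [Finset.HasAntidiagonal.mem_antidiagonal, add_comm])
    (fun q _ => mul_comm _ _)

end WickPowers

/-! ### Orthogonal series in Hilbert spaces -/

section Hilbert

open scoped InnerProductSpace

variable {I H : Type*} [NormedAddCommGroup H] [InnerProductSpace ℝ H]

theorem enorm_sq_eq_ofReal {H : Type*} [NormedAddCommGroup H] (x : H) :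
    ‖x‖ₑ ^ 2 = ENNReal.ofReal (‖x‖ ^ 2) := by
  rw [← ofReal_norm, ENNReal.ofReal_pow (norm_nonneg _)]

theorem hasSum_inner_of_orthogonal {v : I → H} {S : H}
    (hv : Pairwise fun i j => ⟪v i, v j⟫_ℝ = 0) (h : HasSum v S) (i : I) :
    ⟪v i, S⟫_ℝ = ‖v i‖ ^ 2 := by
  have h1 : HasSum (fun j => ⟪v i, v j⟫_ℝ) ⟪v i, S⟫_ℝ := h.mapL (innerSL ℝ (v i))
  have h2 : HasSum (fun j => ⟪v i, v j⟫_ℝ) ⟪v i, v i⟫_ℝ :=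
    hasSum_single i fun j hj => hv hj.symm
  rw [h1.unique h2, real_inner_self_eq_norm_sq]

theorem hasSum_norm_sq_of_orthogonal {v : I → H} {S : H}
    (hv : Pairwise fun i j => ⟪v i, v j⟫_ℝ = 0) (h : HasSum v S) :
    HasSum (fun i => ‖v i‖ ^ 2) (‖S‖ ^ 2) := by
  have h1 : HasSum (fun j => ⟪S, v j⟫_ℝ) ⟪S, S⟫_ℝ := h.mapL (innerSL ℝ S)
  rw [real_inner_self_eq_norm_sq] at h1
  have h2 : (fun j => ⟪S, v j⟫_ℝ) = fun i => ‖v i‖ ^ 2 := funext fun i => by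
    rw [real_inner_comm, hasSum_inner_of_orthogonal hv h i]
  rwa [h2] at h1

theorem enorm_sq_of_orthogonal {v : I → H} {S : H}
    (hv : Pairwise fun i j => ⟪v i, v j⟫_ℝ = 0) (h : HasSum v S) :
    ‖S‖ₑ ^ 2 = ∑' i, ‖v i‖ₑ ^ 2 := by
  have h1 := hasSum_norm_sq_of_orthogonal hv h
  simp only [enorm_sq_eq_ofReal]
  rw [← ENNReal.ofReal_tsum_of_nonneg (fun _ => sq_nonneg _) h1.summable, h1.tsum_eq]

theorem enorm_sq_sub_sum_of_orthogonal {v : I → H} {S : H}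
    (hv : Pairwise fun i j => ⟪v i, v j⟫_ℝ = 0) (h : HasSum v S) (s : Finset I) :
    ‖S - ∑ i ∈ s, v i‖ₑ ^ 2 = ∑' i : {i // i ∉ s}, ‖v i‖ₑ ^ 2 := by
  have h1 : HasSum (fun i : {i // i ∉ s} => v i) (S - ∑ i ∈ s, v i) := by
    rw [Finset.hasSum_compl_iff]
    simpa using h
  exact enorm_sq_of_orthogonal (fun i j hij => hv (Subtype.coe_injective.ne hij)) h1

/-- The lines spanned by the `v i` form an orthogonal family even if some `v i` vanish, so no
normalisation is needed. -/
theorem summable_of_orthogonal [CompleteSpace H] {v : I → H}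
    (hv : Pairwise fun i j => ⟪v i, v j⟫_ℝ = 0) (h : ∑' i, ‖v i‖ₑ ^ 2 < ∞) : Summable v := by
  have h1 : Summable fun i => ‖v i‖ ^ 2 := by
    simp only [enorm_sq_eq_ofReal] at h
    exact (ENNReal.summable_toReal h.ne).congr fun i => ENNReal.toReal_ofReal (sq_nonneg _)
  have h2 : OrthogonalFamily ℝ (fun i => (ℝ ∙ v i : Submodule ℝ H))
      fun i => (ℝ ∙ v i : Submodule ℝ H).subtypeₗᵢ := by
    refine OrthogonalFamily.of_pairwise fun i j hij => ?_
    rw [Function.onFun, Submodule.isOrtho_span]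
    rintro x rfl y rfl
    exact hv hij
  exact (h2.summable_iff_norm_sq_summable
    (fun i => ⟨v i, Submodule.mem_span_singleton_self (v i)⟩)).2 h1

/-- Identifies an orthogonal expansion from its coefficients alone. Bessel's inequality makes the
candidate series converge to some `S'`; then `S - S'` lies both in the closed span and in its
orthogonal complement. -/
theorem hasSum_of_mem_closure_span [CompleteSpace H] {v : I → H} {S : H} {c : I → ℝ}
    (hv : Pairwise fun i j => ⟪v i, v j⟫_ℝ = 0)
    (hS : S ∈ (Submodule.span ℝ (range v)).topologicalClosure)
    (hc : ∀ i, ⟪v i, S⟫_ℝ = c i * ‖v i‖ ^ 2) : HasSum (fun i => c i • v i) S := by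
  have hv' : Pairwise fun i j => ⟪c i • v i, c j • v j⟫_ℝ = 0 := fun i j hij => by
    simp [inner_smul_left, inner_smul_right, hv hij]
  -- Bessel: a partial sum has inner product with `S` equal to its own squared norm, and
  -- Cauchy-Schwarz then bounds it by `‖S‖`.
  have h1 : ∀ s : Finset I, ∑ i ∈ s, ‖c i • v i‖ ^ 2 ≤ ‖S‖ ^ 2 := by
    intro s
    have h2 : ⟪∑ i ∈ s, c i • v i, S⟫_ℝ = ∑ i ∈ s, ‖c i • v i‖ ^ 2 := by
      rw [sum_inner]
      refine Finset.sum_congr rfl fun i _ => ?_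
      rw [inner_smul_left, hc, norm_smul, mul_pow, Real.norm_eq_abs, sq_abs]
      simp only [conj_trivial]
      ring
    have h3 : ‖∑ i ∈ s, c i • v i‖ ^ 2 = ∑ i ∈ s, ‖c i • v i‖ ^ 2 := by
      have := hasSum_norm_sq_of_orthogonal (v := fun i : s => c i • v i)
        (fun i j hij => hv' (Subtype.coe_injective.ne hij)) (hasSum_fintype _)
      have h4 := this.unique (hasSum_fintype _)
      rw [Finset.sum_coe_sort s (fun i => c i • v i),
        Finset.sum_coe_sort s (fun i => ‖c i • v i‖ ^ 2)] at h4
      exact h4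
    have h4 := real_inner_le_norm (∑ i ∈ s, c i • v i) S
    rw [h2, ← h3] at h4
    rw [← h3]
    nlinarith [norm_nonneg (∑ i ∈ s, c i • v i), norm_nonneg S]
  have h2 : Summable fun i => c i • v i := by
    refine summable_of_orthogonal hv' ?_
    have h3 := summable_of_sum_le (fun i => sq_nonneg ‖c i • v i‖) h1
    simp only [enorm_sq_eq_ofReal]
    rw [← ENNReal.ofReal_tsum_of_nonneg (fun _ => sq_nonneg _) h3]
    exact ENNReal.ofReal_lt_top
  obtain ⟨S', hS'⟩ := h2
  have hS'mem : S' ∈ (Submodule.span ℝ (range v)).topologicalClosure := by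
    refine mem_closure_of_tendsto hS' (Eventually.of_forall fun s => ?_)
    exact Submodule.sum_mem _ fun i _ =>
      Submodule.smul_mem _ _ (Submodule.subset_span (mem_range_self i))
  have horth : ∀ i, ⟪v i, S - S'⟫_ℝ = 0 := by
    intro i
    have h3 : HasSum (fun j => ⟪v i, c j • v j⟫_ℝ) ⟪v i, S'⟫_ℝ := hS'.mapL (innerSL ℝ (v i))
    have h4 : HasSum (fun j => ⟪v i, c j • v j⟫_ℝ) ⟪v i, c i • v i⟫_ℝ :=
      hasSum_single i fun j hj => by simp [inner_smul_right, hv hj.symm]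
    rw [inner_sub_right, h3.unique h4, hc, inner_smul_right, real_inner_self_eq_norm_sq, sub_self]
  have h0 : S - S' ∈ (Submodule.span ℝ (range v))ᗮ := by
    rw [Submodule.mem_orthogonal]
    intro x hx
    induction hx using Submodule.span_induction with
    | mem x hx => obtain ⟨i, rfl⟩ := hx; exact horth i
    | zero => simp
    | add x y _ _ hx hy => rw [inner_add_left, hx, hy, add_zero]
    | smul a x _ hx => rw [inner_smul_left, hx, mul_zero]
  have h5 : S - S' = 0 := by
    have h6 := Submodule.sub_mem _ hS hS'mem
    rw [← Submodule.orthogonal_closure, Submodule.mem_orthogonal] at h0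
    exact inner_self_eq_zero.1 (h0 _ h6)
  rwa [sub_eq_zero.1 h5]

end Hilbert

/-! ### Chaos expansions -/

section ChaosExpansion

open scoped InnerProductSpace

variable {U Ω ι : Type*} [MeasurableSpace U] [MeasurableSpace Ω] {μ : Measure U} {P : Measure Ω}

theorem enorm_sq_Lp (X : Lp ℝ 2 P) : ‖X‖ₑ ^ 2 = ∫⁻ ω, ‖X ω‖ₑ ^ 2 ∂P := by
  have := eLpNorm_nnreal_pow_eq_lintegral (f := X) (μ := P) (p := 2) two_ne_zero
  rw [Lp.enorm_def]
  simpa using this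

theorem inner_Lp_eq (X Y : Lp ℝ 2 P) : ⟪X, Y⟫_ℝ = ∫ ω, X ω * Y ω ∂P := by
  rw [L2.inner_def]
  exact integral_congr_ae (Eventually.of_forall fun ω => by simp [mul_comm])

theorem inner_toLp_toLp {f g : Ω → ℝ} (hf : MemLp f 2 P) (hg : MemLp g 2 P) :
    ⟪hf.toLp f, hg.toLp g⟫_ℝ = ∫ ω, f ω * g ω ∂P := by
  rw [inner_Lp_eq]
  refine integral_congr_ae ?_
  filter_upwards [hf.coeFn_toLp, hg.coeFn_toLp] with ω h1 h2
  rw [h1, h2]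

theorem norm_chaosBasis {K : MultiIndex ι → Lp ℝ 2 P} {α : MultiIndex ι} (hα : K α ≠ 0) :
    ‖chaosBasis K α‖ = √(mfactorial α : ℝ) := by
  rw [chaosBasis, norm_smul, norm_div, norm_norm, Real.norm_eq_abs,
    abs_of_nonneg (Real.sqrt_nonneg _), div_mul_cancel₀ _ (norm_ne_zero_iff.2 hα)]

variable [IsProbabilityMeasure P] {N : DrivingField μ P} {m : HilbertBasis ι ℝ (Lp ℝ 2 μ)}
  {h : AssumptionB1 N m} {K : MultiIndex ι → Lp ℝ 2 P}

theorem xiMonomialLp_single (h : AssumptionB1 N m) (k : ι) :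
    xiMonomialLp h (Finsupp.single k 1) = xi N m k := by
  refine Lp.ext ?_
  filter_upwards [(memLp_xiMonomial h (Finsupp.single k 1)).coeFn_toLp] with ω hω
  rw [xiMonomialLp, hω, xiMonomial, mpow_single, pow_one]

theorem xiMonomialLp_zero (h : AssumptionB1 N m) : xiMonomialLp h 0 =ᵐ[P] fun _ => 1 := by
  filter_upwards [(memLp_xiMonomial h 0).coeFn_toLp] with ω hω
  rw [xiMonomialLp, hω, xiMonomial, mpow_zero]

/-- `H_0` consists of the constants, and `ξ_k` is centred, so the projection that is subtracted
vanishes. -/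
theorem AssumptionB2.single (hK : AssumptionB2 h K) (k : ι) :
    K (Finsupp.single k 1) = xi N m k := by
  rw [hK.succ 0 _ (by simp), xiMonomialLp_single, sub_eq_self,
    Submodule.starProjection_apply_eq_zero_iff, chaosUpTo, Submodule.orthogonal_closure,
    Submodule.mem_orthogonal]
  intro x hx
  induction hx using Submodule.span_induction with
  | mem x hx =>
    obtain ⟨p, hp, rfl⟩ := hx
    have : p = 0 := (Finsupp.degree_eq_zero_iff p).1 (by simpa using hp)
    subst this
    rw [inner_Lp_eq, ← N.mean_zero (m k)]
    refine integral_congr_ae ?_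
    filter_upwards [xiMonomialLp_zero h] with ω hω
    rw [hω, one_mul, xi]
  | zero => simp
  | add x y _ _ hx hy => rw [inner_add_left, hx, hy, add_zero]
  | smul a x _ hx => rw [inner_smul_left, hx, mul_zero]

theorem AssumptionB2.inner_eq_zero (hK : AssumptionB2 h K) {α β : MultiIndex ι} (hne : α ≠ β) :
    ⟪K α, K β⟫_ℝ = 0 := by
  rw [inner_Lp_eq, hK.orthogonal α β hne]

theorem AssumptionB2.inner_chaosBasis (hK : AssumptionB2 h K) {α β : MultiIndex ι} (hne : α ≠ β) :
    ⟪chaosBasis K α, chaosBasis K β⟫_ℝ = 0 := by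
  rw [chaosBasis, chaosBasis, inner_smul_left, inner_smul_right, hK.inner_eq_zero hne]
  simp

theorem AssumptionB2.chaosBasis_single (hK : AssumptionB2 h K) (k : ι) :
    chaosBasis K (Finsupp.single k 1) = xi N m k := by
  have h1 : mfactorial (Finsupp.single k 1) = 1 := mfactorial_single_one k
  have h2 : ‖xi N m k‖ = 1 := by
    rw [xi, LinearIsometry.norm_map, m.orthonormal.norm_eq_one]
  rw [chaosBasis, hK.single, h1, h2]
  simp

/-- `N(g) = ∑ ⟨g, m_k⟩ ξ_k` with `ξ_k = 𝔑_{ε_k}`. Orthogonality removes every coefficient outside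
degree one, and the isometry property computes the remaining ones. -/
theorem AssumptionB2.chaosExpansion_noise (hK : AssumptionB2 h K) (g : Lp ℝ 2 μ) :
    chaosExpansion K (N.toIsometry g) = linearSeries fun k => ⟪g, m k⟫_ℝ := by
  ext α
  rw [chaosExpansion, ← inner_Lp_eq, linearSeries]
  split_ifs with h1
  · obtain ⟨k, rfl⟩ := degree_eq_one_iff.1 h1
    rw [hK.chaosBasis_single, xi, LinearIsometry.inner_map_map, mpow_single,
      mfactorial_single_one]
    simp
  · have h2 : HasSum (fun k => ⟪chaosBasis K α, m.repr g k • xi N m k⟫_ℝ)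
        ⟪chaosBasis K α, N.toIsometry g⟫_ℝ := by
      have := ((m.hasSum_repr g).mapL N.toIsometry.toContinuousLinearMap).mapL
        (innerSL ℝ (chaosBasis K α))
      simpa [xi, inner_smul_right] using this
    have h3 : ∀ k, ⟪chaosBasis K α, m.repr g k • xi N m k⟫_ℝ = 0 := by
      intro k
      rw [inner_smul_right, ← hK.chaosBasis_single, hK.inner_chaosBasis, mul_zero]
      rintro rfl
      simp at h1
    simp only [h3] at h2
    rw [real_inner_comm, h2.unique hasSum_zero, zero_div]

/-- The infimum in `secondMoment` ranges over at most one `X`. Parseval gives its value if the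
series converges; convergence follows as soon as the right-hand side is finite. -/
theorem AssumptionB2.secondMoment_eq (hK : AssumptionB2 h K) (hne : ∀ α, K α ≠ 0)
    (u : GenRV ι) : secondMoment K u = ∑' α, (mfactorial α : ℝ≥0∞) * ‖u α‖ₑ ^ 2 := by
  have horth : Pairwise fun α β => ⟪u α • chaosBasis K α, u β • chaosBasis K β⟫_ℝ = 0 :=
    fun α β hαβ => by
      simp [inner_smul_left, inner_smul_right, hK.inner_chaosBasis hαβ]
  have hnorm : ∀ α, ‖u α • chaosBasis K α‖ₑ ^ 2 = (mfactorial α : ℝ≥0∞) * ‖u α‖ₑ ^ 2 := by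
    intro α
    rw [enorm_smul, mul_pow, enorm_sq_eq_ofReal (chaosBasis K α), norm_chaosBasis (hne α),
      Real.sq_sqrt (Nat.cast_nonneg _), ENNReal.ofReal_natCast, mul_comm]
  have hval : ∀ X : Lp ℝ 2 P, HasSum (fun α => u α • chaosBasis K α) X →
      ∫⁻ ω, ‖X ω‖ₑ ^ 2 ∂P = ∑' α, (mfactorial α : ℝ≥0∞) * ‖u α‖ₑ ^ 2 := by
    intro X hX
    rw [← enorm_sq_Lp, enorm_sq_of_orthogonal horth hX]
    exact tsum_congr hnorm
  refine le_antisymm ?_ (le_iInf₂ fun X hX => (hval X hX).ge)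
  rcases eq_or_ne (∑' α, (mfactorial α : ℝ≥0∞) * ‖u α‖ₑ ^ 2) ∞ with h1 | h1
  · rw [h1]; exact le_top
  · have h2 : Summable fun α => u α • chaosBasis K α := by
      refine summable_of_orthogonal horth ?_
      rw [tsum_congr hnorm]
      exact h1.lt_top
    obtain ⟨X, hX⟩ := h2
    exact iInf₂_le_of_le X hX (hval X hX).le

end ChaosExpansion

/-! ### The noise of a slab as a first-order series -/

section Slices

open scoped InnerProductSpace

variable {V Ω ι : Type*} [MeasurableSpace V] [MeasurableSpace Ω]
  {μ : Measure (ℝ × V)} {P : Measure Ω} [IsProbabilityMeasure P] {N : DrivingField μ P}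
  {m : HilbertBasis ι ℝ (Lp ℝ 2 μ)} {h : AssumptionB1 N m} {K : MultiIndex ι → Lp ℝ 2 P}

theorem AssumptionB2.sliceNoise_eq (hK : AssumptionB2 h K) (G : Lp ℝ 2 μ) (s t : ℝ) :
    sliceNoise N K G s t = linearSeries (slicedCoeff m G s t) := by
  rw [sliceNoise, hK.chaosExpansion_noise]
  congr 1
  ext k
  rw [inner_Lp_eq, slicedCoeff]
  refine integral_congr_ae ?_
  filter_upwards [((Lp.memLp G).indicator (measurableSet_slab s t)).coeFn_toLp] with x hx
  rw [sliceLp, hx]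

end Slices

/-! ### Integrals over slabs and the chain rule for monomials -/

section TimeIntegrals

variable {V : Type*} [MeasurableSpace V] {T : ℝ} {π : Measure V}

/-- The density in time of the signed measure `ρ dμ`. -/
noncomputable def timeDensity (T : ℝ) (π : Measure V) (ρ : ℝ × V → ℝ) : ℝ → ℝ :=
  (Icc 0 T).indicator fun r => ∫ v, ρ (r, v) ∂π

/-- The primitive of `timeDensity`. -/
noncomputable def accum (T : ℝ) (π : Measure V) (ρ : ℝ × V → ℝ) (t : ℝ) : ℝ :=
  ∫ r in (0 : ℝ)..t, timeDensity T π ρ r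

theorem integrable_mul_comp_fst {ρ : ℝ × V → ℝ} {h : ℝ → ℝ} {B : ℝ}
    (hρ : Integrable ρ (timeMeasure T π)) (hh : Continuous h) (hB : ∀ r, |h r| ≤ B) :
    Integrable (fun x => ρ x * h x.1) (timeMeasure T π) :=
  hρ.mul_bdd (c := B) (hh.aestronglyMeasurable.comp_fst) (Eventually.of_forall fun x => hB x.1)

variable [SigmaFinite π]

theorem integrable_timeDensity {ρ : ℝ × V → ℝ} (hρ : Integrable ρ (timeMeasure T π)) :
    Integrable (timeDensity T π ρ) := by
  rw [timeDensity, integrable_indicator_iff measurableSet_Icc]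
  exact Integrable.integral_prod_left (ν := π) hρ

theorem continuous_accum {ρ : ℝ × V → ℝ} (hρ : Integrable ρ (timeMeasure T π)) :
    Continuous (accum T π ρ) :=
  (integrable_timeDensity hρ).continuous_primitive 0

theorem accum_sub_accum {ρ : ℝ × V → ℝ} (hρ : Integrable ρ (timeMeasure T π)) (s t : ℝ) :
    accum T π ρ t - accum T π ρ s = ∫ r in s..t, timeDensity T π ρ r :=
  intervalIntegral.integral_interval_sub_left (integrable_timeDensity hρ).intervalIntegrable
    (integrable_timeDensity hρ).intervalIntegrable

theorem abs_accum_le {ρ : ℝ × V → ℝ} (hρ : Integrable ρ (timeMeasure T π)) (t : ℝ) :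
    |accum T π ρ t| ≤ ∫ r, |timeDensity T π ρ r| := by
  refine (intervalIntegral.norm_integral_le_integral_norm_uIoc
    (f := timeDensity T π ρ) (μ := volume) (a := 0) (b := t)).trans ?_
  exact setIntegral_le_integral (integrable_timeDensity hρ).norm
    (Eventually.of_forall fun _ => norm_nonneg _)

/-- Fubini. The indicator inside `timeDensity` accounts for the restriction of Lebesgue measure to
`[0,T]`, so the interval `[s,t]` need not lie in `[0,T]`. -/
theorem setIntegral_slab_mul {ρ : ℝ × V → ℝ} {h : ℝ → ℝ} {s t : ℝ} (hst : s ≤ t)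
    (hρ : IntegrableOn (fun x => ρ x * h x.1) (slab V s t) (timeMeasure T π)) :
    ∫ x in slab V s t, ρ x * h x.1 ∂(timeMeasure T π) =
      ∫ r in s..t, timeDensity T π ρ r * h r := by
  rw [slab] at hρ ⊢
  rw [setIntegral_prod _ hρ, intervalIntegral.integral_of_le hst, ← integral_Icc_eq_integral_Ioc]
  rw [Measure.restrict_restrict measurableSet_Icc, ← setIntegral_indicator measurableSet_Icc]
  refine setIntegral_congr_fun measurableSet_Icc fun r _ => ?_
  by_cases hr : r ∈ Icc 0 T
  · simp [timeDensity, indicator_of_mem hr, Measure.restrict_univ, integral_mul_const]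
  · simp [timeDensity, indicator_of_notMem hr]

theorem setIntegral_slab_eq {ρ : ℝ × V → ℝ} {s t : ℝ} (hst : s ≤ t)
    (hρ : Integrable ρ (timeMeasure T π)) :
    ∫ x in slab V s t, ρ x ∂(timeMeasure T π) = accum T π ρ t - accum T π ρ s := by
  rw [accum_sub_accum hρ]
  have := setIntegral_slab_mul (T := T) (π := π) (ρ := ρ) (h := fun _ => 1) hst
    (by simpa using hρ.integrableOn)
  simpa using this

theorem Icc_absolutelyContinuous_const (c a b : ℝ) :
    AbsolutelyContinuousOnInterval (fun _ : ℝ => c) a b :=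
  contDiffOn_const.absolutelyContinuousOnInterval

theorem absolutelyContinuous_pow {f : ℝ → ℝ} {a b : ℝ}
    (hf : AbsolutelyContinuousOnInterval f a b) (n : ℕ) :
    AbsolutelyContinuousOnInterval (fun x => f x ^ n) a b := by
  induction n with
  | zero => simpa using Icc_absolutelyContinuous_const 1 a b
  | succ n ih =>
    simp only [pow_succ]
    exact ih.fun_mul hf

theorem absolutelyContinuous_prod {κ : Type*} {f : κ → ℝ → ℝ} {a b : ℝ} (s : Finset κ)
    (hf : ∀ k ∈ s, AbsolutelyContinuousOnInterval (f k) a b) :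
    AbsolutelyContinuousOnInterval (fun x => ∏ k ∈ s, f k x) a b := by
  classical
  induction s using Finset.induction_on with
  | empty => simpa using Icc_absolutelyContinuous_const 1 a b
  | insert k s hk ih =>
    simp only [Finset.prod_insert hk]
    exact (hf k (Finset.mem_insert_self _ _)).fun_mul
      (ih fun j hj => hf j (Finset.mem_insert_of_mem hj))

theorem mpow_sub_single {κ : Type*} [DecidableEq κ] (z : κ → ℝ) {α : MultiIndex κ} {k : κ}
    (hk : k ∈ α.support) : mpow z (α - Finsupp.single k 1) =
      z k ^ (α k - 1) * ∏ j ∈ α.support.erase k, z j ^ α j := by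
  have h1 : mpow z (α - Finsupp.single k 1) =
      ∏ j ∈ α.support, z j ^ (α - Finsupp.single k 1 : MultiIndex κ) j := by
    refine Finsupp.prod_of_support_subset _ ?_ _ (by simp)
    exact Finsupp.support_mono tsub_le_self
  rw [h1, ← Finset.mul_prod_erase _ _ hk]
  congr 1
  · simp
  · refine Finset.prod_congr rfl fun j hj => ?_
    have : k ≠ j := (Finset.ne_of_mem_erase hj).symm
    simp [this]

/-- Product rule together with `α_k / α! = 1 / (α - ε_k)!`. -/
theorem hasDerivAt_expCoeff {κ : Type*} {f : κ → ℝ → ℝ} {d : κ → ℝ} {r : ℝ} (α : MultiIndex κ)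
    (hf : ∀ k ∈ α.support, HasDerivAt (f k) (d k) r) :
    HasDerivAt (fun r => expCoeff (fun k => f k r) α)
      (∑ k ∈ α.support, d k * expCoeff (fun k => f k r) (α - Finsupp.single k 1)) r := by
  classical
  have h1 := HasDerivAt.fun_finsetProd (u := α.support) (f := fun k r => f k r ^ α k)
    (f' := fun k => α k * f k r ^ (α k - 1) * d k) (x := r)
    (fun k hk => (hf k hk).fun_pow (α k))
  have h2 := h1.div_const (mfactorial α : ℝ)
  refine h2.congr_deriv ?_
  rw [Finset.sum_div]
  refine Finset.sum_congr rfl fun k hk => ?_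
  rw [expCoeff, mpow_sub_single _ hk, mfactorial_eq_mul hk, smul_eq_mul]
  have h3 : (α k : ℝ) ≠ 0 := Nat.cast_ne_zero.2 (Finsupp.mem_support_iff.1 hk)
  have h4 := mfactorial_cast_ne_zero (α - Finsupp.single k 1)
  push_cast
  field_simp

theorem expCoeff_zero_apply {κ : Type*} {α : MultiIndex κ} (hα : α ≠ 0) :
    expCoeff (fun _ : κ => 0) α = 0 := by
  obtain ⟨k, hk⟩ := Finsupp.support_nonempty_iff.2 hα
  have : mpow (fun _ : κ => (0 : ℝ)) α = 0 :=
    Finset.prod_eq_zero hk (zero_pow (Finsupp.mem_support_iff.1 hk))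
  rw [expCoeff, this, zero_div]

theorem continuous_expCoeff {κ X : Type*} [TopologicalSpace X] {f : κ → X → ℝ}
    (hf : ∀ k, Continuous (f k)) (α : MultiIndex κ) :
    Continuous fun x => expCoeff (fun k => f k x) α := by
  unfold expCoeff mpow Finsupp.prod
  exact (continuous_finsetProd _ fun k _ => (hf k).pow _).div_const _

theorem exists_abs_expCoeff_le {κ X : Type*} {f : κ → X → ℝ} {C : κ → ℝ}
    (hf : ∀ k x, |f k x| ≤ C k) (α : MultiIndex κ) :
    ∃ B, ∀ x, |expCoeff (fun k => f k x) α| ≤ B := by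
  refine ⟨mpow C α / mfactorial α, fun x => ?_⟩
  rw [expCoeff, abs_div, Nat.abs_cast]
  gcongr
  unfold mpow Finsupp.prod
  rw [Finset.abs_prod]
  refine Finset.prod_le_prod (fun _ _ => abs_nonneg _) fun k _ => ?_
  rw [abs_pow]
  exact pow_le_pow_left₀ (abs_nonneg _) (hf k x) _

/-- The densities are merely integrable, so the chain rule holds only almost everywhere. Absolute
continuity, which passes to products of primitives, is what makes the fundamental theorem of
calculus available. -/
theorem integral_sum_mul_expCoeff {κ : Type*} {D : κ → ℝ → ℝ} (hD : ∀ k, Integrable (D k))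
    (α : MultiIndex κ) (s t : ℝ) :
    ∫ r in s..t, ∑ k ∈ α.support,
        D k r * expCoeff (fun k => ∫ q in s..r, D k q) (α - Finsupp.single k 1) =
      expCoeff (fun k => ∫ q in s..t, D k q) α -
        expCoeff (fun k => ∫ q in s..s, D k q) α := by
  have hac : ∀ k, AbsolutelyContinuousOnInterval (fun r => ∫ q in s..r, D k q) s t := fun k =>
    (hD k).intervalIntegrable.absolutelyContinuousOnInterval_intervalIntegral left_mem_uIcc
  have h1 : AbsolutelyContinuousOnInterval
      (fun r => expCoeff (fun k => ∫ q in s..r, D k q) α) s t := by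
    have h2 := (absolutelyContinuous_prod α.support
      fun k _ => absolutelyContinuous_pow (hac k) (α k)).const_mul ((mfactorial α : ℝ)⁻¹)
    convert h2 using 2 with r
    rw [expCoeff, div_eq_inv_mul]
    rfl
  rw [← h1.integral_deriv_eq_sub]
  refine intervalIntegral.integral_congr_ae ?_
  -- Lebesgue differentiation, for the finitely many indices on which the coefficient depends.
  have h3 : ∀ᵐ r, ∀ k ∈ α.support, ∀ c,
      HasDerivAt (fun x => ∫ q in c..x, D k q) (D k r) r := by
    rw [Finset.eventually_all]
    exact fun k _ => LocallyIntegrable.ae_hasDerivAt_integral (hD k).locallyIntegrable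
  filter_upwards [h3] with r hr _
  exact (hasDerivAt_expCoeff α fun k hk => hr k hk s).deriv.symm

/-- The kernel `e_β(s,t) = (A(t) - A(s))^β / β!`, `A_k` being the primitive of `ρ_k`. -/
noncomputable def slabExp {κ : Type*} (T : ℝ) (π : Measure V) (ρ : κ → ℝ × V → ℝ)
    (β : MultiIndex κ) (s t : ℝ) : ℝ :=
  expCoeff (fun k => accum T π (ρ k) t - accum T π (ρ k) s) β

variable {κ : Type*} {ρ : κ → ℝ × V → ℝ}

theorem continuous_slabExp (hρ : ∀ k, Integrable (ρ k) (timeMeasure T π)) (β : MultiIndex κ) :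
    Continuous fun p : ℝ × ℝ => slabExp T π ρ β p.1 p.2 :=
  continuous_expCoeff (fun k => ((continuous_accum (hρ k)).comp continuous_snd).sub
    ((continuous_accum (hρ k)).comp continuous_fst)) β

theorem continuous_slabExp_right (hρ : ∀ k, Integrable (ρ k) (timeMeasure T π))
    (β : MultiIndex κ) (s : ℝ) : Continuous (slabExp T π ρ β s) :=
  continuous_expCoeff (f := fun k t => accum T π (ρ k) t - accum T π (ρ k) s)
    (fun k => (continuous_accum (hρ k)).sub continuous_const) β

theorem exists_abs_slabExp_le (hρ : ∀ k, Integrable (ρ k) (timeMeasure T π))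
    (β : MultiIndex κ) : ∃ B, ∀ s t, |slabExp T π ρ β s t| ≤ B := by
  obtain ⟨B, hB⟩ := exists_abs_expCoeff_le (X := ℝ × ℝ)
    (f := fun k p => accum T π (ρ k) p.2 - accum T π (ρ k) p.1)
    (C := fun k => (∫ r, |timeDensity T π (ρ k) r|) + ∫ r, |timeDensity T π (ρ k) r|)
    (fun k p => (abs_sub _ _).trans (add_le_add (abs_accum_le (hρ k) _) (abs_accum_le (hρ k) _))) β
  exact ⟨B, fun s t => hB (s, t)⟩

/-- Integrated form of `∂_t e_β = ∑_k A_k' e_{β-ε_k}` with `e_β(s,s) = 1_{β=0}`. This is the only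
property of the kernel, besides continuity and boundedness, that the Duhamel computation needs. -/
theorem slabExp_eq (hρ : ∀ k, Integrable (ρ k) (timeMeasure T π)) (β : MultiIndex κ) {s t : ℝ}
    (hst : s ≤ t) :
    slabExp T π ρ β s t = wickOne β + ∑ k ∈ β.support,
      ∫ x in slab V s t, ρ k x * slabExp T π ρ (β - Finsupp.single k 1) s x.1
        ∂(timeMeasure T π) := by
  rcases eq_or_ne β 0 with rfl | hβ
  · simp [slabExp, expCoeff, wickOne]
  rw [wickOne, if_neg hβ]
  have h1 : ∀ k, Integrable
      (fun x => ρ k x * slabExp T π ρ (β - Finsupp.single k 1) s x.1) (timeMeasure T π) := by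
    intro k
    obtain ⟨B, hB⟩ := exists_abs_slabExp_le hρ (β - Finsupp.single k 1)
    exact integrable_mul_comp_fst (h := fun r => slabExp T π ρ (β - Finsupp.single k 1) s r)
      (hρ k) (continuous_slabExp_right hρ (β - Finsupp.single k 1) s) (hB s)
  have h2 : ∀ k ∈ β.support, ∫ x in slab V s t,
      ρ k x * slabExp T π ρ (β - Finsupp.single k 1) s x.1 ∂(timeMeasure T π) =
      ∫ r in s..t, timeDensity T π (ρ k) r * slabExp T π ρ (β - Finsupp.single k 1) s r :=
    fun k _ => setIntegral_slab_mul
      (h := fun r => slabExp T π ρ (β - Finsupp.single k 1) s r) hst (h1 k).integrableOn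
  rw [Finset.sum_congr rfl h2, ← intervalIntegral.integral_finsetSum]
  · have h3 := integral_sum_mul_expCoeff (fun k => integrable_timeDensity (hρ k)) β s t
    simp only [intervalIntegral.integral_same, expCoeff_zero_apply hβ, sub_zero] at h3
    simp only [slabExp, accum_sub_accum (hρ _)]
    rw [h3, zero_add]
  · intro k _
    obtain ⟨B, hB⟩ := exists_abs_slabExp_le hρ (β - Finsupp.single k 1)
    refine Integrable.intervalIntegrable ?_
    exact (integrable_timeDensity (hρ k)).mul_bdd (c := B)
      (continuous_slabExp_right hρ (β - Finsupp.single k 1) s).aestronglyMeasurable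
      (Eventually.of_forall (hB s))

end TimeIntegrals

/-! ### Variation of constants -/

section Fubini

theorem mem_slab {V : Type*} {s t : ℝ} {x : ℝ × V} : x ∈ slab V s t ↔ s ≤ x.1 ∧ x.1 ≤ t := by
  simp [slab]

variable {V : Type*} [MeasurableSpace V] {μ : Measure (ℝ × V)}

/-- `x` is the later point and `y` the earlier one. An indicator on the product encodes `0 ≤ y.1 ≤
x.1 ≤ t`, so that both iterated integrals are sections of one function and Fubini applies to it. -/
theorem integral_causal_left (ρ b : ℝ × V → ℝ) (e : ℝ → ℝ → ℝ) (t : ℝ) (x : ℝ × V) :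
    ∫ y, {z : (ℝ × V) × (ℝ × V) | 0 ≤ z.2.1 ∧ z.2.1 ≤ z.1.1 ∧ z.1.1 ≤ t}.indicator
        (fun z => ρ z.1 * (b z.2 * e z.2.1 z.1.1)) (x, y) ∂μ =
      (slab V 0 t).indicator
        (fun x => ρ x * ∫ y in slab V 0 x.1, b y * e y.1 x.1 ∂μ) x := by
  by_cases hx : x ∈ slab V 0 t
  · rw [indicator_of_mem hx, ← integral_const_mul, ← integral_indicator (measurableSet_slab _ _)]
    refine integral_congr_ae (Eventually.of_forall fun y => ?_)
    have hx' := mem_slab.1 hx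
    simp only [indicator, mem_ofPred_eq, mem_slab, hx'.2, and_true]
  · rw [indicator_of_notMem hx]
    refine integral_eq_zero_of_ae (Eventually.of_forall fun y => indicator_of_notMem ?_ _)
    rintro ⟨h1, h2, h3⟩
    exact hx (mem_slab.2 ⟨h1.trans h2, h3⟩)

theorem integral_causal_right (ρ b : ℝ × V → ℝ) (e : ℝ → ℝ → ℝ) (t : ℝ) (y : ℝ × V) :
    ∫ x, {z : (ℝ × V) × (ℝ × V) | 0 ≤ z.2.1 ∧ z.2.1 ≤ z.1.1 ∧ z.1.1 ≤ t}.indicator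
        (fun z => ρ z.1 * (b z.2 * e z.2.1 z.1.1)) (x, y) ∂μ =
      (slab V 0 t).indicator
        (fun y => b y * ∫ x in slab V y.1 t, ρ x * e y.1 x.1 ∂μ) y := by
  by_cases hy : y ∈ slab V 0 t
  · rw [indicator_of_mem hy, ← integral_const_mul, ← integral_indicator (measurableSet_slab _ _)]
    refine integral_congr_ae (Eventually.of_forall fun x => ?_)
    have hy' := mem_slab.1 hy
    simp only [indicator, mem_ofPred_eq, mem_slab, hy'.1, true_and]
    split_ifs <;> ring
  · rw [indicator_of_notMem hy]
    refine integral_eq_zero_of_ae (Eventually.of_forall fun x => indicator_of_notMem ?_ _)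
    rintro ⟨h1, h2, h3⟩
    exact hy (mem_slab.2 ⟨h1, h2.trans h3⟩)

theorem integrable_causal {ρ b : ℝ × V → ℝ} {e : ℝ → ℝ → ℝ} {B : ℝ}
    (hρ : Integrable ρ μ) (hb : Integrable b μ) (he : Continuous fun p : ℝ × ℝ => e p.1 p.2)
    (hB : ∀ s t, |e s t| ≤ B) (t : ℝ) :
    Integrable ({z : (ℝ × V) × (ℝ × V) | 0 ≤ z.2.1 ∧ z.2.1 ≤ z.1.1 ∧ z.1.1 ≤ t}.indicator
      fun z => ρ z.1 * (b z.2 * e z.2.1 z.1.1)) (μ.prod μ) := by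
  have hD : MeasurableSet {z : (ℝ × V) × (ℝ × V) | 0 ≤ z.2.1 ∧ z.2.1 ≤ z.1.1 ∧ z.1.1 ≤ t} := by
    have h1 : Measurable fun z : (ℝ × V) × (ℝ × V) => z.1.1 := measurable_fst.fst
    have h2 : Measurable fun z : (ℝ × V) × (ℝ × V) => z.2.1 := measurable_snd.fst
    exact (measurableSet_le measurable_const h2).inter
      ((measurableSet_le h2 h1).inter (measurableSet_le h1 measurable_const))
  refine Integrable.indicator ?_ hD
  have h1 : Measurable fun z : (ℝ × V) × (ℝ × V) => e z.2.1 z.1.1 :=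
    he.measurable.comp (f := fun z : (ℝ × V) × (ℝ × V) => (z.2.1, z.1.1))
      (measurable_snd.fst.prodMk measurable_fst.fst)
  have h2 := (hρ.mul_prod hb).mul_bdd (c := B) h1.aestronglyMeasurable
    (Eventually.of_forall fun z => hB _ _)
  simpa only [mul_assoc] using h2

variable [SFinite μ] {ρ b : ℝ × V → ℝ} {e : ℝ → ℝ → ℝ} {B : ℝ}

theorem integrableOn_causal_left (hρ : Integrable ρ μ) (hb : Integrable b μ)
    (he : Continuous fun p : ℝ × ℝ => e p.1 p.2) (hB : ∀ s t, |e s t| ≤ B) (t : ℝ) :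
    IntegrableOn (fun x => ρ x * ∫ y in slab V 0 x.1, b y * e y.1 x.1 ∂μ) (slab V 0 t) μ := by
  rw [← integrable_indicator_iff (measurableSet_slab _ _)]
  refine (integrable_causal hρ hb he hB t).integral_prod_left.congr
    (Eventually.of_forall fun x => ?_)
  exact integral_causal_left ρ b e t x

theorem integrableOn_causal_right (hρ : Integrable ρ μ) (hb : Integrable b μ)
    (he : Continuous fun p : ℝ × ℝ => e p.1 p.2) (hB : ∀ s t, |e s t| ≤ B) (t : ℝ) :
    IntegrableOn (fun y => b y * ∫ x in slab V y.1 t, ρ x * e y.1 x.1 ∂μ) (slab V 0 t) μ := by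
  rw [← integrable_indicator_iff (measurableSet_slab _ _)]
  refine (integrable_causal hρ hb he hB t).integral_prod_right.congr
    (Eventually.of_forall fun x => ?_)
  exact integral_causal_right ρ b e t x

/-- Dirichlet's formula: exchange of the order of integration over a time triangle. -/
theorem setIntegral_causal_swap (hρ : Integrable ρ μ) (hb : Integrable b μ)
    (he : Continuous fun p : ℝ × ℝ => e p.1 p.2) (hB : ∀ s t, |e s t| ≤ B) (t : ℝ) :
    ∫ x in slab V 0 t, ρ x * (∫ y in slab V 0 x.1, b y * e y.1 x.1 ∂μ) ∂μ =
      ∫ y in slab V 0 t, b y * (∫ x in slab V y.1 t, ρ x * e y.1 x.1 ∂μ) ∂μ := by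
  rw [← integral_indicator (measurableSet_slab _ _), ← integral_indicator (measurableSet_slab _ _)]
  have h1 := integral_integral_swap (f := fun x y => {z : (ℝ × V) × (ℝ × V) |
    0 ≤ z.2.1 ∧ z.2.1 ≤ z.1.1 ∧ z.1.1 ≤ t}.indicator
      (fun z => ρ z.1 * (b z.2 * e z.2.1 z.1.1)) (x, y)) (integrable_causal hρ hb he hB t)
  simpa only [integral_causal_left, integral_causal_right] using h1

end Fubini

/-! ### The Duhamel series under the right-hand side of the equation -/

section Duhamel

variable {V ι : Type*} [MeasurableSpace V] {μ : Measure (ℝ × V)}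

theorem skorokhodTo_apply (m : HilbertBasis ι ℝ (Lp ℝ 2 μ)) (t : ℝ) (g : ℝ × V → GenRV ι)
    (α : MultiIndex ι) :
    skorokhodTo m t g α =
      ∑ k ∈ α.support, ∫ x in slab V 0 t, g x (α - Finsupp.single k 1) * m k x ∂μ := by
  refine Finset.sum_congr rfl fun k _ => ?_
  rw [← integral_indicator (measurableSet_slab _ _)]
  refine integral_congr_ae (Eventually.of_forall fun x => ?_)
  by_cases hx : x ∈ slab V 0 t
  · simp [indicator_of_mem hx]
  · simp [indicator_of_notMem hx]

theorem sdeMap_apply (m : HilbertBasis ι ℝ (Lp ℝ 2 μ)) (G : Lp ℝ 2 μ) (w : GenRV ι)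
    (f : ℝ × V → GenRV ι) (u : ℝ → GenRV ι) (t : ℝ) (α : MultiIndex ι) :
    sdeMap m G w f u t α = w α + ∑ k ∈ α.support, ∫ x in slab V 0 t,
      (G x * u x.1 (α - Finsupp.single k 1) + f x (α - Finsupp.single k 1)) * m k x ∂μ := by
  rw [sdeMap, Pi.add_apply, skorokhodTo_apply]
  simp

open Classical in
/-- The series
`∑_α (∑_{β ≤ α} w_{α-β} e_β(0,t) + ∑_k ∫_0^t ∫ ∑_{β ≤ α-ε_k} f_{α-ε_k-β} m_k e_β(s,t) dμ) 𝔑_α`. -/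
noncomputable def duhamel (m : HilbertBasis ι ℝ (Lp ℝ 2 μ)) (w : GenRV ι) (f : ℝ × V → GenRV ι)
    (e : MultiIndex ι → ℝ → ℝ → ℝ) (t : ℝ) : GenRV ι :=
  fun α => ∑ q ∈ Finset.HasAntidiagonal.antidiagonal α, w q.1 * e q.2 0 t +
    ∑ k ∈ α.support, ∫ x in slab V 0 t,
      ∑ q ∈ Finset.HasAntidiagonal.antidiagonal (α - Finsupp.single k 1),
        f x q.1 * m k x * e q.2 x.1 t ∂μ

theorem integrable_mul_of_Lp {g : ℝ × V → ℝ} (hg : MemLp g 2 μ) (h : Lp ℝ 2 μ) :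
    Integrable (fun x => g x * h x) μ :=
  hg.integrable_mul (Lp.memLp h)

open Classical in
-- `wickOne` is the unit of the convolution. Read from right to left, this lets the bare terms in
-- `w` and `f` be absorbed as the term `1_{β=0}` of the kernel recursion.
theorem sum_antidiagonal_mul_wickOne (α : MultiIndex ι) (X : MultiIndex ι → ℝ) :
    ∑ q ∈ Finset.HasAntidiagonal.antidiagonal α, X q.1 * wickOne q.2 = X α := by
  rw [Finset.sum_eq_single (α, 0)]
  · simp [wickOne]
  · rintro ⟨p, q⟩ h hne
    have : q ≠ 0 := by
      rintro rfl
      rw [Finset.HasAntidiagonal.mem_antidiagonal] at h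
      simp only [add_zero] at h
      exact hne (by rw [h])
    simp [wickOne, this]
  · intro h
    exact absurd (by simp [Finset.HasAntidiagonal.mem_antidiagonal]) h

variable [SFinite μ] {m : HilbertBasis ι ℝ (Lp ℝ 2 μ)} {G : Lp ℝ 2 μ} {w : GenRV ι}
  {f : ℝ × V → GenRV ι} {e e' : MultiIndex ι → ℝ → ℝ → ℝ}

/-- The integral of `G` against the Duhamel series produces the integrals `∫ G m_k e_{β-ε_k}`,
directly for the `w` part and after the Fubini exchange for the `f` part. The bare `w` and `f`
supply the `1_{β=0}`. Keeping `e` and `e'` distinct covers the fixed point and the Picard step at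
once. -/
theorem sdeMap_duhamel (hf : MemL2D μ f)
    (he : ∀ β, Continuous fun p : ℝ × ℝ => e β p.1 p.2) (hB : ∀ β, ∃ B, ∀ s t, |e β s t| ≤ B)
    (hee' : ∀ β s t, s ≤ t → e' β s t = wickOne β + ∑ k ∈ β.support,
      ∫ x in slab V s t, G x * m k x * e (β - Finsupp.single k 1) s x.1 ∂μ)
    {t : ℝ} (ht : 0 ≤ t) :
    sdeMap m G w f (duhamel m w f e) t = duhamel m w f e' t := by
  classical
  have hρ : ∀ k, Integrable (fun x => G x * m k x) μ := fun k =>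
    integrable_mul_of_Lp (Lp.memLp G) (m k)
  have hb : ∀ l p, Integrable (fun x => f x p * m l x) μ := fun l p =>
    integrable_mul_of_Lp (hf p) (m l)
  ext α
  rw [sdeMap_apply]
  -- expand the integrals of `G u`
  have h1 : ∀ k ∈ α.support, ∫ x in slab V 0 t, (G x * duhamel m w f e x.1 (α - Finsupp.single k 1)
        + f x (α - Finsupp.single k 1)) * m k x ∂μ =
      ∑ q ∈ Finset.HasAntidiagonal.antidiagonal (α - Finsupp.single k 1),
        w q.1 * (∫ x in slab V 0 t, G x * m k x * e q.2 0 x.1 ∂μ) +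
      (∑ l ∈ (α - Finsupp.single k 1).support,
        ∑ q ∈ Finset.HasAntidiagonal.antidiagonal (α - Finsupp.single k 1 - Finsupp.single l 1),
          ∫ y in slab V 0 t, (f y q.1 * m l y) *
            (∫ x in slab V y.1 t, G x * m k x * e q.2 y.1 x.1 ∂μ) ∂μ) +
      ∫ x in slab V 0 t, f x (α - Finsupp.single k 1) * m k x ∂μ := by
    intro k _
    have hI1 : ∀ q : MultiIndex ι × MultiIndex ι, IntegrableOn
        (fun x => w q.1 * (G x * m k x * e q.2 0 x.1)) (slab V 0 t) μ := by
      intro q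
      obtain ⟨B, hB⟩ := hB q.2
      refine Integrable.const_mul ?_ _
      refine (Integrable.mul_bdd (c := B) (hρ k) ?_
        (Eventually.of_forall fun x => hB _ _)).integrableOn
      have h2 : Continuous fun r : ℝ => e q.2 0 r :=
        (he q.2).comp (continuous_const.prodMk continuous_id)
      exact (h2.measurable.comp measurable_fst).aestronglyMeasurable
    have hI2 : ∀ l (q : MultiIndex ι × MultiIndex ι), IntegrableOn (fun x => G x * m k x *
        ∫ y in slab V 0 x.1, (f y q.1 * m l y) * e q.2 y.1 x.1 ∂μ) (slab V 0 t) μ := by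
      intro l q
      obtain ⟨B, hB⟩ := hB q.2
      exact integrableOn_causal_left (hρ k) (hb l q.1) (he q.2) hB t
    have hin : ∀ x : ℝ × V, ∀ l, ∫ y in slab V 0 x.1,
        ∑ q ∈ Finset.HasAntidiagonal.antidiagonal (α - Finsupp.single k 1 - Finsupp.single l 1),
          f y q.1 * m l y * e q.2 y.1 x.1 ∂μ =
        ∑ q ∈ Finset.HasAntidiagonal.antidiagonal (α - Finsupp.single k 1 - Finsupp.single l 1),
          ∫ y in slab V 0 x.1, f y q.1 * m l y * e q.2 y.1 x.1 ∂μ := by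
      intro x l
      refine integral_finsetSum _ fun q _ => ?_
      obtain ⟨B, hB⟩ := hB q.2
      refine (Integrable.mul_bdd (c := B) (hb l q.1) ?_
        (Eventually.of_forall fun y => hB _ _)).integrableOn
      have h2 : Continuous fun r : ℝ => e q.2 r x.1 :=
        (he q.2).comp (continuous_id.prodMk continuous_const)
      exact (h2.measurable.comp measurable_fst).aestronglyMeasurable
    have hexp : ∀ x : ℝ × V, (G x * duhamel m w f e x.1 (α - Finsupp.single k 1)
        + f x (α - Finsupp.single k 1)) * m k x =
      ((∑ q ∈ Finset.HasAntidiagonal.antidiagonal (α - Finsupp.single k 1),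
        w q.1 * (G x * m k x * e q.2 0 x.1)) +
      ∑ l ∈ (α - Finsupp.single k 1).support,
        ∑ q ∈ Finset.HasAntidiagonal.antidiagonal (α - Finsupp.single k 1 - Finsupp.single l 1),
          G x * m k x * ∫ y in slab V 0 x.1, (f y q.1 * m l y) * e q.2 y.1 x.1 ∂μ) +
      f x (α - Finsupp.single k 1) * m k x := by
      intro x
      simp only [duhamel, hin x]
      rw [add_mul]
      congr 1
      rw [mul_add, add_mul]
      congr 1
      · rw [Finset.mul_sum, Finset.sum_mul]
        exact Finset.sum_congr rfl fun q _ => by ring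
      · rw [Finset.mul_sum, Finset.sum_mul]
        refine Finset.sum_congr rfl fun l _ => ?_
        rw [Finset.mul_sum, Finset.sum_mul]
        exact Finset.sum_congr rfl fun q _ => by ring
    simp only [hexp]
    have hS1 : IntegrableOn (fun x => ∑ q ∈ Finset.HasAntidiagonal.antidiagonal
        (α - Finsupp.single k 1), w q.1 * (G x * m k x * e q.2 0 x.1)) (slab V 0 t) μ :=
      integrable_finsetSum _ fun q _ => hI1 q
    have hS2 : IntegrableOn (fun x => ∑ l ∈ (α - Finsupp.single k 1).support,
        ∑ q ∈ Finset.HasAntidiagonal.antidiagonal (α - Finsupp.single k 1 - Finsupp.single l 1),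
          G x * m k x * ∫ y in slab V 0 x.1, (f y q.1 * m l y) * e q.2 y.1 x.1 ∂μ)
        (slab V 0 t) μ :=
      integrable_finsetSum _ fun l _ => integrable_finsetSum _ fun q _ => hI2 l q
    rw [integral_add (hS1.fun_add hS2) (hb k _).integrableOn, integral_add hS1 hS2,
      integral_finsetSum _ fun q _ => hI1 q,
      integral_finsetSum _ fun l _ => integrable_finsetSum _ fun q _ => hI2 l q]
    congr 2
    · exact Finset.sum_congr rfl fun q _ => integral_const_mul _ _
    · refine Finset.sum_congr rfl fun l _ => ?_
      rw [integral_finsetSum _ fun q _ => hI2 l q]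
      refine Finset.sum_congr rfl fun q _ => ?_
      obtain ⟨B, hB⟩ := hB q.2
      exact setIntegral_causal_swap (hρ k) (hb l q.1) (he q.2) hB t
  rw [Finset.sum_congr rfl h1, Finset.sum_add_distrib, Finset.sum_add_distrib]
  -- In the `w` part `ε_k` is moved into the kernel's multiindex. In the `f` part the basis index
  -- `l` belonging to the forcing is moved outside, leaving the index `k` belonging to `G` for the
  -- recursion.
  rw [sum_support_antidiagonal α
    (fun p k q => w p * (∫ x in slab V 0 t, G x * m k x * e q 0 x.1 ∂μ)),
    sum_support_comm α (fun k l => ∑ q ∈ Finset.HasAntidiagonal.antidiagonal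
      (α - Finsupp.single k 1 - Finsupp.single l 1), ∫ y in slab V 0 t, (f y q.1 * m l y) *
            (∫ x in slab V y.1 t, G x * m k x * e q.2 y.1 x.1 ∂μ) ∂μ)]
  -- For fixed `l`, the terms containing `G` and the bare forcing term add up to the recursion for
  -- `e'` under the integral.
  have h2 : ∀ l ∈ α.support, ∑ k ∈ (α - Finsupp.single l 1).support,
      ∑ q ∈ Finset.HasAntidiagonal.antidiagonal (α - Finsupp.single k 1 - Finsupp.single l 1),
        ∫ y in slab V 0 t, (f y q.1 * m l y) *
            (∫ x in slab V y.1 t, G x * m k x * e q.2 y.1 x.1 ∂μ) ∂μ +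
      ∫ x in slab V 0 t, f x (α - Finsupp.single l 1) * m l x ∂μ =
      ∫ x in slab V 0 t, ∑ q ∈ Finset.HasAntidiagonal.antidiagonal (α - Finsupp.single l 1),
        f x q.1 * m l x * e' q.2 x.1 t ∂μ := by
    intro l _
    have hI3 : ∀ k (q : MultiIndex ι × MultiIndex ι), IntegrableOn (fun y => f y q.1 * m l y *
        ∫ x in slab V y.1 t, G x * m k x * e (q.2 - Finsupp.single k 1) y.1 x.1 ∂μ)
        (slab V 0 t) μ := by
      intro k q
      obtain ⟨B, hB⟩ := hB (q.2 - Finsupp.single k 1)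
      exact integrableOn_causal_right (hρ k) (hb l q.1) (he _) hB t
    have h3 : ∀ k, α - Finsupp.single k 1 - Finsupp.single l 1 =
        α - Finsupp.single l 1 - Finsupp.single k 1 := fun k => tsub_right_comm
    simp only [h3]
    rw [sum_support_antidiagonal (α - Finsupp.single l 1)
      (fun p k q => ∫ y in slab V 0 t, (f y p * m l y) *
            (∫ x in slab V y.1 t, G x * m k x * e q y.1 x.1 ∂μ) ∂μ),
      ← sum_antidiagonal_mul_wickOne (α - Finsupp.single l 1)
        (fun p => ∫ x in slab V 0 t, f x p * m l x ∂μ), ← Finset.sum_add_distrib]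
    have h4 : ∀ q : MultiIndex ι × MultiIndex ι,
        ∑ k ∈ q.2.support, ∫ y in slab V 0 t, f y q.1 * m l y *
          ∫ x in slab V y.1 t, G x * m k x * e (q.2 - Finsupp.single k 1) y.1 x.1 ∂μ ∂μ +
        (∫ x in slab V 0 t, f x q.1 * m l x ∂μ) * wickOne q.2 =
        ∫ x in slab V 0 t, (∑ k ∈ q.2.support, f x q.1 * m l x *
          ∫ y in slab V x.1 t, G y * m k y * e (q.2 - Finsupp.single k 1) x.1 y.1 ∂μ) +
          f x q.1 * m l x * wickOne q.2 ∂μ := by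
      intro q
      rw [integral_add (integrable_finsetSum _ fun k _ => hI3 k q)
        ((hb l q.1).integrableOn.mul_const _), integral_finsetSum _ fun k _ => hI3 k q,
        integral_mul_const]
    simp only [h4]
    rw [← integral_finsetSum]
    · refine setIntegral_congr_fun (measurableSet_slab _ _) fun x hx => ?_
      refine Finset.sum_congr rfl fun q _ => ?_
      rw [hee' q.2 x.1 t (mem_slab.1 hx).2, ← Finset.mul_sum]
      ring
    · intro q _
      exact (integrable_finsetSum _ fun k _ => hI3 k q).add
        ((hb l q.1).integrableOn.mul_const _)
  rw [add_assoc (∑ q ∈ Finset.HasAntidiagonal.antidiagonal α, _), ← Finset.sum_add_distrib,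
    Finset.sum_congr rfl h2, ← add_assoc, duhamel]
  congr 1
  rw [← sum_antidiagonal_mul_wickOne α w, ← Finset.sum_add_distrib]
  refine Finset.sum_congr rfl fun q _ => ?_
  rw [hee' q.2 0 t ht, ← Finset.mul_sum]
  ring

end Duhamel

/-! ### Existence, uniqueness and Picard iterations -/

theorem enorm_add_sq_le {E : Type*} [NormedAddCommGroup E] (x y : E) :
    ‖x + y‖ₑ ^ 2 ≤ 2 * (‖x‖ₑ ^ 2 + ‖y‖ₑ ^ 2) := by
  simp only [enorm_sq_eq_ofReal]
  rw [← ENNReal.ofReal_add (sq_nonneg _) (sq_nonneg _), ← ENNReal.ofReal_ofNat 2,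
    ← ENNReal.ofReal_mul (by norm_num)]
  refine ENNReal.ofReal_le_ofReal ?_
  exact (pow_le_pow_left₀ (norm_nonneg _) (norm_add_le x y) 2).trans add_sq_le

section Solution

variable {V ι : Type*} [MeasurableSpace V]

/-- Triangularity and causality: the value at `α` and `t` sees `u` only at the multiindices `α -
ε_k` and at times in `[0,t]`. -/
theorem sdeMap_congr {μ : Measure (ℝ × V)} (m : HilbertBasis ι ℝ (Lp ℝ 2 μ)) (G : Lp ℝ 2 μ)
    (w : GenRV ι) (f : ℝ × V → GenRV ι) {u v : ℝ → GenRV ι} {t : ℝ} {α : MultiIndex ι}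
    (h : ∀ k ∈ α.support, ∀ s ∈ Icc 0 t,
      u s (α - Finsupp.single k 1) = v s (α - Finsupp.single k 1)) :
    sdeMap m G w f u t α = sdeMap m G w f v t α := by
  rw [sdeMap_apply, sdeMap_apply]
  congr 1
  refine Finset.sum_congr rfl fun k hk => ?_
  refine setIntegral_congr_fun (measurableSet_slab _ _) fun x hx => ?_
  rw [h k hk x.1 (mem_slab.1 hx)]

theorem IsSolution.unique {μ : Measure (ℝ × V)} {m : HilbertBasis ι ℝ (Lp ℝ 2 μ)} {G : Lp ℝ 2 μ}
    {T : ℝ} {w : GenRV ι} {f : ℝ × V → GenRV ι} {u v : ℝ → GenRV ι}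
    (hu : IsSolution m T G w f u) (hv : IsSolution m T G w f v) {t : ℝ} (ht : t ∈ Icc 0 T) :
    u t = v t := by
  have key : ∀ n : ℕ, ∀ α : MultiIndex ι, α.degree = n → ∀ t ∈ Icc 0 T, u t α = v t α := by
    intro n
    induction n using Nat.strong_induction_on with
    | _ n ih =>
      intro α hα t ht
      rw [hu.2 t ht, hv.2 t ht]
      refine sdeMap_congr m G w f fun k hk s hs => ?_
      exact ih _ (hα ▸ degree_sub_single_lt hk) _ rfl s ⟨hs.1, hs.2.trans ht.2⟩
  ext α
  exact key _ α rfl t ht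

variable {T : ℝ} {π : Measure V}
  {m : HilbertBasis ι ℝ (Lp ℝ 2 (timeMeasure T π))} {G : Lp ℝ 2 (timeMeasure T π)} {w : GenRV ι}
  {f : ℝ × V → GenRV ι}

theorem ae_mem_Icc : ∀ᵐ x ∂(timeMeasure T π), x.1 ∈ Icc 0 T := by
  have h1 : ∀ᵐ r ∂((volume : Measure ℝ).restrict (Icc 0 T)), r ∈ Icc 0 T :=
    ae_restrict_mem measurableSet_Icc
  exact Measure.quasiMeasurePreserving_fst.ae h1

/-- The zero process acts as the iterate preceding the first one. This aligns the iteration with the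
kernel truncated at degree `0`, which is zero. -/
theorem picard_zero_eq : picard m G w f 0 = sdeMap m G w f fun _ => 0 := by
  ext t α
  simp [picard, sdeMap]

theorem integrable_mul_basis (m : HilbertBasis ι ℝ (Lp ℝ 2 (timeMeasure T π)))
    (G : Lp ℝ 2 (timeMeasure T π)) (k : ι) :
    Integrable (fun x => G x * m k x) (timeMeasure T π) :=
  integrable_mul_of_Lp (Lp.memLp G) (m k)

theorem memLp_mul_comp_fst (G : Lp ℝ 2 (timeMeasure T π)) {h : ℝ → ℝ}
    (hh : ContinuousOn h (Icc 0 T)) : MemLp (fun x => G x * h x.1) 2 (timeMeasure T π) := by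
  obtain ⟨B, hB⟩ := isCompact_Icc.exists_bound_of_continuousOn hh
  have h1 : AEStronglyMeasurable (fun x : ℝ × V => h x.1) (timeMeasure T π) :=
    (hh.aestronglyMeasurable measurableSet_Icc).comp_fst
  refine MemLp.of_le_mul (c := B) (Lp.memLp G) ((Lp.aestronglyMeasurable G).mul h1) ?_
  filter_upwards [ae_mem_Icc] with x hx
  rw [norm_mul, mul_comm]
  exact mul_le_mul_of_nonneg_right (hB _ hx) (norm_nonneg _)

theorem duhamel_eq_wick {e : MultiIndex ι → ℝ → ℝ → ℝ} {E : ℝ → ℝ → GenRV ι}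
    (h : ∀ β s t, s ≤ t → e β s t = E s t β) {t : ℝ} (ht : 0 ≤ t) :
    duhamel m w f e t = wick w (E 0 t) + skorokhodTo m t (fun x => wick (E x.1 t) (f x)) := by
  classical
  ext α
  rw [Pi.add_apply, skorokhodTo_apply, duhamel, wick]
  congr 1
  · exact Finset.sum_congr rfl fun q _ => by rw [h _ _ _ ht]
  · refine Finset.sum_congr rfl fun k _ => ?_
    refine setIntegral_congr_fun (measurableSet_slab _ _) fun x hx => ?_
    rw [wick_comm, wick, Finset.sum_mul]
    refine Finset.sum_congr rfl fun q _ => ?_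
    rw [h _ _ _ (mem_slab.1 hx).2]
    ring

theorem memL2D_integrand (hf : MemL2D (timeMeasure T π) f) {u : ℝ → GenRV ι} (hu : MemCD T u) :
    MemL2D (timeMeasure T π) fun x => G x • u x.1 + f x :=
  fun α => (memLp_mul_comp_fst G (hu α)).add (hf α)

variable [SigmaFinite π]

theorem continuousOn_skorokhodTo {g : ℝ × V → GenRV ι} (hg : MemL2D (timeMeasure T π) g)
    (α : MultiIndex ι) : ContinuousOn (fun t => skorokhodTo m t g α) (Icc 0 T) := by
  simp only [skorokhodTo_apply]
  refine continuousOn_finsetSum _ fun k _ => ?_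
  have h1 := integrable_mul_of_Lp (hg (α - Finsupp.single k 1)) (m k)
  have h2 := ((continuous_accum h1).sub (continuous_const
    (y := accum T π (fun x => g x (α - Finsupp.single k 1) * m k x) 0))).continuousOn (s := Icc 0 T)
  exact h2.congr fun t ht => setIntegral_slab_eq ht.1 h1

theorem memCD_sdeMap (hf : MemL2D (timeMeasure T π) f) {u : ℝ → GenRV ι} (hu : MemCD T u) :
    MemCD T (sdeMap m G w f u) := fun α =>
  continuousOn_const.add (continuousOn_skorokhodTo (memL2D_integrand hf hu) α)

theorem memCD_picard (hf : MemL2D (timeMeasure T π) f) (n : ℕ) :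
    MemCD T (picard m G w f n) := by
  induction n with
  | zero =>
    rw [picard_zero_eq]
    exact memCD_sdeMap hf fun α => continuousOn_const
  | succ n ih => exact memCD_sdeMap hf ih

theorem slicedCoeff_eq (m : HilbertBasis ι ℝ (Lp ℝ 2 (timeMeasure T π)))
    (G : Lp ℝ 2 (timeMeasure T π)) {s t : ℝ} (hst : s ≤ t) (k : ι) :
    slicedCoeff m G s t k =
      accum T π (fun x => G x * m k x) t - accum T π (fun x => G x * m k x) s := by
  rw [← setIntegral_slab_eq hst (integrable_mul_of_Lp (Lp.memLp G) (m k)), slicedCoeff,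
    ← integral_indicator (measurableSet_slab _ _)]
  refine integral_congr_ae (Eventually.of_forall fun x => ?_)
  by_cases hx : x ∈ slab V s t
  · simp [indicator_of_mem hx]
  · simp [indicator_of_notMem hx]

/-- The continuous extension to all `s, t` of `H(s,t)^β / β!`. -/
noncomputable def sdeKernel (m : HilbertBasis ι ℝ (Lp ℝ 2 (timeMeasure T π)))
    (G : Lp ℝ 2 (timeMeasure T π)) (β : MultiIndex ι) (s t : ℝ) : ℝ :=
  slabExp T π (fun k x => G x * m k x) β s t

/-- The part of `sdeKernel` of degree less than `n`. -/
noncomputable def sdeKernelTrunc (n : ℕ) (m : HilbertBasis ι ℝ (Lp ℝ 2 (timeMeasure T π)))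
    (G : Lp ℝ 2 (timeMeasure T π)) (β : MultiIndex ι) (s t : ℝ) : ℝ :=
  if β.degree < n then sdeKernel m G β s t else 0

theorem sdeKernel_eq_expCoeff {s t : ℝ} (hst : s ≤ t) (β : MultiIndex ι) :
    sdeKernel m G β s t = expCoeff (slicedCoeff m G s t) β := by
  rw [sdeKernel, slabExp]
  congr 1
  ext k
  exact (slicedCoeff_eq m G hst k).symm

theorem sdeKernelTrunc_eq_expCoeffTrunc {s t : ℝ} (hst : s ≤ t) (n : ℕ) (β : MultiIndex ι) :
    sdeKernelTrunc n m G β s t = expCoeffTrunc n (slicedCoeff m G s t) β := by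
  rw [sdeKernelTrunc, expCoeffTrunc, sdeKernel_eq_expCoeff hst]

theorem sdeKernel_eq (β : MultiIndex ι) {s t : ℝ} (hst : s ≤ t) :
    sdeKernel m G β s t = wickOne β + ∑ k ∈ β.support, ∫ x in slab V s t,
      G x * m k x * sdeKernel m G (β - Finsupp.single k 1) s x.1 ∂(timeMeasure T π) :=
  slabExp_eq (integrable_mul_basis m G) β hst

/-- Removing `ε_k` lowers the degree by exactly one, so a cutoff at `n + 1` on the left matches a
cutoff at `n` under the integral. Beyond the cutoff both sides vanish, as `β ≠ 0` there. -/
theorem sdeKernelTrunc_succ_eq (n : ℕ) (β : MultiIndex ι) {s t : ℝ} (hst : s ≤ t) :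
    sdeKernelTrunc (n + 1) m G β s t = wickOne β + ∑ k ∈ β.support, ∫ x in slab V s t,
      G x * m k x * sdeKernelTrunc n m G (β - Finsupp.single k 1) s x.1
        ∂(timeMeasure T π) := by
  have h1 : ∀ k ∈ β.support, (β - Finsupp.single k 1).degree + 1 = β.degree := by
    intro k hk
    conv_rhs => rw [← sub_single_add hk, map_add, Finsupp.degree_single]
  by_cases h : β.degree < n + 1
  · rw [sdeKernelTrunc, if_pos h, sdeKernel_eq β hst]
    congr 1
    refine Finset.sum_congr rfl fun k hk => ?_
    have h2 : (β - Finsupp.single k 1).degree < n := by have := h1 k hk; omega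
    simp only [sdeKernelTrunc, if_pos h2]
  · rw [sdeKernelTrunc, if_neg h, wickOne, if_neg (by rintro rfl; simp at h),
      Finset.sum_eq_zero, add_zero]
    intro k hk
    have h2 : ¬(β - Finsupp.single k 1).degree < n := by have := h1 k hk; omega
    simp only [sdeKernelTrunc, if_neg h2, mul_zero, integral_zero]

theorem continuous_sdeKernel (β : MultiIndex ι) :
    Continuous fun p : ℝ × ℝ => sdeKernel m G β p.1 p.2 :=
  continuous_slabExp (integrable_mul_basis m G) β

theorem exists_abs_sdeKernel_le (β : MultiIndex ι) :
    ∃ B, ∀ s t, |sdeKernel m G β s t| ≤ B :=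
  exists_abs_slabExp_le (integrable_mul_basis m G) β

theorem continuous_sdeKernelTrunc (n : ℕ) (β : MultiIndex ι) :
    Continuous fun p : ℝ × ℝ => sdeKernelTrunc n m G β p.1 p.2 := by
  unfold sdeKernelTrunc
  split_ifs
  · exact continuous_sdeKernel β
  · exact continuous_const

theorem exists_abs_sdeKernelTrunc_le (n : ℕ) (β : MultiIndex ι) :
    ∃ B, ∀ s t, |sdeKernelTrunc n m G β s t| ≤ B := by
  unfold sdeKernelTrunc
  split_ifs
  · exact exists_abs_sdeKernel_le β
  · exact ⟨0, by simp⟩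

/-- The solution of the equation. -/
noncomputable def solution (m : HilbertBasis ι ℝ (Lp ℝ 2 (timeMeasure T π)))
    (G : Lp ℝ 2 (timeMeasure T π)) (w : GenRV ι) (f : ℝ × V → GenRV ι) : ℝ → GenRV ι :=
  duhamel m w f (sdeKernel m G)

theorem sdeMap_solution (hf : MemL2D (timeMeasure T π) f) {t : ℝ} (ht : 0 ≤ t) :
    sdeMap m G w f (solution m G w f) t = solution m G w f t :=
  sdeMap_duhamel hf continuous_sdeKernel exists_abs_sdeKernel_le
    (fun β _ _ hst => sdeKernel_eq β hst) ht

/-- Each application of `sdeMap` raises the cutoff by one. Starting from the empty truncation,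
iterate `n` retains the degrees `0, …, n`, hence the index `n + 1`. -/
theorem picard_eq_duhamel (hf : MemL2D (timeMeasure T π) f) (n : ℕ) {t : ℝ} (ht : 0 ≤ t) :
    picard m G w f n t = duhamel m w f (sdeKernelTrunc (n + 1) m G) t := by
  induction n generalizing t with
  | zero =>
    rw [picard_zero_eq, ← sdeMap_duhamel hf (continuous_sdeKernelTrunc 0)
      (exists_abs_sdeKernelTrunc_le 0) (fun β _ _ hst => sdeKernelTrunc_succ_eq 0 β hst) ht]
    ext α
    refine sdeMap_congr m G w f fun k _ s _ => ?_
    simp [duhamel, sdeKernelTrunc]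
  | succ n ih =>
    rw [← sdeMap_duhamel hf (continuous_sdeKernelTrunc (n + 1))
      (exists_abs_sdeKernelTrunc_le (n + 1))
      (fun β _ _ hst => sdeKernelTrunc_succ_eq (n + 1) β hst) ht]
    ext α
    refine sdeMap_congr m G w f fun k _ s hs => ?_
    rw [ih hs.1]

/-- Every kernel multiindex entering the coefficient at `α` has degree at most `|α|`, so the
truncation is invisible. Convergence is thus eventual equality, with a threshold independent of `t`.
-/
theorem picard_eq_solution (hf : MemL2D (timeMeasure T π) f) {n : ℕ} {α : MultiIndex ι}
    (hn : α.degree ≤ n) {t : ℝ} (ht : 0 ≤ t) :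
    picard m G w f n t α = solution m G w f t α := by
  classical
  have h1 : ∀ p q : MultiIndex ι, p + q = α → q.degree < n + 1 := by
    rintro p q rfl
    rw [map_add] at hn
    omega
  rw [picard_eq_duhamel hf n ht, solution, duhamel, duhamel]
  congr 1
  · refine Finset.sum_congr rfl fun q hq => ?_
    rw [sdeKernelTrunc, if_pos (h1 _ _ (Finset.HasAntidiagonal.mem_antidiagonal.1 hq))]
  · refine Finset.sum_congr rfl fun k hk => ?_
    refine setIntegral_congr_fun (measurableSet_slab _ _) fun x _ => ?_
    refine Finset.sum_congr rfl fun q hq => ?_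
    have h2 := Finset.HasAntidiagonal.mem_antidiagonal.1 hq
    rw [sdeKernelTrunc, if_pos (h1 (q.1 + Finsupp.single k 1) q.2 ?_)]
    rw [add_right_comm, h2, sub_single_add hk]

/-- Continuity of the coefficient at `α` is inherited from the Picard iterate of index `|α|`, with
which it coincides on `[0,T]`. -/
theorem isSolution_solution (hf : MemL2D (timeMeasure T π) f) :
    IsSolution m T G w f (solution m G w f) :=
  ⟨fun α => (memCD_picard hf α.degree α).congr fun _ ht =>
    (picard_eq_solution hf le_rfl ht.1).symm, fun _ ht => (sdeMap_solution hf ht.1).symm⟩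

theorem tendstoUniformlyOn_picard (hf : MemL2D (timeMeasure T π) f) (v : MultiIndex ι →₀ ℝ) :
    TendstoUniformlyOn (fun n t => pairing (picard m G w f n t) v)
      (fun t => pairing (solution m G w f t) v) atTop (Icc 0 T) := by
  have h1 : ∀ᶠ n : ℕ in atTop, ∀ α ∈ v.support, α.degree ≤ n := by
    rw [Finset.eventually_all]
    exact fun α _ => eventually_ge_atTop _
  rw [Metric.tendstoUniformlyOn_iff]
  intro ε hε
  filter_upwards [h1] with n hn t ht
  have : pairing (picard m G w f n t) v = pairing (solution m G w f t) v :=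
    Finset.sum_congr rfl fun α hα => by simp only [picard_eq_solution hf (hn α hα) ht.1]
  rwa [this, dist_self]

theorem solution_eq_coeff {t : ℝ} (ht : 0 ≤ t) :
    solution m G w f t = forcingCoeff m G f t + initialCoeff m G w t := by
  classical
  ext α
  rw [Pi.add_apply, add_comm, solution, duhamel, forcingCoeff, initialCoeff]
  congr 1
  · exact Finset.sum_congr rfl fun q _ => by rw [sdeKernel_eq_expCoeff ht, expCoeff]
  · refine Finset.sum_congr rfl fun k _ => ?_
    refine setIntegral_congr_fun (measurableSet_slab _ _) fun x hx => ?_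
    exact Finset.sum_congr rfl fun q _ => by
      rw [sdeKernel_eq_expCoeff (mem_slab.1 hx).2, expCoeff]

variable {Ω : Type*} [MeasurableSpace Ω] {P : Measure Ω} [IsProbabilityMeasure P]
  {N : DrivingField (timeMeasure T π) P} {hB1 : AssumptionB1 N m}
  {K : MultiIndex ι → Lp ℝ 2 P}

theorem solution_eq_wick (hK : AssumptionB2 hB1 K) {t : ℝ} (ht : 0 ≤ t) :
    solution m G w f t = wick w (wickExp (sliceNoise N K G 0 t)) +
      skorokhodTo m t (fun x => wick (wickExp (sliceNoise N K G x.1 t)) (f x)) :=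
  duhamel_eq_wick (E := fun s t => wickExp (sliceNoise N K G s t))
    (fun β s t hst => by
      rw [hK.sliceNoise_eq, wickExp_linearSeries, sdeKernel_eq_expCoeff hst]) ht

theorem picard_eq_wick (hK : AssumptionB2 hB1 K) (hf : MemL2D (timeMeasure T π) f) (n : ℕ)
    {t : ℝ} (ht : 0 ≤ t) :
    picard m G w f n t = wick w (wickExpTrunc n (sliceNoise N K G 0 t)) +
      skorokhodTo m t (fun x => wick (wickExpTrunc n (sliceNoise N K G x.1 t)) (f x)) := by
  rw [picard_eq_duhamel hf n ht]
  exact duhamel_eq_wick (E := fun s t => wickExpTrunc n (sliceNoise N K G s t))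
    (fun β s t hst => by
      rw [hK.sliceNoise_eq, wickExpTrunc_linearSeries, sdeKernelTrunc_eq_expCoeffTrunc hst]) ht

/-- `(a+b)² ≤ 2(a²+b²)` is applied to the initial and forcing coefficients; the suprema in the two
norms dominate the resulting sums. -/
theorem iSup_secondMoment_solution_le (hK : AssumptionB2 hB1 K) (hne : ∀ α, K α ≠ 0) :
    (⨆ t ∈ Icc 0 T, secondMoment K (solution m G w f t)) ≤
      2 * (initialNormSq m T G w + forcingNormSq m T G f) := by
  refine iSup₂_le fun t ht => ?_
  rw [hK.secondMoment_eq hne, solution_eq_coeff ht.1]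
  have h1 : ∀ α, (mfactorial α : ℝ≥0∞) * ‖(forcingCoeff m G f t + initialCoeff m G w t) α‖ₑ ^ 2 ≤
      2 * ((mfactorial α : ℝ≥0∞) * ‖initialCoeff m G w t α‖ₑ ^ 2 +
        (mfactorial α : ℝ≥0∞) * ‖forcingCoeff m G f t α‖ₑ ^ 2) := by
    intro α
    rw [Pi.add_apply, add_comm, ← mul_add, mul_left_comm]
    gcongr
    exact enorm_add_sq_le _ _
  refine (ENNReal.tsum_le_tsum h1).trans ?_
  rw [ENNReal.tsum_mul_left, ENNReal.tsum_add]
  gcongr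
  · refine le_add_left ?_
    exact le_iSup₂ (f := fun t (_ : t ∈ Icc 0 T) =>
      ∑' α, (mfactorial α : ℝ≥0∞) * ‖initialCoeff m G w t α‖ₑ ^ 2) t ht
  · refine le_add_right ?_
    exact le_iSup₂ (f := fun t (_ : t ∈ Icc 0 T) =>
      ∑' α, (mfactorial α : ℝ≥0∞) * ‖forcingCoeff m G f t α‖ₑ ^ 2) t ht

end Solution

/-! ### Estimates of the chaos levels -/

section Levels

open scoped InnerProductSpace

variable {U ι : Type*} [MeasurableSpace U] {μ : Measure U}

/-- `∑_{|α| = n} α! u_α²`. -/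
noncomputable def levelSq (n : ℕ) (u : GenRV ι) : ℝ≥0∞ :=
  ∑' α : {α : MultiIndex ι // α.degree = n}, (mfactorial α.1 : ℝ≥0∞) * ‖u α.1‖ₑ ^ 2

theorem kernelNormSq_eq (n : ℕ) (u : GenRV ι) : kernelNormSq n u = n ! * levelSq n u := by
  rw [kernelNormSq, levelSq, ← ENNReal.tsum_mul_left]
  refine tsum_congr fun α => ?_
  push_cast
  ring

theorem memS_iff {u : GenRV ι} : MemS u ↔ ∀ n, levelSq n u < ∞ := by
  refine forall_congr' fun n => ?_
  rw [kernelNormSq_eq, ENNReal.mul_lt_top_iff]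
  have h1 : (n ! : ℝ≥0∞) < ∞ := ENNReal.natCast_lt_top _
  have h2 : (n ! : ℝ≥0∞) ≠ 0 := Nat.cast_ne_zero.2 (Nat.factorial_ne_zero _)
  constructor
  · rintro (h | h | h)
    · exact h.2
    · exact absurd h h2
    · simp [h]
  · exact fun h => Or.inl ⟨h1, h⟩

/-- `∑_{|α| = n} α! ∫ g_α² dμ`. -/
noncomputable def fieldLevelSq (μ : Measure U) (n : ℕ) (g : U → GenRV ι) : ℝ≥0∞ :=
  ∑' α : {α : MultiIndex ι // α.degree = n},
    (mfactorial α.1 : ℝ≥0∞) * ∫⁻ x, ‖g x α.1‖ₑ ^ 2 ∂μ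

theorem memSH_iff {f : U → GenRV ι} : MemSH μ f ↔ ∀ n, fieldLevelSq μ n f < ∞ := by
  refine forall_congr' fun n => ?_
  have h0 : ∑' α : {α : MultiIndex ι // α.degree = n},
      ((n ! * mfactorial α.1 : ℕ) : ℝ≥0∞) * ∫⁻ x, ‖f x α.1‖ₑ ^ 2 ∂μ =
      n ! * fieldLevelSq μ n f := by
    rw [fieldLevelSq, ← ENNReal.tsum_mul_left]
    refine tsum_congr fun α => ?_
    push_cast
    ring
  rw [h0, ENNReal.mul_lt_top_iff]
  have h1 : (n ! : ℝ≥0∞) < ∞ := ENNReal.natCast_lt_top _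
  have h2 : (n ! : ℝ≥0∞) ≠ 0 := Nat.cast_ne_zero.2 (Nat.factorial_ne_zero _)
  constructor
  · rintro (h | h | h)
    · exact h.2
    · exact absurd h h2
    · simp [h]
  · exact fun h => Or.inl ⟨h1, h⟩

theorem levelSq_add_le (n : ℕ) (u v : GenRV ι) :
    levelSq n (u + v) ≤ 2 * (levelSq n u + levelSq n v) := by
  rw [levelSq, levelSq, levelSq, ← ENNReal.tsum_add, ← ENNReal.tsum_mul_left]
  refine ENNReal.tsum_le_tsum fun α => ?_
  rw [← mul_add, mul_left_comm]
  gcongr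
  exact enorm_add_sq_le _ _

theorem levelSq_zero (u : GenRV ι) : levelSq 0 u = ‖u 0‖ₑ ^ 2 := by
  rw [levelSq, tsum_eq_single ⟨0, by simp⟩]
  · simp
  · rintro ⟨α, hα⟩ h
    exact absurd (Subtype.ext ((Finsupp.degree_eq_zero_iff α).1 hα)) h

@[simp] theorem levelSq_zero_right (n : ℕ) : levelSq n (0 : GenRV ι) = 0 := by
  simp [levelSq]

theorem levelSq_indicator_le {X : Type*} (n : ℕ) (A : Set X) (g : X → GenRV ι) (x : X) :
    levelSq n (A.indicator g x) ≤ levelSq n (g x) := by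
  by_cases hx : x ∈ A
  · rw [indicator_of_mem hx]
  · rw [indicator_of_notMem hx]
    simp

theorem levelSq_smul (n : ℕ) (c : ℝ) (u : GenRV ι) :
    levelSq n (c • u) = ‖c‖ₑ ^ 2 * levelSq n u := by
  rw [levelSq, levelSq, ← ENNReal.tsum_mul_left]
  refine tsum_congr fun α => ?_
  rw [Pi.smul_apply, enorm_smul]
  ring

theorem tsum_enorm_integral_mul_sq (m : HilbertBasis ι ℝ (Lp ℝ 2 μ)) {g : U → ℝ}
    (hg : MemLp g 2 μ) :
    ∑' k, ‖∫ x, g x * m k x ∂μ‖ₑ ^ 2 = ∫⁻ x, ‖g x‖ₑ ^ 2 ∂μ := by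
  have h1 : ∀ k, ∫ x, g x * m k x ∂μ = m.repr (hg.toLp g) k := by
    intro k
    rw [m.repr_apply_apply, real_inner_comm, inner_Lp_eq]
    refine integral_congr_ae ?_
    filter_upwards [hg.coeFn_toLp] with x hx
    rw [hx]
  have h2 := enorm_sq_of_orthogonal (fun i j hij => by
    simp [inner_smul_left, inner_smul_right, m.orthonormal.inner_eq_zero hij])
    (m.hasSum_repr (hg.toLp g))
  have h3 : ∀ k, ‖m.repr (hg.toLp g) k • m k‖ₑ ^ 2 = ‖m.repr (hg.toLp g) k‖ₑ ^ 2 := by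
    intro k
    rw [enorm_smul, mul_pow, enorm_sq_eq_ofReal (m k), m.orthonormal.norm_eq_one]
    simp
  simp only [h3] at h2
  simp only [h1, ← h2, enorm_sq_Lp]
  refine lintegral_congr_ae ?_
  filter_upwards [hg.coeFn_toLp] with x hx
  rw [hx]

/-- Cauchy-Schwarz with weights `α_k`, whose sum is `|α|`, and `α! / α_k = (α - ε_k)!`. -/
theorem mfactorial_mul_sq_sum_le (α : MultiIndex ι) (x : ι → ℝ) :
    (mfactorial α : ℝ) * (∑ k ∈ α.support, x k) ^ 2 ≤
      α.degree * ∑ k ∈ α.support, (mfactorial (α - Finsupp.single k 1) : ℝ) * x k ^ 2 := by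
  have h0 : ∀ k ∈ α.support, (0 : ℝ) < α k := fun k hk =>
    Nat.cast_pos.2 (Nat.pos_of_ne_zero (Finsupp.mem_support_iff.1 hk))
  have h1 := Finset.sum_sq_le_sum_mul_sum_of_sq_le_mul α.support
    (f := fun k => (α k : ℝ)) (g := fun k => x k ^ 2 / α k) (r := x)
    (fun k hk => (h0 k hk).le) (fun k hk => div_nonneg (sq_nonneg _) (h0 k hk).le)
    (fun k hk => by have := (h0 k hk).ne'; exact le_of_eq (by field_simp))
  rw [← Nat.cast_sum, sum_support_eq_degree] at h1
  calc (mfactorial α : ℝ) * (∑ k ∈ α.support, x k) ^ 2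
      ≤ mfactorial α * (α.degree * ∑ k ∈ α.support, x k ^ 2 / α k) := by gcongr
    _ = _ := by
      rw [mul_left_comm, Finset.mul_sum]
      congr 1
      refine Finset.sum_congr rfl fun k hk => ?_
      rw [mfactorial_eq_mul hk]
      have := (h0 k hk).ne'
      push_cast
      field_simp

/-- The map `(α, k) ↦ (α - ε_k, k)` is injective, since `α` is recovered by adding `ε_k` back. -/
theorem tsum_level_succ_le (n : ℕ) (Y : MultiIndex ι → ι → ℝ≥0∞) :
    ∑' α : {α : MultiIndex ι // α.degree = n + 1},
        ∑ k ∈ α.1.support, Y (α.1 - Finsupp.single k 1) k ≤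
      ∑' β : {β : MultiIndex ι // β.degree = n}, ∑' k, Y β.1 k := by
  have h1 : ∀ α : {α : MultiIndex ι // α.degree = n + 1},
      ∑ k ∈ α.1.support, Y (α.1 - Finsupp.single k 1) k =
        ∑' k : α.1.support, Y (α.1 - Finsupp.single k.1 1) k.1 := by
    intro α
    rw [tsum_fintype, Finset.sum_coe_sort α.1.support fun k => Y (α.1 - Finsupp.single k 1) k]
  simp only [h1]
  rw [← ENNReal.tsum_sigma, ← ENNReal.tsum_prod]
  refine ENNReal.tsum_comp_le_tsum_of_injective
    (f := fun p : (Σ α : {α : MultiIndex ι // α.degree = n + 1}, α.1.support) =>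
      ((⟨p.1.1 - Finsupp.single p.2.1 1, degree_sub_single p.2.2 p.1.2⟩, p.2.1) :
        {β : MultiIndex ι // β.degree = n} × ι)) ?_ (fun q => Y q.1.1 q.2)
  rintro ⟨⟨α, hα⟩, ⟨k, hk⟩⟩ ⟨⟨β, hβ⟩, ⟨l, hl⟩⟩ h
  simp only [Prod.mk.injEq, Subtype.mk.injEq] at h
  obtain ⟨h1, rfl⟩ := h
  have : α = β := (sub_single_add hk).symm.trans (h1 ▸ sub_single_add hl)
  subst this
  rfl

/-- The factor `n + 1` is the price for a general integrand. After the weighted Cauchy-Schwarz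
inequality, Parseval in `k` restores `∫ g_β² dμ`. -/
theorem levelSq_skorokhod_le (m : HilbertBasis ι ℝ (Lp ℝ 2 μ)) {g : U → GenRV ι}
    (hg : MemL2D μ g) (n : ℕ) :
    levelSq (n + 1) (skorokhod m g) ≤ (n + 1 : ℕ) * fieldLevelSq μ n g := by
  have h1 : ∀ α : {α : MultiIndex ι // α.degree = n + 1},
      (mfactorial α.1 : ℝ≥0∞) * ‖skorokhod m g α.1‖ₑ ^ 2 ≤
      (n + 1 : ℕ) * ∑ k ∈ α.1.support, (mfactorial (α.1 - Finsupp.single k 1) : ℝ≥0∞) *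
        ‖∫ x, g x (α.1 - Finsupp.single k 1) * m k x ∂μ‖ₑ ^ 2 := by
    rintro ⟨α, hα⟩
    have h2 := ENNReal.ofReal_le_ofReal (mfactorial_mul_sq_sum_le α
      fun k => ∫ x, g x (α - Finsupp.single k 1) * m k x ∂μ)
    rw [hα, ENNReal.ofReal_mul (Nat.cast_nonneg _), ENNReal.ofReal_mul (Nat.cast_nonneg _),
      ENNReal.ofReal_sum_of_nonneg (fun k _ => by positivity), ENNReal.ofReal_natCast,
      ENNReal.ofReal_natCast] at h2
    simp only [enorm_sq_eq_ofReal, Real.norm_eq_abs, sq_abs]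
    refine h2.trans_eq ?_
    congr 1
    refine Finset.sum_congr rfl fun k _ => ?_
    rw [ENNReal.ofReal_mul (Nat.cast_nonneg _), ENNReal.ofReal_natCast]
  refine (ENNReal.tsum_le_tsum h1).trans ?_
  rw [ENNReal.tsum_mul_left]
  gcongr
  refine (tsum_level_succ_le n fun β k => (mfactorial β : ℝ≥0∞) *
    ‖∫ x, g x β * m k x ∂μ‖ₑ ^ 2).trans_eq ?_
  refine tsum_congr fun β => ?_
  rw [ENNReal.tsum_mul_left, tsum_enorm_integral_mul_sq m (hg β.1)]

theorem skorokhod_sub (m : HilbertBasis ι ℝ (Lp ℝ 2 μ)) {g h : U → GenRV ι}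
    (hg : MemL2D μ g) (hh : MemL2D μ h) :
    skorokhod m (g - h) = skorokhod m g - skorokhod m h := by
  ext α
  rw [Pi.sub_apply, skorokhod, skorokhod, skorokhod, ← Finset.sum_sub_distrib]
  refine Finset.sum_congr rfl fun k _ => ?_
  have h1 : ∀ {g : U → GenRV ι}, MemL2D μ g →
      Integrable (fun x => g x (α - Finsupp.single k 1) * m k x) μ := fun hg =>
    (hg _).integrable_mul (Lp.memLp (m k))
  rw [← integral_sub (h1 hg) (h1 hh)]
  exact integral_congr_ae (Eventually.of_forall fun x => by simp [sub_mul])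

theorem fieldLevelSq_eq_lintegral [Countable ι] {g : U → GenRV ι} (hg : MemL2D μ g) (n : ℕ) :
    fieldLevelSq μ n g = ∫⁻ x, levelSq n (g x) ∂μ := by
  simp only [fieldLevelSq, levelSq]
  rw [lintegral_tsum]
  · refine tsum_congr fun α => ?_
    rw [lintegral_const_mul'' _ ((hg α.1).1.enorm.pow_const 2)]
  · exact fun α => ((hg α.1).1.enorm.pow_const 2).const_mul _

theorem aemeasurable_levelSq [Countable ι] {g : U → GenRV ι} (hg : MemL2D μ g) (n : ℕ) :
    AEMeasurable (fun x => levelSq n (g x)) μ :=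
  AEMeasurable.tsum fun α => ((hg α.1).1.enorm.pow_const 2).const_mul _

theorem MemL2D.indicator {g : U → GenRV ι} (hg : MemL2D μ g) {A : Set U} (hA : MeasurableSet A) :
    MemL2D μ (A.indicator g) := by
  intro α
  convert (hg α).indicator hA using 2 with x
  by_cases hx : x ∈ A
  · simp [indicator_of_mem hx]
  · simp [indicator_of_notMem hx]

end Levels

/-! ### Bounds and continuity in time of the chaos levels -/

section LevelBounds

variable {V ι : Type*} [MeasurableSpace V] {T : ℝ} {π : Measure V}
  {m : HilbertBasis ι ℝ (Lp ℝ 2 (timeMeasure T π))} {G : Lp ℝ 2 (timeMeasure T π)} {w : GenRV ι}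
  {f : ℝ × V → GenRV ι} {u : ℝ → GenRV ι}

/-- All the chaos levels of the process are bounded on `[0,T]`. -/
def LevelBounded (T : ℝ) (n : ℕ) (u : ℝ → GenRV ι) : Prop :=
  ∃ B : ℝ≥0∞, B < ∞ ∧ ∀ t ∈ Icc 0 T, levelSq n (u t) ≤ B

/-- A Skorokhod integral has no coefficient of order zero, so only `w 0` remains; this starts the
inductions on the level. -/
theorem levelBounded_zero_sdeMap : LevelBounded T 0 (sdeMap m G w f u) := by
  refine ⟨‖w 0‖ₑ ^ 2, ENNReal.pow_lt_top enorm_lt_top, fun t _ => ?_⟩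
  rw [levelSq_zero, sdeMap_apply]
  simp

variable [Countable ι]

theorem fieldLevelSq_integrand_lt_top (hf : MemL2D (timeMeasure T π) f) (hu : MemCD T u) {n : ℕ}
    (hfn : fieldLevelSq (timeMeasure T π) n f < ∞) (hun : LevelBounded T n u) :
    fieldLevelSq (timeMeasure T π) n (fun x => G x • u x.1 + f x) < ∞ := by
  obtain ⟨B, hB, hun⟩ := hun
  rw [fieldLevelSq_eq_lintegral (memL2D_integrand hf hu)]
  have h1 : ∀ᵐ x ∂(timeMeasure T π), levelSq n (G x • u x.1 + f x) ≤
      2 * (‖G x‖ₑ ^ 2 * B + levelSq n (f x)) := by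
    filter_upwards [ae_mem_Icc] with x hx
    refine (levelSq_add_le n _ _).trans ?_
    rw [levelSq_smul]
    gcongr
    exact hun _ hx
  refine (lintegral_mono_ae h1).trans_lt ?_
  have hG : AEMeasurable (fun x => ‖G x‖ₑ ^ 2 * B) (timeMeasure T π) :=
    ((Lp.aestronglyMeasurable G).enorm.pow_const 2).mul_const _
  rw [lintegral_const_mul' _ _ (by simp), lintegral_add_left' hG, lintegral_mul_const' _ _ hB.ne,
    ← enorm_sq_Lp, ← fieldLevelSq_eq_lintegral hf]
  refine ENNReal.mul_lt_top (by simp) (ENNReal.add_lt_top.2 ⟨ENNReal.mul_lt_top ?_ hB, hfn⟩)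
  exact ENNReal.pow_lt_top enorm_lt_top

theorem levelBounded_succ_sdeMap (hf : MemL2D (timeMeasure T π) f) (hu : MemCD T u) {n : ℕ}
    (hw : levelSq (n + 1) w < ∞) (hfn : fieldLevelSq (timeMeasure T π) n f < ∞)
    (hun : LevelBounded T n u) : LevelBounded T (n + 1) (sdeMap m G w f u) := by
  have hg := memL2D_integrand (G := G) hf hu
  refine ⟨2 * (levelSq (n + 1) w + (n + 1 : ℕ) * fieldLevelSq (timeMeasure T π) n
    (fun x => G x • u x.1 + f x)), ?_, fun t _ => ?_⟩
  · refine ENNReal.mul_lt_top (by simp) (ENNReal.add_lt_top.2 ⟨hw,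
      ENNReal.mul_lt_top (ENNReal.natCast_lt_top _) (fieldLevelSq_integrand_lt_top hf hu hfn hun)⟩)
  · refine (levelSq_add_le _ _ _).trans ?_
    gcongr
    refine (levelSq_skorokhod_le m (hg.indicator (measurableSet_slab 0 t)) n).trans ?_
    gcongr
    rw [fieldLevelSq_eq_lintegral hg,
      fieldLevelSq_eq_lintegral (hg.indicator (measurableSet_slab 0 t))]
    exact lintegral_mono fun x => levelSq_indicator_le _ _ _ _

theorem levelBounded_sdeMap (hf : MemL2D (timeMeasure T π) f) (hu : MemCD T u)
    (hw : MemS w) (hfS : MemSH (timeMeasure T π) f)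
    (hun : ∀ n, LevelBounded T n u) (n : ℕ) : LevelBounded T n (sdeMap m G w f u) := by
  cases n with
  | zero => exact levelBounded_zero_sdeMap
  | succ n =>
    exact levelBounded_succ_sdeMap hf hu (memS_iff.1 hw _) (memSH_iff.1 hfS _) (hun n)

theorem levelBounded_picard [SigmaFinite π] (hf : MemL2D (timeMeasure T π) f)
    (hw : MemS w) (hfS : MemSH (timeMeasure T π) f) (j n : ℕ) :
    LevelBounded T n (picard m G w f j) := by
  induction j generalizing n with
  | zero =>
    rw [picard_zero_eq]
    refine levelBounded_sdeMap hf (fun α => continuousOn_const) hw hfS (fun n => ?_) n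
    exact ⟨0, by simp, fun t _ => (levelSq_zero_right n).le⟩
  | succ j ih => exact levelBounded_sdeMap hf (memCD_picard hf j) hw hfS ih n

theorem IsSolution.levelBounded (hf : MemL2D (timeMeasure T π) f)
    (hw : MemS w) (hfS : MemSH (timeMeasure T π) f) (hu : IsSolution m T G w f u) (n : ℕ) :
    LevelBounded T n u := by
  induction n with
  | zero =>
    obtain ⟨B, hB, h⟩ := levelBounded_zero_sdeMap (T := T) (m := m) (G := G) (w := w) (f := f)
      (u := u)
    exact ⟨B, hB, fun t ht => hu.2 t ht ▸ h t ht⟩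
  | succ n ih =>
    obtain ⟨B, hB, h⟩ := levelBounded_succ_sdeMap (m := m) (G := G) hf hu.1
      (memS_iff.1 hw (n + 1)) (memSH_iff.1 hfS n) ih
    exact ⟨B, hB, fun t ht => hu.2 t ht ▸ h t ht⟩

/-- Absolute continuity of the integral cannot be applied to the slabs directly, as they may have
infinite measure when `π` is infinite. Integrating out `V` first reduces the claim to short time
intervals. -/
theorem tendsto_setLIntegral_slab [SigmaFinite π] {p : ℝ × V → ℝ≥0∞}
    (hp : AEMeasurable p (timeMeasure T π)) (hfin : ∫⁻ x, p x ∂(timeMeasure T π) < ∞) (t₀ : ℝ) :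
    Tendsto (fun t => ∫⁻ x in slab V (min t t₀) (max t t₀), p x ∂(timeMeasure T π))
      (𝓝 t₀) (𝓝 0) := by
  have h1 : ∀ s t, ∫⁻ x in slab V s t, p x ∂(timeMeasure T π) =
      ∫⁻ r in Icc s t, ∫⁻ v, p (r, v) ∂π ∂((volume : Measure ℝ).restrict (Icc 0 T)) := by
    intro s t
    rw [slab, timeMeasure, ← Measure.prod_restrict, Measure.restrict_univ, lintegral_prod]
    have h2 := hp.restrict (s := Icc s t ×ˢ univ)
    rwa [timeMeasure, ← Measure.prod_restrict, Measure.restrict_univ] at h2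
  simp only [h1]
  refine tendsto_setLIntegral_zero ?_ ?_
  · rw [← lintegral_prod _ hp]
    exact hfin.ne
  · have h2 : Tendsto (fun t : ℝ => ENNReal.ofReal (max t t₀ - min t t₀)) (𝓝 t₀) (𝓝 0) := by
      have : Continuous fun t : ℝ => ENNReal.ofReal (max t t₀ - min t t₀) :=
        ENNReal.continuous_ofReal.comp (by fun_prop)
      simpa using this.tendsto t₀
    refine tendsto_of_tendsto_of_tendsto_of_le_of_le tendsto_const_nhds h2 (fun _ => zero_le)
      fun t => ?_
    refine (Measure.restrict_apply_le _ _).trans ?_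
    rw [Real.volume_Icc]

/-- The two truncated integrands differ by `0` or `±f`, and they agree outside the slab between the
two times. -/
theorem levelSq_skorokhodTo_sub_le (hg : MemL2D (timeMeasure T π) f) (n : ℕ) (t t₀ : ℝ) :
    levelSq (n + 1) (skorokhodTo m t f - skorokhodTo m t₀ f) ≤ (n + 1 : ℕ) *
      ∫⁻ x in slab V (min t t₀) (max t t₀), levelSq n (f x) ∂(timeMeasure T π) := by
  have h1 := hg.indicator (measurableSet_slab 0 t)
  have h2 := hg.indicator (measurableSet_slab 0 t₀)
  have h3 : MemL2D (timeMeasure T π) ((slab V 0 t).indicator f - (slab V 0 t₀).indicator f) :=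
    fun α => (h1 α).sub (h2 α)
  rw [skorokhodTo, skorokhodTo, ← skorokhod_sub m h1 h2]
  refine (levelSq_skorokhod_le m h3 n).trans ?_
  gcongr
  rw [fieldLevelSq_eq_lintegral h3, ← lintegral_indicator (measurableSet_slab _ _)]
  refine lintegral_mono fun x => ?_
  by_cases hx : x ∈ slab V (min t t₀) (max t t₀)
  · rw [indicator_of_mem hx]
    simp only [Pi.sub_apply, indicator]
    split_ifs
    · simp
    · simp
    · simp [levelSq]
    · simp
  · rw [indicator_of_notMem hx]
    rw [mem_slab] at hx
    have h4 : x ∈ slab V 0 t ↔ x ∈ slab V 0 t₀ := by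
      rw [mem_slab, mem_slab]
      simp only [min_le_iff, le_max_iff, not_and_or, not_or, not_le] at hx
      constructor
      · rintro ⟨h5, h6⟩
        refine ⟨h5, ?_⟩
        rcases hx with hx | hx <;> linarith
      · rintro ⟨h5, h6⟩
        refine ⟨h5, ?_⟩
        rcases hx with hx | hx <;> linarith
    have h5 : ((slab V 0 t).indicator f - (slab V 0 t₀).indicator f) x = 0 := by
      by_cases h6 : x ∈ slab V 0 t₀
      · simp [h6, h4.2 h6]
      · simp [h6, mt h4.1 h6]
    rw [h5, levelSq_zero_right]

/-- Separating `v` from `u` serves both uses: `v` is the next Picard iterate after `u`, or `v = u`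
is the solution. -/
theorem memCS_of_eq_sdeMap [SigmaFinite π] (hf : MemL2D (timeMeasure T π) f) (hw : MemS w)
    (hfS : MemSH (timeMeasure T π) f) (hu : MemCD T u) (hun : ∀ n, LevelBounded T n u)
    {v : ℝ → GenRV ι} (hv : ∀ t ∈ Icc 0 T, v t = sdeMap m G w f u t) : MemCS T v := by
  have hg := memL2D_integrand (G := G) hf hu
  refine ⟨fun t ht => memS_iff.2 fun n => ?_, fun n t₀ ht₀ => ?_⟩
  · obtain ⟨B, hB, h⟩ := levelBounded_sdeMap (m := m) (G := G) hf hu hw hfS hun n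
    rw [hv t ht]
    exact (h t ht).trans_lt hB
  · have h1 : ∀ t ∈ Icc 0 T, v t - v t₀ =
        skorokhodTo m t (fun x => G x • u x.1 + f x) -
          skorokhodTo m t₀ (fun x => G x • u x.1 + f x) := by
      intro t ht
      rw [hv t ht, hv t₀ ht₀, sdeMap, sdeMap, add_sub_add_left_eq_sub]
    cases n with
    | zero =>
      refine tendsto_const_nhds.congr' ?_
      filter_upwards [self_mem_nhdsWithin] with t ht
      rw [kernelNormSq_eq, levelSq_zero, h1 t ht]
      simp [skorokhodTo_apply]
    | succ n =>
      have h2 := tendsto_setLIntegral_slab (aemeasurable_levelSq hg n)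
        (by
          rw [← fieldLevelSq_eq_lintegral hg]
          exact fieldLevelSq_integrand_lt_top hf hu (memSH_iff.1 hfS n) (hun n)) t₀
      have h3 := (ENNReal.Tendsto.const_mul h2
        (Or.inr (ENNReal.natCast_ne_top ((n + 1)! * (n + 1))))).mono_left
          (nhdsWithin_le_nhds (s := Icc 0 T))
      rw [mul_zero] at h3
      refine tendsto_of_tendsto_of_tendsto_of_le_of_le' tendsto_const_nhds h3
        (Eventually.of_forall fun _ => zero_le) ?_
      filter_upwards [self_mem_nhdsWithin] with t ht
      rw [kernelNormSq_eq, h1 t ht, Nat.cast_mul, mul_assoc]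
      gcongr
      exact levelSq_skorokhodTo_sub_le hg n t t₀

end LevelBounds

/-! ### Symmetric tensors -/

section KernelFunctions

variable {U ι : Type*} [MeasurableSpace U] {μ : Measure U}

/-- The functions `E_α` on `U^n`, computed by expansion in the first variable; `E_α = 0` if
`|α| ≠ n`. -/
noncomputable def kernelFn (m : HilbertBasis ι ℝ (Lp ℝ 2 μ)) :
    (n : ℕ) → MultiIndex ι → (Fin n → U) → ℝ
  | 0, α, _ => wickOne α
  | n + 1, α, z => ∑ k ∈ α.support,
      (α k : ℝ) * (m k (z 0) * kernelFn m n (α - Finsupp.single k 1) (Fin.tail z))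

theorem kernelFn_of_degree_ne (m : HilbertBasis ι ℝ (Lp ℝ 2 μ)) {n : ℕ} {α : MultiIndex ι}
    (h : α.degree ≠ n) : kernelFn m n α = 0 := by
  induction n generalizing α with
  | zero =>
    ext z
    have : α ≠ 0 := by rintro rfl; simp at h
    simp [kernelFn, wickOne, this]
  | succ n ih =>
    ext z
    refine Finset.sum_eq_zero fun k hk => ?_
    rw [ih]
    · simp
    · intro h1
      apply h
      rw [← sub_single_add hk, map_add, h1, Finsupp.degree_single]

theorem sum_smul_sum_single {M : Type*} [AddCommMonoid M] {n : ℕ} (k : Fin n → ι) (F : ι → M) :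
    ∑ l ∈ (∑ i, Finsupp.single (k i) 1 : MultiIndex ι).support,
      (∑ i, Finsupp.single (k i) 1 : MultiIndex ι) l • F l = ∑ i, F (k i) := by
  have h1 := Finsupp.sum_finsetSum_index (s := Finset.univ)
    (g := fun i : Fin n => (Finsupp.single (k i) 1 : MultiIndex ι)) (h := fun l a => a • F l)
    (by simp) (by intros; rw [add_smul])
  have h2 : ∀ i, (Finsupp.single (k i) 1 : MultiIndex ι).sum (fun l a => a • F l) = F (k i) := by
    intro i
    rw [Finsupp.sum_single_index] <;> simp
  simp only [h2] at h1
  exact h1.symm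

theorem sum_single_swap {n : ℕ} (k : Fin (n + 1) → ι) (p : Fin (n + 1)) :
    ∑ i : Fin n, Finsupp.single (k (Equiv.swap 0 p i.succ)) 1 =
      (∑ i, Finsupp.single (k i) 1 : MultiIndex ι) - Finsupp.single (k p) 1 := by
  have h1 : (∑ i, Finsupp.single (k i) 1 : MultiIndex ι) =
      ∑ i, Finsupp.single (k (Equiv.swap 0 p i)) 1 :=
    (Equiv.sum_comp (Equiv.swap 0 p) fun i => Finsupp.single (k i) 1).symm
  rw [h1, Fin.sum_univ_succ, Equiv.swap_apply_left, add_tsub_cancel_left]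

theorem sum_perm_succ {M : Type*} [AddCommMonoid M] {n : ℕ} (F : Equiv.Perm (Fin (n + 1)) → M) :
    ∑ σ, F σ = ∑ p, ∑ e : Equiv.Perm (Fin n), F (Equiv.Perm.decomposeFin.symm (p, e)) := by
  rw [← Equiv.sum_comp Equiv.Perm.decomposeFin.symm, Fintype.sum_prod_type]

/-- A permutation of `n + 1` points splits into the image `p` of `0` and a permutation of the other
points. Grouping the `p` with equal index `k p` accounts for the weight `α k` in `kernelFn`. -/
theorem symTensor_eq_kernelFn (m : HilbertBasis ι ℝ (Lp ℝ 2 μ)) {n : ℕ} (k : Fin n → ι) :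
    symTensor m k = kernelFn m n (∑ i, Finsupp.single (k i) 1) := by
  induction n with
  | zero =>
    ext z
    simp [symTensor, kernelFn, wickOne]
  | succ n ih =>
    ext z
    have h1 : ∀ p, m (k p) (z 0) * kernelFn m n
        ((∑ i, Finsupp.single (k i) 1 : MultiIndex ι) - Finsupp.single (k p) 1) (Fin.tail z) =
        ∑ e : Equiv.Perm (Fin n),
          ∏ i, m (k (Equiv.Perm.decomposeFin.symm (p, e) i)) (z i) := by
      intro p
      rw [← sum_single_swap, ← ih, symTensor, Finset.mul_sum]
      refine Finset.sum_congr rfl fun e _ => ?_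
      rw [Fin.prod_univ_succ, Equiv.Perm.decomposeFin_symm_apply_zero]
      simp only [Equiv.Perm.decomposeFin_symm_apply_succ]
      rfl
    have h2 := sum_smul_sum_single k fun l => m l (z 0) * kernelFn m n
        ((∑ i, Finsupp.single (k i) 1 : MultiIndex ι) - Finsupp.single l 1) (Fin.tail z)
    simp only [nsmul_eq_mul] at h2
    rw [kernelFn, h2, symTensor, sum_perm_succ]
    exact Finset.sum_congr rfl fun p _ => (h1 p).symm

theorem exists_listing {n : ℕ} {α : MultiIndex ι} (h : α.degree = n) :
    ∃ k : Fin n → ι, ∑ i, Finsupp.single (k i) 1 = α := by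
  induction n generalizing α with
  | zero => exact ⟨Fin.elim0, by simpa using ((Finsupp.degree_eq_zero_iff α).1 h).symm⟩
  | succ n ih =>
    have hne : α ≠ 0 := by rintro rfl; simp at h
    obtain ⟨j, hj⟩ := Finsupp.support_nonempty_iff.2 hne
    obtain ⟨k, hk⟩ := ih (degree_sub_single hj h)
    refine ⟨Fin.cons j k, ?_⟩
    simp only [Fin.sum_univ_succ, Fin.cons_zero, Fin.cons_succ]
    rw [hk, add_comm, sub_single_add hj]

/-- Shows that the listing picked by `Exists.choose` is immaterial. -/
theorem symBasis_eq_kernelFn (m : HilbertBasis ι ℝ (Lp ℝ 2 μ)) (n : ℕ) (α : MultiIndex ι) :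
    symBasis m n α = kernelFn m n α := by
  ext z
  rw [symBasis]
  split_ifs with h
  · rw [symTensor_eq_kernelFn, h.choose_spec]
  · rw [kernelFn_of_degree_ne m (fun h1 => h (exists_listing h1)), Pi.zero_apply]

/-- Summing `m_k ⊗ E_β` over the slot `p` that receives `m_k` gives `E_{β+ε_k}` with no extra
factor. The proof inverts the permutations, so that they act on the variables instead of the
indices, and splits each one by the image of `0`. -/
theorem sum_kernelFn_swap (m : HilbertBasis ι ℝ (Lp ℝ 2 μ)) (n : ℕ) (β : MultiIndex ι) (k : ι)
    (z : Fin (n + 1) → U) :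
    ∑ p, m k (z p) * kernelFn m n β (fun i => z (Equiv.swap 0 p i.succ)) =
      kernelFn m (n + 1) (β + Finsupp.single k 1) z := by
  by_cases h : β.degree = n
  · obtain ⟨l, rfl⟩ := exists_listing h
    have h1 : (∑ i, Finsupp.single (l i) 1 : MultiIndex ι) + Finsupp.single k 1 =
        ∑ i, Finsupp.single ((Fin.cons k l : Fin (n + 1) → ι) i) 1 := by
      simp only [Fin.sum_univ_succ, Fin.cons_zero, Fin.cons_succ]
      rw [add_comm]
    have h2 : symTensor m (Fin.cons k l : Fin (n + 1) → ι) z =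
        ∑ σ : Equiv.Perm (Fin (n + 1)), ∏ i, m ((Fin.cons k l : Fin (n + 1) → ι) i) (z (σ i)) := by
      rw [symTensor, ← Equiv.sum_comp (Equiv.inv (Equiv.Perm (Fin (n + 1))))]
      refine Finset.sum_congr rfl fun σ _ => ?_
      rw [← Equiv.prod_comp σ]
      simp
    have h3 : ∀ p, m k (z p) * kernelFn m n (∑ i, Finsupp.single (l i) 1)
        (fun i => z (Equiv.swap 0 p i.succ)) = ∑ e : Equiv.Perm (Fin n),
          ∏ i, m ((Fin.cons k l : Fin (n + 1) → ι) i)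
            (z (Equiv.Perm.decomposeFin.symm (p, e) i)) := by
      intro p
      rw [← symTensor_eq_kernelFn, symTensor, Finset.mul_sum,
        ← Equiv.sum_comp (Equiv.inv (Equiv.Perm (Fin n)))]
      refine Finset.sum_congr rfl fun e _ => ?_
      rw [Fin.prod_univ_succ, Equiv.Perm.decomposeFin_symm_apply_zero, Fin.cons_zero]
      simp only [Equiv.Perm.decomposeFin_symm_apply_succ, Fin.cons_succ]
      rw [← Equiv.prod_comp e]
      simp
    rw [h1, ← symTensor_eq_kernelFn m (Fin.cons k l : Fin (n + 1) → ι), h2, sum_perm_succ]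
    exact Finset.sum_congr rfl fun p _ => h3 p
  · rw [kernelFn_of_degree_ne m h, kernelFn_of_degree_ne m]
    · simp
    · rw [map_add, Finsupp.degree_single]
      omega

end KernelFunctions

/-! ### Tensor products in `L²` -/

section ProductLp

open scoped InnerProductSpace

variable {X Y : Type*} [MeasurableSpace X] [MeasurableSpace Y] {μ : Measure X} {ν : Measure Y}

theorem memLp_mul_prod {a : X → ℝ} {b : Y → ℝ} (ha : MemLp a 2 μ) (hb : MemLp b 2 ν) :
    MemLp (fun z : X × Y => a z.1 * b z.2) 2 (μ.prod ν) := by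
  have h1 : AEStronglyMeasurable (fun z : X × Y => a z.1 * b z.2) (μ.prod ν) :=
    ha.1.comp_fst.mul hb.1.comp_snd
  rw [memLp_two_iff_integrable_sq h1]
  simpa only [mul_pow] using ha.integrable_sq.mul_prod hb.integrable_sq

/-- The tensor product `a ⊗ b` in `L²(μ ⊗ ν)`. -/
noncomputable def prodLp (a : Lp ℝ 2 μ) (b : Lp ℝ 2 ν) : Lp ℝ 2 (μ.prod ν) :=
  (memLp_mul_prod (Lp.memLp a) (Lp.memLp b)).toLp _

theorem coeFn_prodLp (a : Lp ℝ 2 μ) (b : Lp ℝ 2 ν) :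
    prodLp a b =ᵐ[μ.prod ν] fun z => a z.1 * b z.2 :=
  MemLp.coeFn_toLp _

theorem coeFn_prodLp_of_ae {a : Lp ℝ 2 μ} {b : Lp ℝ 2 ν} {a' : X → ℝ} {b' : Y → ℝ}
    (ha : a =ᵐ[μ] a') (hb : b =ᵐ[ν] b') :
    prodLp a b =ᵐ[μ.prod ν] fun z => a' z.1 * b' z.2 := by
  filter_upwards [coeFn_prodLp a b, Measure.quasiMeasurePreserving_fst.ae ha,
    Measure.quasiMeasurePreserving_snd.ae hb] with z h1 h2 h3
  rw [h1, h2, h3]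

theorem inner_prodLp [SFinite μ] [SFinite ν] (a a' : Lp ℝ 2 μ) (b b' : Lp ℝ 2 ν) :
    ⟪prodLp a b, prodLp a' b'⟫_ℝ = ⟪a, a'⟫_ℝ * ⟪b, b'⟫_ℝ := by
  rw [prodLp, prodLp, inner_toLp_toLp, inner_Lp_eq, inner_Lp_eq, ← integral_prod_mul]
  exact integral_congr_ae (Eventually.of_forall fun z => by ring)

theorem norm_prodLp [SFinite μ] [SFinite ν] (a : Lp ℝ 2 μ) (b : Lp ℝ 2 ν) :
    ‖prodLp a b‖ = ‖a‖ * ‖b‖ := by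
  have h1 := inner_prodLp a a b b
  simp only [real_inner_self_eq_norm_sq] at h1
  rw [← mul_pow] at h1
  exact (pow_left_inj₀ (norm_nonneg _) (by positivity) two_ne_zero).1 h1

theorem prodLp_add_left (a a' : Lp ℝ 2 μ) (b : Lp ℝ 2 ν) :
    prodLp (a + a') b = prodLp a b + prodLp a' b := by
  refine Lp.ext ?_
  filter_upwards [coeFn_prodLp_of_ae (Lp.coeFn_add a a') (EventuallyEq.refl _ b),
    coeFn_prodLp a b, coeFn_prodLp a' b, Lp.coeFn_add (prodLp a b) (prodLp a' b)] with z h1 h2 h3 h4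
  rw [h1, h4, Pi.add_apply, Pi.add_apply, h2, h3, add_mul]

theorem prodLp_smul_left (c : ℝ) (a : Lp ℝ 2 μ) (b : Lp ℝ 2 ν) :
    prodLp (c • a) b = c • prodLp a b := by
  refine Lp.ext ?_
  filter_upwards [coeFn_prodLp_of_ae (Lp.coeFn_smul c a) (EventuallyEq.refl _ b),
    coeFn_prodLp a b, Lp.coeFn_smul c (prodLp a b)] with z h1 h2 h3
  rw [h1, h3, Pi.smul_apply, Pi.smul_apply, h2, smul_eq_mul, smul_eq_mul, mul_assoc]

/-- `prodLp` as a continuous linear map in the first factor. -/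
noncomputable def prodCLM [SFinite μ] [SFinite ν] (b : Lp ℝ 2 ν) :
    Lp ℝ 2 μ →L[ℝ] Lp ℝ 2 (μ.prod ν) :=
  LinearMap.mkContinuous
    { toFun := fun a => prodLp a b
      map_add' := fun a a' => prodLp_add_left a a' b
      map_smul' := fun c a => prodLp_smul_left c a b } ‖b‖
    fun a => by
      change ‖prodLp a b‖ ≤ _
      rw [norm_prodLp, mul_comm]

end ProductLp

/-! ### The `E_α` as an orthogonal system in `L²(U^n)` -/

section KernelLp

open scoped InnerProductSpace

variable {U ι : Type*} [MeasurableSpace U] {μ : Measure U} [SigmaFinite μ]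

/-- The measure `μ^n` on `U^n`. -/
noncomputable abbrev powMeasure (μ : Measure U) (n : ℕ) : Measure (Fin n → U) :=
  Measure.pi fun _ => μ

theorem measurePreserving_cons (μ : Measure U) [SigmaFinite μ] (n : ℕ) :
    MeasurePreserving (fun z : Fin (n + 1) → U => (z 0, Fin.tail z)) (powMeasure μ (n + 1))
      (μ.prod (powMeasure μ n)) := by
  have h1 := measurePreserving_piFinSuccAbove (fun _ : Fin (n + 1) => μ) 0
  convert h1 using 1
  ext z : 1
  exact Prod.ext rfl (funext fun j => by simp [MeasurableEquiv.piFinSuccAbove, Fin.tail])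

theorem measurePreserving_swap (μ : Measure U) [SigmaFinite μ] {n : ℕ} (p : Fin (n + 1)) :
    MeasurePreserving (fun (z : Fin (n + 1) → U) i => z (Equiv.swap 0 p i))
      (powMeasure μ (n + 1)) (powMeasure μ (n + 1)) := by
  have h1 := measurePreserving_piCongrLeft (fun _ : Fin (n + 1) => μ) (Equiv.swap 0 p)
  convert h1 using 1
  ext z i
  have := MeasurableEquiv.piCongrLeft_apply_apply (Equiv.swap 0 p) (β := fun _ => U) z
    (Equiv.swap 0 p i)
  rw [Equiv.swap_apply_self] at this
  exact this.symm

/-- The element `a ⊗ b` of `L²(U^{n+1})`. -/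
noncomputable def consLp {n : ℕ} : Lp ℝ 2 (μ.prod (powMeasure μ n)) →ₗᵢ[ℝ]
    Lp ℝ 2 (powMeasure μ (n + 1)) :=
  Lp.compMeasurePreservingₗᵢ ℝ _ (measurePreserving_cons μ n)

theorem coeFn_consLp {n : ℕ} (X : Lp ℝ 2 (μ.prod (powMeasure μ n))) :
    consLp X =ᵐ[powMeasure μ (n + 1)] fun z => X (z 0, Fin.tail z) :=
  Lp.coeFn_compMeasurePreserving _ (measurePreserving_cons μ n)

/-- Transposition of the arguments `0` and `p`. -/
noncomputable def swapLp {n : ℕ} (p : Fin (n + 1)) : Lp ℝ 2 (powMeasure μ (n + 1)) →ₗᵢ[ℝ]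
    Lp ℝ 2 (powMeasure μ (n + 1)) :=
  Lp.compMeasurePreservingₗᵢ ℝ _ (measurePreserving_swap μ p)

theorem coeFn_swapLp {n : ℕ} (p : Fin (n + 1)) (X : Lp ℝ 2 (powMeasure μ (n + 1))) :
    swapLp p X =ᵐ[powMeasure μ (n + 1)] fun z => X fun i => z (Equiv.swap 0 p i) :=
  Lp.coeFn_compMeasurePreserving _ (measurePreserving_swap μ p)

theorem memLp_kernelFn (m : HilbertBasis ι ℝ (Lp ℝ 2 μ)) (n : ℕ) (α : MultiIndex ι) :
    MemLp (kernelFn m n α) 2 (powMeasure μ n) := by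
  induction n generalizing α with
  | zero =>
    have : IsFiniteMeasure (powMeasure μ 0) := by
      rw [powMeasure, Measure.pi_of_empty]
      infer_instance
    exact memLp_const _
  | succ n ih =>
    refine memLp_finsetSum _ fun k _ => MemLp.const_mul ?_ _
    exact (memLp_mul_prod (Lp.memLp (m k)) (ih (α - Finsupp.single k 1))).comp_measurePreserving
      (measurePreserving_cons μ n)

/-- `E_α` as an element of `L²(U^n)`. -/
noncomputable def kernelLp (m : HilbertBasis ι ℝ (Lp ℝ 2 μ)) (n : ℕ) (α : MultiIndex ι) :
    Lp ℝ 2 (powMeasure μ n) :=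
  (memLp_kernelFn m n α).toLp _

theorem coeFn_kernelLp (m : HilbertBasis ι ℝ (Lp ℝ 2 μ)) (n : ℕ) (α : MultiIndex ι) :
    kernelLp m n α =ᵐ[powMeasure μ n] kernelFn m n α :=
  MemLp.coeFn_toLp _

theorem kernelLp_of_degree_ne (m : HilbertBasis ι ℝ (Lp ℝ 2 μ)) {n : ℕ} {α : MultiIndex ι}
    (h : α.degree ≠ n) : kernelLp m n α = 0 := by
  refine Lp.ext ?_
  filter_upwards [coeFn_kernelLp m n α, Lp.coeFn_zero ℝ 2 (powMeasure μ n)] with z h1 h2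
  rw [h1, h2, kernelFn_of_degree_ne m h]

theorem ae_cons {n : ℕ} {p : U × (Fin n → U) → Prop}
    (h : ∀ᵐ x ∂(μ.prod (powMeasure μ n)), p x) :
    ∀ᵐ z ∂(powMeasure μ (n + 1)), p (z 0, Fin.tail z) :=
  (measurePreserving_cons μ n).quasiMeasurePreserving.ae h

theorem coeFn_consLp_prodLp {n : ℕ} {a : Lp ℝ 2 μ} {b : Lp ℝ 2 (powMeasure μ n)} {a' : U → ℝ}
    {b' : (Fin n → U) → ℝ} (ha : a =ᵐ[μ] a') (hb : b =ᵐ[powMeasure μ n] b') :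
    consLp (prodLp a b) =ᵐ[powMeasure μ (n + 1)] fun z => a' (z 0) * b' (Fin.tail z) := by
  filter_upwards [coeFn_consLp (prodLp a b), ae_cons (coeFn_prodLp_of_ae ha hb)] with z h1 h2
  rw [h1, h2]

theorem coeFn_finset_sum {X κ : Type*} [MeasurableSpace X] {ν : Measure X} (s : Finset κ)
    (F : κ → Lp ℝ 2 ν) : ⇑(∑ i ∈ s, F i) =ᵐ[ν] fun x => ∑ i ∈ s, F i x := by
  classical
  induction s using Finset.induction_on with
  | empty =>
    simp only [Finset.sum_empty]
    exact Lp.coeFn_zero _ _ _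
  | insert i s hi ih =>
    rw [Finset.sum_insert hi]
    filter_upwards [Lp.coeFn_add (F i) (∑ i ∈ s, F i), ih] with x h1 h2
    rw [h1, Pi.add_apply, h2, Finset.sum_insert hi]

theorem kernelLp_succ (m : HilbertBasis ι ℝ (Lp ℝ 2 μ)) (n : ℕ) (α : MultiIndex ι) :
    kernelLp m (n + 1) α = ∑ k ∈ α.support,
      (α k : ℝ) • consLp (prodLp (m k) (kernelLp m n (α - Finsupp.single k 1))) := by
  refine Lp.ext ?_
  have h1 : ∀ᵐ z ∂(powMeasure μ (n + 1)), ∀ k ∈ α.support,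
      ((α k : ℝ) • consLp (prodLp (m k) (kernelLp m n (α - Finsupp.single k 1))) :
        Lp ℝ 2 (powMeasure μ (n + 1))) z =
      (α k : ℝ) * (m k (z 0) * kernelFn m n (α - Finsupp.single k 1) (Fin.tail z)) := by
    rw [Finset.eventually_all]
    intro k _
    filter_upwards [Lp.coeFn_smul (α k : ℝ)
      (consLp (prodLp (m k) (kernelLp m n (α - Finsupp.single k 1)))),
      coeFn_consLp_prodLp (EventuallyEq.refl _ (m k))
        (coeFn_kernelLp m n (α - Finsupp.single k 1))] with z h1 h2
    rw [h1, Pi.smul_apply, h2, smul_eq_mul]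
  filter_upwards [coeFn_kernelLp m (n + 1) α, coeFn_finset_sum α.support fun k =>
    (α k : ℝ) • consLp (prodLp (m k) (kernelLp m n (α - Finsupp.single k 1))), h1] with z h2 h3 h4
  rw [h2, h3, kernelFn, Finset.sum_congr rfl h4]

theorem inner_kernelLp_succ_term (m : HilbertBasis ι ℝ (Lp ℝ 2 μ)) (n : ℕ) (α β : MultiIndex ι)
    (k l : ι) (a b : ℝ) :
    ⟪a • consLp (prodLp (m k) (kernelLp m n α)), b • consLp (prodLp (m l) (kernelLp m n β))⟫_ℝ =
      a * b * (⟪m k, m l⟫_ℝ * ⟪kernelLp m n α, kernelLp m n β⟫_ℝ) := by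
  rw [inner_smul_left, inner_smul_right, LinearIsometry.inner_map_map, inner_prodLp]
  simp only [conj_trivial]
  ring

/-- Expand in the first variable: terms with `k ≠ l` vanish by orthonormality of `m`, and those with
`k = l` pair the different multiindices `α - ε_k` and `β - ε_k`. -/
theorem inner_kernelLp_of_ne (m : HilbertBasis ι ℝ (Lp ℝ 2 μ)) (n : ℕ) {α β : MultiIndex ι}
    (h : α ≠ β) : ⟪kernelLp m n α, kernelLp m n β⟫_ℝ = 0 := by
  induction n generalizing α β with
  | zero =>
    by_cases h1 : α.degree = 0
    · have h2 : β.degree ≠ 0 := fun h2 => h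
        (((Finsupp.degree_eq_zero_iff α).1 h1).trans ((Finsupp.degree_eq_zero_iff β).1 h2).symm)
      rw [kernelLp_of_degree_ne m h2, inner_zero_right]
    · rw [kernelLp_of_degree_ne m h1, inner_zero_left]
  | succ n ih =>
    rw [kernelLp_succ, kernelLp_succ, sum_inner]
    refine Finset.sum_eq_zero fun k hk => ?_
    rw [inner_sum]
    refine Finset.sum_eq_zero fun l hl => ?_
    rw [inner_kernelLp_succ_term]
    by_cases hkl : k = l
    · subst hkl
      rw [ih, mul_zero, mul_zero]
      intro h1
      exact h ((sub_single_add hk).symm.trans (h1 ▸ sub_single_add hl))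
    · rw [m.orthonormal.inner_eq_zero hkl, zero_mul, mul_zero]

/-- The expansion in the first variable gives `∑_k α_k² n! (α-ε_k)! = n! α! ∑_k α_k = (n+1)! α!`. -/
theorem norm_kernelLp_sq (m : HilbertBasis ι ℝ (Lp ℝ 2 μ)) {n : ℕ} {α : MultiIndex ι}
    (h : α.degree = n) : ‖kernelLp m n α‖ ^ 2 = n ! * mfactorial α := by
  induction n generalizing α with
  | zero =>
    have h0 := (Finsupp.degree_eq_zero_iff α).1 h
    subst h0
    rw [← real_inner_self_eq_norm_sq, kernelLp, inner_toLp_toLp]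
    simp [kernelFn, wickOne, powMeasure, Measure.real]
  | succ n ih =>
    have h1 : ∀ k ∈ α.support, ∑ l ∈ α.support,
        ⟪(α k : ℝ) • consLp (prodLp (m k) (kernelLp m n (α - Finsupp.single k 1))),
          (α l : ℝ) • consLp (prodLp (m l) (kernelLp m n (α - Finsupp.single l 1)))⟫_ℝ =
        (n ! * mfactorial α : ℝ) * α k := by
      intro k hk
      rw [Finset.sum_eq_single_of_mem k hk]
      · rw [inner_kernelLp_succ_term, real_inner_self_eq_norm_sq, real_inner_self_eq_norm_sq,
          m.orthonormal.norm_eq_one, ih (degree_sub_single hk h), mfactorial_eq_mul hk]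
        push_cast
        ring
      · intro l _ hl
        rw [inner_kernelLp_succ_term, m.orthonormal.inner_eq_zero hl.symm, zero_mul, mul_zero]
    rw [← real_inner_self_eq_norm_sq, kernelLp_succ, sum_inner]
    simp only [inner_sum]
    rw [Finset.sum_congr rfl h1, ← Finset.mul_sum, ← Nat.cast_sum, sum_support_eq_degree, h,
      Nat.factorial_succ]
    push_cast
    ring

theorem enorm_kernelLp_sq (m : HilbertBasis ι ℝ (Lp ℝ 2 μ)) {n : ℕ} {α : MultiIndex ι}
    (h : α.degree = n) : ‖kernelLp m n α‖ₑ ^ 2 = n ! * mfactorial α := by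
  rw [enorm_sq_eq_ofReal, norm_kernelLp_sq m h, ENNReal.ofReal_mul (Nat.cast_nonneg _),
    ENNReal.ofReal_natCast, ENNReal.ofReal_natCast]

theorem sum_swapLp_prodLp (m : HilbertBasis ι ℝ (Lp ℝ 2 μ)) (n : ℕ) (β : MultiIndex ι) (k : ι) :
    ∑ p, swapLp p (consLp (prodLp (m k) (kernelLp m n β))) =
      kernelLp m (n + 1) (β + Finsupp.single k 1) := by
  refine Lp.ext ?_
  have h1 : ∀ᵐ z ∂(powMeasure μ (n + 1)), ∀ p ∈ Finset.univ,
      swapLp p (consLp (prodLp (m k) (kernelLp m n β))) z =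
        m k (z p) * kernelFn m n β (fun i => z (Equiv.swap 0 p i.succ)) := by
    rw [Finset.eventually_all]
    intro p _
    filter_upwards [coeFn_swapLp p (consLp (prodLp (m k) (kernelLp m n β))),
      (measurePreserving_swap μ p).quasiMeasurePreserving.ae
        (coeFn_consLp_prodLp (EventuallyEq.refl _ (m k)) (coeFn_kernelLp m n β))] with z h1 h2
    rw [h1, h2, Equiv.swap_apply_left]
    rfl
  filter_upwards [coeFn_kernelLp m (n + 1) (β + Finsupp.single k 1), coeFn_finset_sum Finset.univ
    fun p => swapLp p (consLp (prodLp (m k) (kernelLp m n β))), h1] with z h2 h3 h4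
  rw [h2, h3, ← sum_kernelFn_swap, Finset.sum_congr rfl h4]

end KernelLp

/-! ### Kernels of Skorokhod integrals -/

section KernelStep

open scoped InnerProductSpace

variable {U ι : Type*} [MeasurableSpace U] {μ : Measure U} [SigmaFinite μ]
  {m : HilbertBasis ι ℝ (Lp ℝ 2 μ)} {n : ℕ}

theorem mem_topologicalClosure_of_hasSum {I H : Type*} [NormedAddCommGroup H]
    [InnerProductSpace ℝ H] {W : Submodule ℝ H} {v : I → H} {S : H} (h : HasSum v S)
    (hv : ∀ i, v i ∈ W.topologicalClosure) : S ∈ W.topologicalClosure :=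
  W.isClosed_topologicalClosure.mem_of_tendsto h
    (Eventually.of_forall fun _ => Submodule.sum_mem _ fun i _ => hv i)

theorem tsum_eq_tsum_degree {F : MultiIndex ι → ℝ≥0∞} (h : ∀ α, α.degree ≠ n → F α = 0) :
    ∑' α, F α = ∑' α : {α : MultiIndex ι // α.degree = n}, F α := by
  refine (tsum_subtype_eq_of_support_subset (s := {α : MultiIndex ι | α.degree = n}) ?_).symm
  intro α hα
  by_contra h1
  exact hα (h α h1)

theorem tsum_enorm_kernel_sq (u : GenRV ι) :
    ∑' α, ‖u α • kernelLp m n α‖ₑ ^ 2 = n ! * levelSq n u := by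
  rw [tsum_eq_tsum_degree (n := n), levelSq, ← ENNReal.tsum_mul_left]
  · refine tsum_congr fun α => ?_
    rw [enorm_smul, mul_pow, enorm_kernelLp_sq m α.2]
    ring
  · intro α hα
    simp [kernelLp_of_degree_ne m hα]

theorem pairwise_inner_kernelLp (m : HilbertBasis ι ℝ (Lp ℝ 2 μ)) (n : ℕ) :
    Pairwise fun α β => ⟪kernelLp m n α, kernelLp m n β⟫_ℝ = 0 :=
  fun _ _ h => inner_kernelLp_of_ne m n h

theorem pairwise_inner_smul_kernelLp (m : HilbertBasis ι ℝ (Lp ℝ 2 μ)) (n : ℕ) (u : GenRV ι) :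
    Pairwise fun α β => ⟪u α • kernelLp m n α, u β • kernelLp m n β⟫_ℝ = 0 :=
  fun _ _ h => by simp [inner_smul_left, inner_smul_right, inner_kernelLp_of_ne m n h]

/-- Both sides are convergence along finite sets of multiindices; terms of degree other than `n` are
zero. -/
theorem isKernel_iff {u : GenRV ι} {F : (Fin n → U) → ℝ} (hF : MemLp F 2 (powMeasure μ n)) :
    IsKernel m n u F ↔ HasSum (fun α => u α • kernelLp m n α) (hF.toLp F) := by
  classical
  have h1 : ∀ s : Finset (MultiIndex ι), edist (∑ α ∈ s, u α • kernelLp m n α) (hF.toLp F) =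
      eLpNorm (fun x => F x - ∑ α ∈ s with α.degree = n, u α * symBasis m n α x) 2
        (powMeasure μ n) := by
    intro s
    rw [edist_comm, Lp.edist_def]
    refine eLpNorm_congr_ae ?_
    have h2 : ∀ᵐ x ∂(powMeasure μ n), ∀ α ∈ s,
        (u α • kernelLp m n α : Lp ℝ 2 (powMeasure μ n)) x = u α * symBasis m n α x := by
      rw [Finset.eventually_all]
      intro α _
      filter_upwards [Lp.coeFn_smul (u α) (kernelLp m n α), coeFn_kernelLp m n α] with x h3 h4
      rw [h3, Pi.smul_apply, h4, symBasis_eq_kernelFn, smul_eq_mul]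
    filter_upwards [hF.coeFn_toLp, coeFn_finset_sum s fun α => u α • kernelLp m n α, h2]
      with x h3 h4 h5
    rw [Pi.sub_apply, h3, h4, Finset.sum_congr rfl h5, Finset.sum_filter_of_ne]
    intro α _ hne
    by_contra h6
    apply hne
    rw [symBasis_eq_kernelFn, kernelFn_of_degree_ne m h6, Pi.zero_apply, mul_zero]
  have h3 : HasSum (fun α => u α • kernelLp m n α) (hF.toLp F) ↔
      Tendsto (fun s : Finset (MultiIndex ι) => ∑ α ∈ s, u α • kernelLp m n α) atTop
        (𝓝 (hF.toLp F)) := Iff.rfl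
  rw [h3, tendsto_iff_edist_tendsto_0]
  simp only [h1]
  exact ⟨fun h => h.2, fun h => ⟨hF, h⟩⟩

theorem IsKernel.hasSum {u : GenRV ι} {F : (Fin n → U) → ℝ} (h : IsKernel m n u F) :
    HasSum (fun α => u α • kernelLp m n α) (h.1.toLp F) :=
  (isKernel_iff h.1).1 h

variable {g : U → GenRV ι}

/-- The function `g_β(x) E_β(y)` of `(x, y) ∈ U × U^n`. -/
noncomputable def fieldTerm (m : HilbertBasis ι ℝ (Lp ℝ 2 μ)) (n : ℕ) (hg : MemL2D μ g)
    (β : MultiIndex ι) : Lp ℝ 2 (μ.prod (powMeasure μ n)) :=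
  prodLp ((hg β).toLp _) (kernelLp m n β)

theorem pairwise_inner_fieldTerm (hg : MemL2D μ g) :
    Pairwise fun α β => ⟪fieldTerm m n hg α, fieldTerm m n hg β⟫_ℝ = 0 := fun α β h => by
  simp only [fieldTerm]
  rw [inner_prodLp, inner_kernelLp_of_ne m n h, mul_zero]

theorem enorm_toLp_sq {X : Type*} [MeasurableSpace X] {ν : Measure X} {a : X → ℝ}
    (ha : MemLp a 2 ν) : ‖ha.toLp a‖ₑ ^ 2 = ∫⁻ x, ‖a x‖ₑ ^ 2 ∂ν := by
  rw [enorm_sq_Lp]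
  refine lintegral_congr_ae ?_
  filter_upwards [ha.coeFn_toLp] with x hx
  rw [hx]

theorem enorm_fieldTerm_sq (hg : MemL2D μ g) (β : MultiIndex ι) :
    ‖fieldTerm m n hg β‖ₑ ^ 2 = (∫⁻ x, ‖g x β‖ₑ ^ 2 ∂μ) * ‖kernelLp m n β‖ₑ ^ 2 := by
  rw [fieldTerm, enorm_sq_eq_ofReal, norm_prodLp, mul_pow, ENNReal.ofReal_mul (sq_nonneg _),
    ← enorm_sq_eq_ofReal, ← enorm_sq_eq_ofReal, enorm_toLp_sq]

theorem tsum_enorm_fieldTerm_sq (hg : MemL2D μ g) :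
    ∑' β, ‖fieldTerm m n hg β‖ₑ ^ 2 = n ! * fieldLevelSq μ n g := by
  simp only [enorm_fieldTerm_sq]
  rw [tsum_eq_tsum_degree (n := n), fieldLevelSq, ← ENNReal.tsum_mul_left]
  · refine tsum_congr fun α => ?_
    rw [enorm_kernelLp_sq m α.2]
    ring
  · intro α hα
    simp [kernelLp_of_degree_ne m hα]

theorem summable_fieldTerm (hg : MemL2D μ g) (hfin : fieldLevelSq μ n g < ∞) :
    Summable (fieldTerm m n hg) := by
  refine summable_of_orthogonal (pairwise_inner_fieldTerm hg) ?_
  rw [tsum_enorm_fieldTerm_sq]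
  exact ENNReal.mul_lt_top (ENNReal.natCast_lt_top _) hfin

/-- The sum of all transpositions `0 ↔ p`. -/
noncomputable def sumSwap : Lp ℝ 2 (powMeasure μ (n + 1)) →L[ℝ] Lp ℝ 2 (powMeasure μ (n + 1)) :=
  ∑ p, (swapLp p).toContinuousLinearMap

theorem sumSwap_apply (X : Lp ℝ 2 (powMeasure μ (n + 1))) :
    sumSwap X = ∑ p, swapLp p X := by
  simp [sumSwap]

/-- Expand `g_β` in the basis `m` and apply `sum_swapLp_prodLp` to each `m_k ⊗ E_β`. -/
theorem hasSum_sumSwap_fieldTerm (hg : MemL2D μ g) (β : MultiIndex ι) :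
    HasSum (fun k => (∫ x, g x β * m k x ∂μ) • kernelLp m (n + 1) (β + Finsupp.single k 1))
      (sumSwap (consLp (fieldTerm m n hg β))) := by
  have h1 := (m.hasSum_repr ((hg β).toLp _)).mapL
    (sumSwap.comp (consLp.toContinuousLinearMap.comp (prodCLM (kernelLp m n β))))
  have h2 : ∀ k, m.repr ((hg β).toLp _) k = ∫ x, g x β * m k x ∂μ := by
    intro k
    rw [m.repr_apply_apply, real_inner_comm, inner_Lp_eq]
    refine integral_congr_ae ?_
    filter_upwards [(hg β).coeFn_toLp] with x hx
    rw [hx]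
  change HasSum _ ((sumSwap.comp (consLp.toContinuousLinearMap.comp
    (prodCLM (kernelLp m n β)))) ((hg β).toLp _))
  convert h1 using 2 with k
  rw [map_smul, h2]
  congr 1
  change _ = sumSwap (consLp (prodLp (m k) (kernelLp m n β)))
  rw [sumSwap_apply, sum_swapLp_prodLp]

theorem inner_kernelLp_sumSwap [DecidableEq (MultiIndex ι)] (hg : MemL2D μ g)
    (α β : MultiIndex ι) :
    ⟪kernelLp m (n + 1) α, sumSwap (consLp (fieldTerm m n hg β))⟫_ℝ =
      ∑ k ∈ α.support, if β = α - Finsupp.single k 1 then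
        (∫ x, g x (α - Finsupp.single k 1) * m k x ∂μ) * ‖kernelLp m (n + 1) α‖ ^ 2 else 0 := by
  have h1 := (hasSum_sumSwap_fieldTerm (m := m) (n := n) hg β).mapL
    (innerSL ℝ (kernelLp m (n + 1) α))
  simp only [innerSL_apply_apply, inner_smul_right] at h1
  have h2 : HasSum (fun k => (∫ x, g x β * m k x ∂μ) *
      ⟪kernelLp m (n + 1) α, kernelLp m (n + 1) (β + Finsupp.single k 1)⟫_ℝ)
      (∑ k ∈ α.support, (∫ x, g x β * m k x ∂μ) *
      ⟪kernelLp m (n + 1) α, kernelLp m (n + 1) (β + Finsupp.single k 1)⟫_ℝ) := by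
    refine hasSum_sum_of_ne_finset_zero fun k hk => ?_
    rw [inner_kernelLp_of_ne m (n + 1), mul_zero]
    rintro rfl
    exact hk (mem_support_add_single β k)
  rw [h1.unique h2]
  refine Finset.sum_congr rfl fun k hk => ?_
  split_ifs with h
  · rw [h, sub_single_add hk, real_inner_self_eq_norm_sq]
  · rw [inner_kernelLp_of_ne m (n + 1), mul_zero]
    rintro rfl
    exact h (by simp)

/-- The kernel of the Skorokhod integral is the unnormalised symmetrisation of `X`. Instead of
regrouping the double series over `(β, k)`, the proof checks membership in the closed span of the
`E_α` and compares inner products. -/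
theorem hasSum_skorokhod_kernel (hg : MemL2D μ g) {X : Lp ℝ 2 (μ.prod (powMeasure μ n))}
    (hX : HasSum (fieldTerm m n hg) X) :
    HasSum (fun α => skorokhod m g α • kernelLp m (n + 1) α) (sumSwap (consLp X)) := by
  classical
  have h1 : HasSum (fun β => sumSwap (consLp (fieldTerm m n hg β))) (sumSwap (consLp X)) :=
    hX.mapL (sumSwap.comp consLp.toContinuousLinearMap)
  refine hasSum_of_mem_closure_span (pairwise_inner_kernelLp m (n + 1)) ?_ fun α => ?_
  · refine mem_topologicalClosure_of_hasSum h1 fun β => ?_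
    refine mem_topologicalClosure_of_hasSum (hasSum_sumSwap_fieldTerm hg β) fun k => ?_
    exact Submodule.smul_mem _ _ (Submodule.le_topologicalClosure _
      (Submodule.subset_span (mem_range_self _)))
  · have h2 := h1.mapL (innerSL ℝ (kernelLp m (n + 1) α))
    simp only [innerSL_apply_apply, inner_kernelLp_sumSwap] at h2
    have h3 : HasSum (fun β => ∑ k ∈ α.support, if β = α - Finsupp.single k 1 then
        (∫ x, g x (α - Finsupp.single k 1) * m k x ∂μ) * ‖kernelLp m (n + 1) α‖ ^ 2 else 0)
        (∑ k ∈ α.support,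
          (∫ x, g x (α - Finsupp.single k 1) * m k x ∂μ) * ‖kernelLp m (n + 1) α‖ ^ 2) :=
      hasSum_sum fun k _ => hasSum_ite_eq _ _
    rw [h2.unique h3, skorokhod, Finset.sum_mul]

/-- The kernels `F` are given separately for each `x`, with no measurability in `x`, while `X` is a
limit in `L²` of the product. The bridge is a finite partial sum `S`: on `A` it equals `S - F`, so
its mass there is at most a tail of the series at `x`, and the integrated tail is the tail for `X`.
-/
theorem ae_eq_zero_of_isKernel [Countable ι] (hg : MemL2D μ g)
    (hfin : fieldLevelSq μ n g < ∞) {X : Lp ℝ 2 (μ.prod (powMeasure μ n))}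
    (hX : HasSum (fieldTerm m n hg) X) {A : Set (U × (Fin n → U))} (hA : MeasurableSet A)
    (h : ∀ᵐ x ∂μ, ∃ F, IsKernel m n (g x) F ∧ ∀ᵐ y ∂(powMeasure μ n), (x, y) ∈ A → F y = 0) :
    ∀ᵐ z ∂(μ.prod (powMeasure μ n)), z ∈ A → X z = 0 := by
  have hsum : ∑' β, ‖fieldTerm m n hg β‖ₑ ^ 2 ≠ ∞ := by
    rw [tsum_enorm_fieldTerm_sq]
    exact (ENNReal.mul_lt_top (ENNReal.natCast_lt_top _) hfin).ne
  have key : ∀ s : Finset (MultiIndex ι), ∫⁻ z in A, ‖X z‖ₑ ^ 2 ∂(μ.prod (powMeasure μ n)) ≤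
      2 * (∑' β : {β // β ∉ s}, ‖fieldTerm m n hg β‖ₑ ^ 2 +
        ∑' β : {β // β ∉ s}, ‖fieldTerm m n hg β‖ₑ ^ 2) := by
    intro s
    set S : Lp ℝ 2 (μ.prod (powMeasure μ n)) := ∑ β ∈ s, fieldTerm m n hg β with hS
    have h1 : ∀ᵐ z ∂(μ.prod (powMeasure μ n)),
        A.indicator (fun z => ‖X z‖ₑ ^ 2) z ≤ 2 * (‖(X - S) z‖ₑ ^ 2 +
          A.indicator (fun z => ‖S z‖ₑ ^ 2) z) := by
      filter_upwards [Lp.coeFn_sub X S] with z hz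
      by_cases hzA : z ∈ A
      · rw [indicator_of_mem hzA, indicator_of_mem hzA, hz, Pi.sub_apply]
        refine le_trans (le_of_eq ?_) (enorm_add_sq_le (X z - S z) (S z))
        rw [sub_add_cancel]
      · rw [indicator_of_notMem hzA]
        exact zero_le
    have hmS : AEMeasurable (A.indicator fun z => ‖S z‖ₑ ^ 2) (μ.prod (powMeasure μ n)) :=
      ((Lp.aestronglyMeasurable S).enorm.pow_const 2).indicator hA
    have hmX : AEMeasurable (fun z => ‖(X - S) z‖ₑ ^ 2) (μ.prod (powMeasure μ n)) :=
      (Lp.aestronglyMeasurable (X - S)).enorm.pow_const 2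
    rw [← lintegral_indicator hA]
    refine (lintegral_mono_ae h1).trans ?_
    rw [lintegral_const_mul' _ _ (by simp), lintegral_add_left' hmX, ← enorm_sq_Lp]
    gcongr
    · rw [hS, enorm_sq_sub_sum_of_orthogonal (pairwise_inner_fieldTerm hg) hX]
    · rw [lintegral_prod _ hmS]
      have h2 : ∀ᵐ z ∂(μ.prod (powMeasure μ n)), S z = ∑ β ∈ s, g z.1 β * kernelFn m n β z.2 := by
        have h3 : ∀ᵐ z ∂(μ.prod (powMeasure μ n)), ∀ β ∈ s,
            fieldTerm m n hg β z = g z.1 β * kernelFn m n β z.2 := by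
          rw [Finset.eventually_all]
          exact fun β _ => coeFn_prodLp_of_ae (hg β).coeFn_toLp (coeFn_kernelLp m n β)
        filter_upwards [coeFn_finset_sum s (fieldTerm m n hg), h3] with z h4 h5
        rw [hS, h4, Finset.sum_congr rfl h5]
      -- On the section of `A` at `x` the kernel `F` is zero, hence `|S| = |F - S|` there.
      have h3 : ∀ᵐ x ∂μ, ∫⁻ y, A.indicator (fun z => ‖S z‖ₑ ^ 2) (x, y) ∂(powMeasure μ n) ≤
          ∑' β : {β // β ∉ s}, ‖g x β‖ₑ ^ 2 * ‖kernelLp m n β.1‖ₑ ^ 2 := by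
        filter_upwards [h, Measure.ae_ae_of_ae_prod h2] with x hx hx2
        obtain ⟨F, hF, hFA⟩ := hx
        have h4 := enorm_sq_sub_sum_of_orthogonal (pairwise_inner_smul_kernelLp m n (g x))
          hF.hasSum s
        simp only [enorm_smul, mul_pow] at h4
        rw [← h4, enorm_sq_Lp]
        refine lintegral_mono_ae ?_
        have h5 : ∀ᵐ y ∂(powMeasure μ n), ∀ β ∈ s,
            (g x β • kernelLp m n β : Lp ℝ 2 (powMeasure μ n)) y = g x β * kernelFn m n β y := by
          rw [Finset.eventually_all]
          intro β _
          filter_upwards [Lp.coeFn_smul (g x β) (kernelLp m n β), coeFn_kernelLp m n β]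
            with y h6 h7
          rw [h6, Pi.smul_apply, h7, smul_eq_mul]
        filter_upwards [hx2, hFA, hF.1.coeFn_toLp, h5,
          Lp.coeFn_sub (hF.1.toLp F) (∑ β ∈ s, g x β • kernelLp m n β),
          coeFn_finset_sum s fun β => g x β • kernelLp m n β] with y h6 h7 h8 h9 h10 h11
        by_cases hy : (x, y) ∈ A
        · rw [indicator_of_mem hy, h10, Pi.sub_apply, h8, h7 hy, h11, Finset.sum_congr rfl h9, h6,
            zero_sub, enorm_neg]
        · rw [indicator_of_notMem hy]
          exact zero_le
      refine (lintegral_mono_ae h3).trans (le_of_eq ?_)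
      rw [lintegral_tsum]
      · refine tsum_congr fun β => ?_
        rw [lintegral_mul_const'' _ ((hg β.1).1.enorm.pow_const 2), enorm_fieldTerm_sq]
      · exact fun β => ((hg β.1).1.enorm.pow_const 2).mul_const _
  -- As `s` exhausts the multiindices, both tails tend to zero.
  have h0 : ∫⁻ z in A, ‖X z‖ₑ ^ 2 ∂(μ.prod (powMeasure μ n)) = 0 := by
    have h1 := ENNReal.tendsto_tsum_compl_atTop_zero hsum
    have h2 := ENNReal.Tendsto.const_mul (h1.add h1) (Or.inr ENNReal.ofNat_ne_top) (a := 2)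
    rw [add_zero, mul_zero] at h2
    exact le_antisymm (ge_of_tendsto' h2 key) zero_le
  rw [lintegral_eq_zero_iff' ((Lp.aestronglyMeasurable X).enorm.pow_const 2).restrict,
    EventuallyEq, ae_restrict_iff' hA] at h0
  filter_upwards [h0] with z hz hzA
  simpa using hz hzA

end KernelStep

/-! ### Adapted integrands -/

section Adapted

open scoped InnerProductSpace

variable {V ι : Type*} [MeasurableSpace V] {μ : Measure (ℝ × V)}

/-- The kernel of order `n` of `u` exists and is supported in `([0,t] × V)^n`. -/
def MeasurableAtLevel (m : HilbertBasis ι ℝ (Lp ℝ 2 μ)) (n : ℕ) (t : ℝ) (u : GenRV ι) : Prop :=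
  ∃ F : (Fin n → ℝ × V) → ℝ, IsKernel m n u F ∧
    ∀ᵐ x ∂(powMeasure μ n), (∃ i, t < (x i).1) → F x = 0

variable [SigmaFinite μ] {m : HilbertBasis ι ℝ (Lp ℝ 2 μ)} {n : ℕ} {t : ℝ}

theorem measurableAtLevel_iff {u : GenRV ι} : MeasurableAtLevel m n t u ↔
    ∃ X : Lp ℝ 2 (powMeasure μ n), HasSum (fun α => u α • kernelLp m n α) X ∧
      ∀ᵐ x ∂(powMeasure μ n), (∃ i, t < (x i).1) → X x = 0 := by
  constructor
  · rintro ⟨F, hF, h⟩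
    refine ⟨hF.1.toLp F, hF.hasSum, ?_⟩
    filter_upwards [h, hF.1.coeFn_toLp] with x h1 h2 h3
    rw [h2, h1 h3]
  · rintro ⟨X, hX, h⟩
    refine ⟨X, (isKernel_iff (Lp.memLp X)).2 ?_, h⟩
    rwa [Lp.toLp_coeFn]

theorem MeasurableAtLevel.congr {u v : GenRV ι} (hu : MeasurableAtLevel m n t u)
    (h : ∀ α, α.degree = n → u α = v α) : MeasurableAtLevel m n t v := by
  rw [measurableAtLevel_iff] at hu ⊢
  have h1 : (fun α => u α • kernelLp m n α) = fun α => v α • kernelLp m n α := by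
    funext α
    by_cases hα : α.degree = n
    · rw [h α hα]
    · rw [kernelLp_of_degree_ne m hα, smul_zero, smul_zero]
  rwa [h1] at hu

theorem MeasurableAtLevel.add {u v : GenRV ι} (hu : MeasurableAtLevel m n t u)
    (hv : MeasurableAtLevel m n t v) : MeasurableAtLevel m n t (u + v) := by
  rw [measurableAtLevel_iff] at hu hv ⊢
  obtain ⟨X, hX, hX0⟩ := hu
  obtain ⟨Y, hY, hY0⟩ := hv
  refine ⟨X + Y, ?_, ?_⟩
  · simpa only [Pi.add_apply, add_smul] using hX.add hY
  · filter_upwards [hX0, hY0, Lp.coeFn_add X Y] with x h1 h2 h3 h4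
    rw [h3, Pi.add_apply, h1 h4, h2 h4, add_zero]

theorem MeasurableAtLevel.smul {u : GenRV ι} (c : ℝ) (hu : MeasurableAtLevel m n t u) :
    MeasurableAtLevel m n t (c • u) := by
  rw [measurableAtLevel_iff] at hu ⊢
  obtain ⟨X, hX, hX0⟩ := hu
  refine ⟨c • X, ?_, ?_⟩
  · simpa only [Pi.smul_apply, smul_assoc] using hX.const_smul c
  · filter_upwards [hX0, Lp.coeFn_smul c X] with x h1 h3 h4
    rw [h3, Pi.smul_apply, h1 h4, smul_zero]

theorem measurableAtLevel_zero (u : GenRV ι) : MeasurableAtLevel m 0 t u := by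
  rw [measurableAtLevel_iff]
  refine ⟨u 0 • kernelLp m 0 0, hasSum_single 0 fun α hα => ?_,
    Eventually.of_forall fun x ⟨i, _⟩ => i.elim0⟩
  rw [kernelLp_of_degree_ne m (fun h => hα ((Finsupp.degree_eq_zero_iff α).1 h)), smul_zero]

/-- No single time carries mass, so by Fubini coincidences with the first time form a null set. -/
theorem ae_cons_fst_ne (hμ : ∀ c : ℝ, ∀ᵐ x ∂μ, x.1 ≠ c) (n : ℕ) :
    ∀ᵐ z ∂(powMeasure μ (n + 1)), ∀ j : Fin n, (z j.succ).1 ≠ (z 0).1 := by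
  refine ae_cons (p := fun z : (ℝ × V) × (Fin n → ℝ × V) => ∀ j : Fin n, (z.2 j).1 ≠ z.1.1) ?_
  have hmeas : MeasurableSet
      {z : (ℝ × V) × (Fin n → ℝ × V) | ∀ j : Fin n, (z.2 j).1 ≠ z.1.1} := by
    have : {z : (ℝ × V) × (Fin n → ℝ × V) | ∀ j : Fin n, (z.2 j).1 ≠ z.1.1} =
        ⋂ j : Fin n, {z | (z.2 j).1 = z.1.1}ᶜ := by
      ext z
      simp
    rw [this]
    refine MeasurableSet.iInter fun j => (measurableSet_eq_fun ?_ ?_).compl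
    · exact ((measurable_pi_apply j).comp measurable_snd).fst
    · exact measurable_fst.fst
  rw [Measure.ae_prod_iff_ae_ae hmeas]
  refine Eventually.of_forall fun x => ?_
  rw [ae_all_iff]
  exact fun j => (Measure.quasiMeasurePreserving_eval (fun _ : Fin n => μ) j).ae (hμ x.1)

theorem exists_swap_succ {n : ℕ} {p i : Fin (n + 1)} (h : i ≠ p) :
    ∃ j : Fin n, Equiv.swap 0 p j.succ = i := by
  have h1 : Equiv.swap 0 p i ≠ 0 := by
    intro h2
    apply h
    rw [← Equiv.swap_apply_self 0 p i, h2, Equiv.swap_apply_left]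
  obtain ⟨j, hj⟩ := Fin.exists_succ_eq.2 h1
  exact ⟨j, by rw [hj, Equiv.swap_apply_self]⟩

theorem ae_fst_ne (hμ : ∀ c : ℝ, ∀ᵐ x ∂μ, x.1 ≠ c) (n : ℕ) :
    ∀ᵐ z ∂(powMeasure μ (n + 1)), ∀ p i, i ≠ p → (z i).1 ≠ (z p).1 := by
  rw [ae_all_iff]
  intro p
  filter_upwards [(measurePreserving_swap μ p).quasiMeasurePreserving.ae (ae_cons_fst_ne hμ n)]
    with z hz i hi
  obtain ⟨j, rfl⟩ := exists_swap_succ hi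
  have := hz j
  rwa [Equiv.swap_apply_left] at this

variable [Countable ι] {g : ℝ × V → GenRV ι}

theorem measurableSet_later (n : ℕ) (t : ℝ) : MeasurableSet
    {z : (ℝ × V) × (Fin n → ℝ × V) | t < z.1.1 ∨ ∃ j, z.1.1 < (z.2 j).1} := by
  have : {z : (ℝ × V) × (Fin n → ℝ × V) | t < z.1.1 ∨ ∃ j, z.1.1 < (z.2 j).1} =
      {z | t < z.1.1} ∪ ⋃ j : Fin n, {z | z.1.1 < (z.2 j).1} := by
    ext z
    simp
  rw [this]
  have h1 : Measurable fun z : (ℝ × V) × (Fin n → ℝ × V) => z.1.1 := measurable_fst.fst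
  exact (measurableSet_lt measurable_const h1).union (MeasurableSet.iUnion fun j =>
    measurableSet_lt h1 ((measurable_pi_apply j).comp measurable_snd).fst)

/-- Adaptedness makes `X(x,y)` vanish unless every time in `y` is at most that of `x`; the cutoff
also puts `x` before `t`. Hence copy `p` survives only where the `p`-th time is maximal and at most
`t`. -/
theorem exists_hasSum_fieldTerm_of_adapted (hμ0 : ∀ᵐ x ∂μ, 0 ≤ x.1) (hg : MemL2D μ g)
    (hfin : fieldLevelSq μ n g < ∞) (had : ∀ᵐ x ∂μ, MeasurableAtLevel m n x.1 (g x)) (t : ℝ) :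
    ∃ X, HasSum (fieldTerm m n (hg.indicator (measurableSet_slab 0 t))) X ∧
      ∀ᵐ z ∂(powMeasure μ (n + 1)), ∀ p, (t < (z p).1 ∨ ∃ i, (z p).1 < (z i).1) →
        swapLp p (consLp X) z = 0 := by
  have hg' := hg.indicator (measurableSet_slab 0 t)
  have hfin' : fieldLevelSq μ n ((slab V 0 t).indicator g) < ∞ := by
    refine lt_of_le_of_lt ?_ hfin
    rw [fieldLevelSq_eq_lintegral hg, fieldLevelSq_eq_lintegral hg']
    exact lintegral_mono fun x => levelSq_indicator_le _ _ _ _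
  obtain ⟨X, hX⟩ := summable_fieldTerm (m := m) hg' hfin'
  refine ⟨X, hX, ?_⟩
  have h1 := ae_eq_zero_of_isKernel hg' hfin' hX (measurableSet_later n t) (by
    filter_upwards [had, hμ0] with x hx hx0
    by_cases hxt : x.1 ≤ t
    · rw [indicator_of_mem (mem_slab.2 ⟨hx0, hxt⟩)]
      obtain ⟨F, hF, hF0⟩ := hx
      refine ⟨F, hF, ?_⟩
      filter_upwards [hF0] with y hy h2
      rcases h2 with h2 | h2
      · exact absurd hxt (not_le.2 h2)
      · exact hy h2
    · rw [indicator_of_notMem (fun h => hxt (mem_slab.1 h).2)]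
      refine ⟨0, (isKernel_iff MemLp.zero).2 ?_, by simp⟩
      simp)
  have h2 : ∀ᵐ z ∂(powMeasure μ (n + 1)),
      (t < (z 0).1 ∨ ∃ j : Fin n, (z 0).1 < (z j.succ).1) → consLp X z = 0 := by
    filter_upwards [ae_cons h1, coeFn_consLp X] with z h3 h4 h5
    rw [h4]
    exact h3 h5
  rw [ae_all_iff]
  intro p
  filter_upwards [(measurePreserving_swap μ p).quasiMeasurePreserving.ae h2,
    coeFn_swapLp p (consLp X)] with z h3 h4 h5
  rw [h4]
  apply h3
  rw [Equiv.swap_apply_left]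
  refine h5.imp_right ?_
  rintro ⟨i, hi⟩
  have hne : i ≠ p := by rintro rfl; exact lt_irrefl _ hi
  obtain ⟨j, rfl⟩ := exists_swap_succ hne
  exact ⟨j, hi⟩

/-- If some time exceeds `t`, each copy vanishes: either its own time exceeds `t`, or that other
time is later than its own. -/
theorem measurableAtLevel_skorokhodTo (hμ0 : ∀ᵐ x ∂μ, 0 ≤ x.1) (hg : MemL2D μ g)
    (hfin : fieldLevelSq μ n g < ∞) (had : ∀ᵐ x ∂μ, MeasurableAtLevel m n x.1 (g x)) (t : ℝ) :
    MeasurableAtLevel m (n + 1) t (skorokhodTo m t g) := by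
  obtain ⟨X, hX, h0⟩ := exists_hasSum_fieldTerm_of_adapted hμ0 hg hfin had t
  rw [measurableAtLevel_iff]
  refine ⟨_, hasSum_skorokhod_kernel _ hX, ?_⟩
  rw [sumSwap_apply]
  filter_upwards [h0, coeFn_finset_sum Finset.univ fun p => swapLp p (consLp X)] with z h1 h2 h3
  rw [h2]
  refine Finset.sum_eq_zero fun p _ => h1 p ?_
  obtain ⟨i, hi⟩ := h3
  rcases lt_or_ge t (z p).1 with h4 | h4
  · exact Or.inl h4
  · exact Or.inr ⟨i, h4.trans_lt hi⟩

/-- The Itô isometry at level `n + 1`. The copies are orthogonal because, off ties, the `p`-th and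
`q`-th times cannot both be maximal. Each has squared norm `n! ∫ level_n`, so the total is `(n+1)! ∫
level_n`, and the factorial cancels against the norm of the kernel. -/
theorem levelSq_skorokhodTo_eq (hμ0 : ∀ᵐ x ∂μ, 0 ≤ x.1) (hμ : ∀ c : ℝ, ∀ᵐ x ∂μ, x.1 ≠ c)
    (hg : MemL2D μ g) (hfin : fieldLevelSq μ n g < ∞)
    (had : ∀ᵐ x ∂μ, MeasurableAtLevel m n x.1 (g x)) (t : ℝ) :
    levelSq (n + 1) (skorokhodTo m t g) = ∫⁻ x in slab V 0 t, levelSq n (g x) ∂μ := by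
  have hg' := hg.indicator (measurableSet_slab 0 t)
  obtain ⟨X, hX, h0⟩ := exists_hasSum_fieldTerm_of_adapted hμ0 hg hfin had t
  have horth : Pairwise fun p q => ⟪swapLp p (consLp X), swapLp q (consLp X)⟫_ℝ = 0 := by
    intro p q hpq
    rw [inner_Lp_eq]
    refine integral_eq_zero_of_ae ?_
    filter_upwards [h0, ae_fst_ne hμ n] with z h1 h2
    rcases lt_or_gt_of_ne (h2 q p hpq) with h3 | h3
    · rw [h1 p (Or.inr ⟨q, h3⟩), zero_mul, Pi.zero_apply]
    · rw [h1 q (Or.inr ⟨p, h3⟩), mul_zero, Pi.zero_apply]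
  have hnorm : ∀ p : Fin (n + 1), ‖swapLp p (consLp X)‖ₑ ^ 2 =
      n ! * ∫⁻ x in slab V 0 t, levelSq n (g x) ∂μ := by
    intro p
    rw [enorm_sq_eq_ofReal, LinearIsometry.norm_map, LinearIsometry.norm_map,
      ← enorm_sq_eq_ofReal, enorm_sq_of_orthogonal (pairwise_inner_fieldTerm hg') hX,
      tsum_enorm_fieldTerm_sq, fieldLevelSq_eq_lintegral hg',
      ← lintegral_indicator (measurableSet_slab _ _)]
    congr 1
    refine lintegral_congr fun x => ?_
    by_cases hx : x ∈ slab V 0 t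
    · simp [indicator_of_mem hx]
    · simp [indicator_of_notMem hx]
  have h1 := enorm_sq_of_orthogonal
    (pairwise_inner_smul_kernelLp m (n + 1) (skorokhod m ((slab V 0 t).indicator g)))
    (hasSum_skorokhod_kernel hg' hX)
  have h2 := enorm_sq_of_orthogonal horth (hasSum_fintype _)
  rw [tsum_enorm_kernel_sq, sumSwap_apply, h2, tsum_fintype] at h1
  simp only [hnorm, Finset.sum_const, Finset.card_univ, Fintype.card_fin, nsmul_eq_mul] at h1
  rw [← mul_assoc, ← Nat.cast_mul, ← Nat.factorial_succ] at h1
  exact ((ENNReal.mul_right_inj (Nat.cast_ne_zero.2 (Nat.factorial_ne_zero _))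
    (ENNReal.natCast_ne_top _)).1 h1).symm

end Adapted

/-! ### The adapted case -/

section Moments

variable {U ι : Type*} [MeasurableSpace U] {μ : Measure U}

theorem tsum_eq_tsum_levelSq (u : GenRV ι) :
    ∑' α, (mfactorial α : ℝ≥0∞) * ‖u α‖ₑ ^ 2 = ∑' n, levelSq n u := by
  rw [← (Equiv.sigmaFiberEquiv (Finsupp.degree : MultiIndex ι → ℕ)).tsum_eq]
  exact ENNReal.tsum_sigma'
    fun p : Σ n, {α : MultiIndex ι // α.degree = n} => (mfactorial p.2.1 : ℝ≥0∞) * ‖u p.2.1‖ₑ ^ 2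

theorem lintegral_tsum_levelSq [Countable ι] {g : U → GenRV ι} (hg : MemL2D μ g) :
    ∫⁻ x, ∑' n, levelSq n (g x) ∂μ = ∑' n, fieldLevelSq μ n g := by
  rw [lintegral_tsum fun n => aemeasurable_levelSq hg n]
  exact tsum_congr fun n => (fieldLevelSq_eq_lintegral hg n).symm

theorem levelSq_eq_zero {n : ℕ} {u : GenRV ι} (h : ∀ α, α.degree = n → u α = 0) :
    levelSq n u = 0 := by
  rw [levelSq, ENNReal.tsum_eq_zero]
  rintro ⟨α, hα⟩
  simp [h α hα]

theorem eq_zero_of_degree_succ {w : GenRV ι} (hw : ∀ α, α ≠ 0 → w α = 0) {n : ℕ}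
    {α : MultiIndex ι} (hα : α.degree = n + 1) : w α = 0 :=
  hw α (by rintro rfl; simp at hα)

theorem memS_of_deterministic {w : GenRV ι} (hw : ∀ α, α ≠ 0 → w α = 0) : MemS w := by
  rw [memS_iff]
  intro n
  cases n with
  | zero => rw [levelSq_zero]; exact ENNReal.pow_lt_top enorm_lt_top
  | succ n => rw [levelSq_eq_zero fun α => eq_zero_of_degree_succ hw]; simp

end Moments

/-! ### A Gronwall-type iteration over the levels -/

section Iterate

variable {V : Type*} [MeasurableSpace V] {T : ℝ} {π : Measure V}

/-- `(∫_{[0,t] × V} G² dμ)^k / k!`. -/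
noncomputable def energyPow (G : Lp ℝ 2 (timeMeasure T π)) (k : ℕ) (t : ℝ) : ℝ :=
  slabExp T π (fun (_ : Unit) x => G x ^ 2) (Finsupp.single () k) 0 t

variable (G : Lp ℝ 2 (timeMeasure T π))

theorem integrable_sq_Lp : Integrable (fun x => G x ^ 2) (timeMeasure T π) :=
  (Lp.memLp G).integrable_sq

variable [SigmaFinite π]

theorem energyPow_eq (k : ℕ) {t : ℝ} (ht : 0 ≤ t) :
    energyPow G k t = (∫ x in slab V 0 t, G x ^ 2 ∂(timeMeasure T π)) ^ k / k ! := by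
  rw [energyPow, slabExp, expCoeff, setIntegral_slab_eq ht (integrable_sq_Lp G), mpow, mfactorial,
    Finsupp.prod_single_index (by simp), Finsupp.prod_single_index (by simp)]

theorem energyPow_nonneg (k : ℕ) {t : ℝ} (ht : 0 ≤ t) : 0 ≤ energyPow G k t := by
  rw [energyPow_eq G k ht]
  have : 0 ≤ ∫ x in slab V 0 t, G x ^ 2 ∂(timeMeasure T π) :=
    integral_nonneg fun x => sq_nonneg _
  positivity

/-- This is `slabExp_eq` for a one-element index set and density `G²`: integrating `G² A^k / k!`
yields `A^{k+1} / (k+1)!`. -/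
theorem lintegral_mul_energyPow (k : ℕ) {t : ℝ} (ht : 0 ≤ t) :
    ∫⁻ x in slab V 0 t, ‖G x‖ₑ ^ 2 * ENNReal.ofReal (energyPow G k x.1) ∂(timeMeasure T π) =
      ENNReal.ofReal (energyPow G (k + 1) t) := by
  have hρ : ∀ _ : Unit, Integrable (fun x => G x ^ 2) (timeMeasure T π) :=
    fun _ => integrable_sq_Lp G
  have h1 : energyPow G (k + 1) t =
      ∫ x in slab V 0 t, G x ^ 2 * energyPow G k x.1 ∂(timeMeasure T π) := by
    have h2 := slabExp_eq hρ (Finsupp.single () (k + 1)) ht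
    rw [Finsupp.support_single (hb := k.succ_ne_zero), Finset.sum_singleton,
      ← Finsupp.single_tsub, Nat.add_sub_cancel] at h2
    rw [energyPow, h2, wickOne, if_neg (by simp), zero_add]
    rfl
  obtain ⟨B, hB⟩ := exists_abs_slabExp_le hρ (Finsupp.single () k)
  have h3 : Integrable (fun x => G x ^ 2 * energyPow G k x.1) (timeMeasure T π) :=
    integrable_mul_comp_fst (integrable_sq_Lp G) (continuous_slabExp_right hρ _ 0) (hB 0)
  have h4 : ∀ᵐ x ∂(timeMeasure T π), 0 ≤ G x ^ 2 * energyPow G k x.1 := by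
    filter_upwards [ae_mem_Icc] with x hx
    exact mul_nonneg (sq_nonneg _) (energyPow_nonneg G k hx.1)
  rw [h1, ofReal_integral_eq_lintegral_ofReal h3.integrableOn (ae_restrict_of_ae h4)]
  refine lintegral_congr fun x => ?_
  rw [ENNReal.ofReal_mul (sq_nonneg _), enorm_sq_eq_ofReal, Real.norm_eq_abs, sq_abs]

theorem sum_range_energyPow_le (N : ℕ) {t : ℝ} (ht : 0 ≤ t) :
    ∑ k ∈ Finset.range N, 2 ^ k * ENNReal.ofReal (energyPow G k t) ≤
      ENNReal.ofReal (Real.exp (2 * ∫ x, G x ^ 2 ∂(timeMeasure T π))) := by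
  have h0 : 0 ≤ ∫ x in slab V 0 t, G x ^ 2 ∂(timeMeasure T π) :=
    integral_nonneg fun x => sq_nonneg _
  have h1 : ∀ k, 2 ^ k * ENNReal.ofReal (energyPow G k t) =
      ENNReal.ofReal ((2 * ∫ x in slab V 0 t, G x ^ 2 ∂(timeMeasure T π)) ^ k / k !) := by
    intro k
    rw [energyPow_eq G k ht, mul_pow, mul_div_assoc, ENNReal.ofReal_mul (by positivity),
      ENNReal.ofReal_pow (by norm_num), ENNReal.ofReal_ofNat]
  simp only [h1]
  rw [← ENNReal.ofReal_sum_of_nonneg fun k _ => by positivity]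
  refine ENNReal.ofReal_le_ofReal ((Real.sum_le_exp_of_nonneg (by positivity) N).trans ?_)
  gcongr
  · exact Eventually.of_forall fun x => sq_nonneg _
  · exact integrable_sq_Lp G
  · exact Measure.restrict_le_self

/-- With `B = b + 2 ∑ F`, the partial sums satisfy `S_{N+1}(t) ≤ B + 2 ∫ G² S_N`, which iterates to
`B ∑ (2A)^k / k!`. Finite partial sums avoid presupposing that the full series is finite. -/
theorem sum_range_le_of_iterate {a : ℕ → ℝ → ℝ≥0∞} {F : ℕ → ℝ≥0∞} {b : ℝ≥0∞}
    (hmeas : ∀ n, AEMeasurable (fun x => ‖G x‖ₑ ^ 2 * a n x.1) (timeMeasure T π))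
    (h0 : ∀ t ∈ Icc 0 T, a 0 t ≤ b)
    (hs : ∀ n, ∀ t ∈ Icc 0 T, a (n + 1) t ≤
      2 * ((∫⁻ x in slab V 0 t, ‖G x‖ₑ ^ 2 * a n x.1 ∂(timeMeasure T π)) + F n))
    (N : ℕ) {t : ℝ} (ht : t ∈ Icc 0 T) :
    ∑ n ∈ Finset.range N, a n t ≤
      (b + 2 * ∑' n, F n) * ∑ k ∈ Finset.range N, 2 ^ k * ENNReal.ofReal (energyPow G k t) := by
  induction N generalizing t with
  | zero => simp
  | succ N ih =>
    set B := b + 2 * ∑' n, F n with hB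
    have h1 : ∫⁻ x in slab V 0 t, ‖G x‖ₑ ^ 2 * ∑ n ∈ Finset.range N, a n x.1
        ∂(timeMeasure T π) ≤
        B * ∑ k ∈ Finset.range N, 2 ^ k * ENNReal.ofReal (energyPow G (k + 1) t) := by
      have hE : ∀ k, AEMeasurable (fun x => ‖G x‖ₑ ^ 2 * ENNReal.ofReal (energyPow G k x.1))
          ((timeMeasure T π).restrict (slab V 0 t)) := by
        intro k
        refine (((Lp.aestronglyMeasurable G).enorm.pow_const 2).mul
          (Measurable.aemeasurable ?_)).restrict
        exact (ENNReal.continuous_ofReal.comp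
          (continuous_slabExp_right (fun _ => integrable_sq_Lp G) _ 0)).measurable.comp
            measurable_fst
      have h2 : ∀ᵐ x ∂(timeMeasure T π), ‖G x‖ₑ ^ 2 * ∑ n ∈ Finset.range N, a n x.1 ≤
          ∑ k ∈ Finset.range N,
            B * 2 ^ k * (‖G x‖ₑ ^ 2 * ENNReal.ofReal (energyPow G k x.1)) := by
        filter_upwards [ae_mem_Icc] with x hx
        refine (mul_le_mul_right (ih hx) _).trans_eq ?_
        rw [Finset.mul_sum, Finset.mul_sum]
        exact Finset.sum_congr rfl fun k _ => by ring
      refine (lintegral_mono_ae (ae_restrict_of_ae h2)).trans_eq ?_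
      rw [lintegral_finsetSum' _ fun k _ => (hE k).const_mul _, Finset.mul_sum]
      refine Finset.sum_congr rfl fun k _ => ?_
      rw [lintegral_const_mul'' _ (hE k), lintegral_mul_energyPow G k ht.1, mul_assoc]
    have h3 : ∑ n ∈ Finset.range N, a (n + 1) t ≤
        2 * (∫⁻ x in slab V 0 t, ‖G x‖ₑ ^ 2 * ∑ n ∈ Finset.range N, a n x.1
          ∂(timeMeasure T π)) + 2 * ∑' n, F n := by
      refine (Finset.sum_le_sum fun n _ => hs n t ht).trans ?_
      rw [← Finset.mul_sum, Finset.sum_add_distrib, mul_add]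
      simp only [Finset.mul_sum]
      rw [lintegral_finsetSum' _ fun n _ => (hmeas n).restrict, ← Finset.mul_sum,
        ← Finset.mul_sum]
      gcongr
      exact ENNReal.sum_le_tsum _
    -- The zeroth terms are split off: `a 0 t ≤ b` on the left, and `energyPow G 0 t = 1` on the
    -- right, which releases the free `B`.
    rw [Finset.sum_range_succ', Finset.sum_range_succ' (fun k => 2 ^ k * _)]
    have h4 : energyPow G 0 t = 1 := by simp [energyPow_eq G 0 ht.1]
    rw [h4, mul_add]
    calc _ ≤ (2 * (B * ∑ k ∈ Finset.range N, 2 ^ k * ENNReal.ofReal (energyPow G (k + 1) t)) +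
          2 * ∑' n, F n) + b := by
            gcongr
            · exact h3.trans (by gcongr)
            · exact h0 t ht
      _ = B * ∑ k ∈ Finset.range N, 2 ^ (k + 1) * ENNReal.ofReal (energyPow G (k + 1) t) + B := by
        rw [add_assoc, add_comm _ b, ← hB, mul_left_comm, Finset.mul_sum]
        congr 2
        exact Finset.sum_congr rfl fun k _ => by ring
      _ = _ := by simp

end Iterate

/-! ### The mean square of a field by chaos levels -/

section MeanSquare

variable {V Ω ι : Type*} [MeasurableSpace V] {T : ℝ} {π : Measure V}
  {m : HilbertBasis ι ℝ (Lp ℝ 2 (timeMeasure T π))} {f : ℝ × V → GenRV ι}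
  [MeasurableSpace Ω] {P : Measure Ω} [IsProbabilityMeasure P]
  {N : DrivingField (timeMeasure T π) P} {hB1 : AssumptionB1 N m} {K : MultiIndex ι → Lp ℝ 2 P}
  [Countable ι]

theorem AssumptionB2.meanSquare_eq (hK : AssumptionB2 hB1 K) (hne : ∀ α, K α ≠ 0)
    (hf : MemL2D (timeMeasure T π) f) :
    meanSquare K (timeMeasure T π) f = ∑' n, fieldLevelSq (timeMeasure T π) n f := by
  rw [← lintegral_tsum_levelSq hf]
  exact lintegral_congr fun x => by rw [hK.secondMoment_eq hne, tsum_eq_tsum_levelSq]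

theorem AssumptionB2.memSH (hK : AssumptionB2 hB1 K) (hne : ∀ α, K α ≠ 0)
    (hf : MemL2D (timeMeasure T π) f) (hfin : meanSquare K (timeMeasure T π) f < ∞) :
    MemSH (timeMeasure T π) f := by
  rw [hK.meanSquare_eq hne hf] at hfin
  exact memSH_iff.2 fun n => (ENNReal.le_tsum n).trans_lt hfin

end MeanSquare

/-! ### Adaptedness and moments of the solution -/

section AdaptedSolution

variable {V ι : Type*} [MeasurableSpace V] {T : ℝ} {π : Measure V}
  {m : HilbertBasis ι ℝ (Lp ℝ 2 (timeMeasure T π))} {G : Lp ℝ 2 (timeMeasure T π)} {w : GenRV ι}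
  {f : ℝ × V → GenRV ι} {u : ℝ → GenRV ι}

theorem ae_fst_ne_const (c : ℝ) : ∀ᵐ x ∂(timeMeasure T π), x.1 ≠ c := by
  have h1 : ∀ᵐ r ∂((volume : Measure ℝ).restrict (Icc 0 T)), r ≠ c := by
    rw [ae_iff]
    simp
  exact Measure.quasiMeasurePreserving_fst.ae h1

variable [SigmaFinite π]

theorem ae_measurableAtLevel_integrand (had : AdaptedField m f) {n : ℕ}
    (hun : ∀ t ∈ Icc 0 T, MeasurableAtLevel m n t (u t)) :
    ∀ᵐ x ∂(timeMeasure T π), MeasurableAtLevel m n x.1 (G x • u x.1 + f x) := by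
  filter_upwards [had, ae_mem_Icc] with x h1 h2
  exact ((hun _ h2).smul _).add (h1 n)

variable [Countable ι]

/-- Induction on the order: the kernel of order `n + 1` of `u` depends only on the order `n` of the
adapted integrand, and `w` contributes at order zero alone. -/
theorem IsSolution.measurableAtLevel (hf : MemL2D (timeMeasure T π) f)
    (hw : ∀ α, α ≠ 0 → w α = 0) (hfS : MemSH (timeMeasure T π) f) (had : AdaptedField m f)
    (hu : IsSolution m T G w f u) (n : ℕ) :
    ∀ t ∈ Icc 0 T, MeasurableAtLevel m n t (u t) := by
  induction n with
  | zero => exact fun t _ => measurableAtLevel_zero (u t)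
  | succ n ih =>
    intro t ht
    have h1 := measurableAtLevel_skorokhodTo (ae_mem_Icc.mono fun x hx => hx.1)
      (memL2D_integrand hf hu.1) (fieldLevelSq_integrand_lt_top (G := G) hf hu.1
        (memSH_iff.1 hfS n) (hu.levelBounded hf (memS_of_deterministic hw) hfS n))
      (ae_measurableAtLevel_integrand had ih) t
    refine h1.congr fun α hα => ?_
    rw [hu.2 t ht, sdeMap, Pi.add_apply, eq_zero_of_degree_succ hw hα, zero_add]

/-- The isometry bounds the level without the factor `n + 1`; the `2` comes only from splitting `G u
+ f`. -/
theorem IsSolution.levelSq_succ_le (hf : MemL2D (timeMeasure T π) f)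
    (hw : ∀ α, α ≠ 0 → w α = 0) (hfS : MemSH (timeMeasure T π) f) (had : AdaptedField m f)
    (hu : IsSolution m T G w f u) (n : ℕ) {t : ℝ} (ht : t ∈ Icc 0 T) :
    levelSq (n + 1) (u t) ≤ 2 * ((∫⁻ x in slab V 0 t, ‖G x‖ₑ ^ 2 * levelSq n (u x.1)
      ∂(timeMeasure T π)) + fieldLevelSq (timeMeasure T π) n f) := by
  have h1 := levelSq_skorokhodTo_eq (ae_mem_Icc.mono fun x hx => hx.1) ae_fst_ne_const
      (memL2D_integrand hf hu.1) (fieldLevelSq_integrand_lt_top (G := G) hf hu.1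
        (memSH_iff.1 hfS n) (hu.levelBounded hf (memS_of_deterministic hw) hfS n))
      (ae_measurableAtLevel_integrand had (hu.measurableAtLevel hf hw hfS had n)) t
  have h2 : levelSq (n + 1) (u t) =
      levelSq (n + 1) (skorokhodTo m t fun x => G x • u x.1 + f x) := by
    refine tsum_congr fun α => ?_
    rw [hu.2 t ht, sdeMap, Pi.add_apply, eq_zero_of_degree_succ hw α.2, zero_add]
  rw [h2, h1, fieldLevelSq_eq_lintegral hf]
  refine (lintegral_mono fun x => levelSq_add_le n (G x • u x.1) (f x)).trans ?_
  rw [lintegral_const_mul' _ _ (by simp),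
    lintegral_add_right' _ (aemeasurable_levelSq hf n).restrict]
  simp only [levelSq_smul]
  gcongr
  exact Measure.restrict_le_self

theorem IsSolution.tsum_levelSq_le (hf : MemL2D (timeMeasure T π) f)
    (hw : ∀ α, α ≠ 0 → w α = 0) (hfS : MemSH (timeMeasure T π) f) (had : AdaptedField m f)
    (hu : IsSolution m T G w f u) {t : ℝ} (ht : t ∈ Icc 0 T) :
    ∑' n, levelSq n (u t) ≤ (‖w 0‖ₑ ^ 2 + 2 * ∑' n, fieldLevelSq (timeMeasure T π) n f) *
      ENNReal.ofReal (Real.exp (2 * ∫ x, G x ^ 2 ∂(timeMeasure T π))) := by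
  refine ENNReal.tsum_le_of_sum_range_le fun N => ?_
  refine (sum_range_le_of_iterate G (a := fun n t => levelSq n (u t)) (b := ‖w 0‖ₑ ^ 2)
    (fun n => ?_) (fun s hs => ?_)
    (fun n s hs => hu.levelSq_succ_le hf hw hfS had n hs) N ht).trans ?_
  · simp only [← levelSq_smul]
    exact aemeasurable_levelSq (g := fun x => G x • u x.1)
      (fun α => memLp_mul_comp_fst G (hu.1 α)) n
  · rw [levelSq_zero, hu.2 s hs, sdeMap_apply]
    simp
  · gcongr
    exact sum_range_energyPow_le G N ht.1

theorem memCS_picard (hf : MemL2D (timeMeasure T π) f) (hfS : MemSH (timeMeasure T π) f)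
    (hw : MemS w) (n : ℕ) : MemCS T (picard m G w f n) := by
  cases n with
  | zero =>
    rw [picard_zero_eq]
    exact memCS_of_eq_sdeMap hf hw hfS (fun α => continuousOn_const)
      (fun n => ⟨0, by simp, fun t _ => (levelSq_zero_right n).le⟩) fun t _ => rfl
  | succ n =>
    exact memCS_of_eq_sdeMap hf hw hfS (memCD_picard hf n) (levelBounded_picard hf hw hfS n)
      fun t _ => rfl

theorem IsSolution.memCS (hf : MemL2D (timeMeasure T π) f) (hfS : MemSH (timeMeasure T π) f)
    (hw : MemS w) (hu : IsSolution m T G w f u) : MemCS T u :=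
  memCS_of_eq_sdeMap hf hw hfS hu.1 (hu.levelBounded hf hw hfS) hu.2

variable {Ω : Type*} [MeasurableSpace Ω] {P : Measure Ω} [IsProbabilityMeasure P]
  {N : DrivingField (timeMeasure T π) P} {hB1 : AssumptionB1 N m}
  {K : MultiIndex ι → Lp ℝ 2 P}

theorem IsSolution.secondMoment_le (hK : AssumptionB2 hB1 K) (hne : ∀ α, K α ≠ 0)
    (hf : MemL2D (timeMeasure T π) f) (hw : ∀ α, α ≠ 0 → w α = 0) (had : AdaptedField m f)
    (hfin : meanSquare K (timeMeasure T π) f < ∞) (hu : IsSolution m T G w f u) {t : ℝ}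
    (ht : t ∈ Icc 0 T) :
    secondMoment K (u t) ≤ (2 * (Real.exp (2 * ∫ x, G x ^ 2 ∂(timeMeasure T π))).toNNReal : ℝ≥0) *
      (‖w 0‖ₑ ^ 2 + meanSquare K (timeMeasure T π) f) := by
  rw [hK.secondMoment_eq hne, tsum_eq_tsum_levelSq]
  refine (hu.tsum_levelSq_le hf hw (hK.memSH hne hf hfin) had ht).trans ?_
  rw [← hK.meanSquare_eq hne hf, mul_comm, ENNReal.coe_mul, mul_comm (ENNReal.ofNNReal 2),
    mul_assoc, mul_add (ENNReal.ofNNReal 2)]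
  have h1 : ‖w 0‖ₑ ^ 2 ≤ 2 * ‖w 0‖ₑ ^ 2 := by
    rw [two_mul]
    exact le_self_add
  exact mul_le_mul' le_rfl (add_le_add h1 le_rfl)

end AdaptedSolution

end WickSDE

/-! ### The proposition -/

theorem mainTheorem4 {V : Type*} [MeasurableSpace V]
    (T : ℝ) (hT : 0 < T) (π : Measure V) [SigmaFinite π] (G : Lp ℝ 2 (timeMeasure T π)) :
    ∃ C : ℝ≥0, ∀ (Ω ι : Type*) [MeasurableSpace Ω] [Countable ι]
      (P : Measure Ω) [IsProbabilityMeasure P]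
      (N : DrivingField (timeMeasure T π) P)
      (m : HilbertBasis ι ℝ (Lp ℝ 2 (timeMeasure T π)))
      (hB1 : AssumptionB1 N m)
      (K : MultiIndex ι → Lp ℝ 2 P) (_ : AssumptionB2 hB1 K) (_ : ∀ α, K α ≠ 0)
      (w : GenRV ι) (f : ℝ × V → GenRV ι) (_ : MemL2D (timeMeasure T π) f),
      ∃ u : ℝ → GenRV ι,
        -- (i) existence, uniqueness, and the two explicit forms of the solution
        IsSolution m T G w f u ∧
        (∀ v, IsSolution m T G w f v → ∀ t ∈ Icc 0 T, v t = u t) ∧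
        (∀ t ∈ Icc 0 T,
          u t = wick w (wickExp (sliceNoise N K G 0 t)) +
            skorokhodTo m t (fun x => wick (wickExp (sliceNoise N K G x.1 t)) (f x))) ∧
        (∀ t ∈ Icc 0 T, u t = forcingCoeff m G f t + initialCoeff m G w t) ∧
        -- (ii) Picard iterations: convergence, explicit form, regularity
        (∀ n, MemCD T (picard m G w f n)) ∧
        (∀ v : MultiIndex ι →₀ ℝ,
          TendstoUniformlyOn (fun n t => pairing (picard m G w f n t) v)
            (fun t => pairing (u t) v) atTop (Icc 0 T)) ∧
        (∀ n, ∀ t ∈ Icc 0 T,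
          picard m G w f n t = wick w (wickExpTrunc n (sliceNoise N K G 0 t)) +
            skorokhodTo m t (fun x => wick (wickExpTrunc n (sliceNoise N K G x.1 t)) (f x))) ∧
        (MemSH (timeMeasure T π) f → MemS w →
          (∀ n, MemCS T (picard m G w f n)) ∧ MemCS T u) ∧
        -- (iii) the general second moment bound
        (⨆ t ∈ Icc 0 T, secondMoment K (u t)) ≤
          2 * (initialNormSq m T G w + forcingNormSq m T G f) ∧
        -- (iv) the adapted case
        ((∀ α, α ≠ 0 → w α = 0) → AdaptedField m f → meanSquare K (timeMeasure T π) f < ∞ →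
          AdaptedProcess m T u ∧
          (∀ t ∈ Icc 0 T, secondMoment K (u t) < ∞) ∧
          (⨆ t ∈ Icc 0 T, secondMoment K (u t)) ≤
            C * (‖w 0‖ₑ ^ 2 + meanSquare K (timeMeasure T π) f)) := by
  -- The exponential comes from the iteration over levels, the leading `2` from the coefficient of
  -- the forcing term. The constant depends on `G` only through `∫ G² dμ`, so it is fixed before the
  -- noise and its basis.
  refine ⟨2 * (Real.exp (2 * ∫ x, G x ^ 2 ∂(timeMeasure T π))).toNNReal, ?_⟩
  intro Ω ι _ _ P _ N m hB1 K hK hne w f hf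
  have hu := isSolution_solution (m := m) (G := G) (w := w) hf
  refine ⟨solution m G w f, hu, fun v hv t ht => hv.unique hu ht,
    fun t ht => solution_eq_wick hK ht.1, fun t ht => solution_eq_coeff ht.1,
    memCD_picard hf, tendstoUniformlyOn_picard hf, fun n t ht => picard_eq_wick hK hf n ht.1,
    fun hfS hw => ⟨memCS_picard hf hfS hw, hu.memCS hf hfS hw⟩,
    iSup_secondMoment_solution_le hK hne, fun hw had hfin => ?_⟩
  have h1 := fun t (ht : t ∈ Icc 0 T) => hu.secondMoment_le hK hne hf hw had hfin ht
  refine ⟨fun t ht n => hu.measurableAtLevel hf hw (hK.memSH hne hf hfin) had n t ht,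
    fun t ht => (h1 t ht).trans_lt ?_, iSup₂_le h1⟩
  exact ENNReal.mul_lt_top ENNReal.coe_lt_top
    (ENNReal.add_lt_top.2 ⟨ENNReal.pow_lt_top enorm_lt_top, hfin⟩)
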